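/- **Setting.** Let $\mathbb X$ be a finite set, $\varepsilon,\beta,T>0$, and let $\mathcal H$ be the Hilbert space with orthogonal basis $\{|x\rangle\}_{x\in\mathbb X}$, $\langle x|x\rangle=\varepsilon^{-1}$, with creation and annihilation operators $a^*(x),a(x)$ on the fermionic Fock space $\mathcal F=\bigwedge\mathcal H$. Write $\int dx=\varepsilon\sum_{x\in\mathbb X}$, $(f,g)=\int dx\,f(x)g(x)$, and let one-particle operators $M$ act by $(Mf)(x)=\sum_y M_{xy}f(y)$. Let $A,B,Q$ be hermitian, $B\ge0$, $A_\pm=A\pm iB$, $\rho_0=e^{-\beta(a^*,Qa)}$ and $H=(a^*,A_-a)+V$, where $$V=V(a^*,a)=\sum_{m,\bar m}\int d^mx\,d^{\bar m}y\;v_{m,\bar m}(x;y)\,a^*(y_1)\cdots a^*(y_{\bar m})\,a(x_1)\cdots a(x_m)$$ is normal, even ($v_{m,\bar m}=0$ for $m+\bar m$ odd), without constant term ($v_{0,0}=0$), with $v_{m,\bar m}$ antisymmetric in the $x$ and in the $y$. $V^\dagger(\bar\psi,\psi)$ denotes the normal ordered polynomial of the adjoint operator $V^\dagger$. Let $c^\pm(x)$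 be generators of a Grassmann algebra $\mathbb C\{c^+,c^-\}$ that anticommute with all $a,a^*$, and $$Z(c^-,c^+)=\mathrm{Tr}\big(e^{iH^\dagger T}e^{(c^+,a^*)}e^{(c^-,a)}e^{-iHT}\rho_0\big).$$ For $N\ge1$ let $U_N=e^{-iA_-T/N}$, and let $G^{(N)}$ be the inverse of the (invertible) matrix on $\{+,-\}\times\{1,\dots,N+1\}\times\mathbb X$ with the blocks $$\big(G^{(N)}_{\rho\sigma}\big)^{-1}_{mn}=\delta_{\rho\sigma}\delta_{mn}-\delta_{\rho-}\delta_{\sigma-}\delta_{m,n-1}U_N^\dagger-\delta_{\rho+}\delta_{\sigma+}\delta_{m-1,n}U_N-\delta_{\rho-}\delta_{\sigma+}\delta_{m,N+1}\delta_{n,N+1}+\delta_{\rho+}\delta_{\sigma-}\delta_{m1}\delta_{n1}e^{-\beta Q}.$$ For Grassmann generators $\bar\psi^\sigma_m(x),\psi^\sigma_m(x)$ put $$\mathcal V^{(N)}=\frac TN\Big(\sum_{k=1}^N V(\bar\psi^+_{k+1},\psi^+_k)-\sum_{\ell=2}^{N+1}V^\dagger(\bar\psi^-_{\ell-1},\psi^-_\ell)\Big),$$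 $$(\mu_{G}*f)(\bar\eta,\eta)=\det(G)\int D(\bar\psi,\psi)\,e^{-(\bar\psi,G^{-1}\psi)}f(\bar\psi+\bar\eta,\psi+\eta),\qquad D(\bar\psi,\psi)=\prod\varepsilon^{-1}d\bar\psi\,d\psi,$$ where the product and $(\bar\psi,G^{-1}\psi)=\varepsilon\sum\bar\psi\,G^{-1}\psi$ run over $\{+,-\}\times\{1,\dots,N+1\}\times\mathbb X$, and let the source-dependent fields be $$\bar\zeta^{(N)}_{\sigma,m}(x)=\sum_{y}G^{(N)}\big((+,N+1,y),(\sigma,m,x)\big)c^-(y),\qquad \zeta^{(N)}_{\sigma,m}(x)=-\sum_y G^{(N)}\big((\sigma,m,x),(-,N+1,y)\big)c^+(y).$$ **Theorem.** Let $f_\beta=\big(1+e^{-\beta Q}e^{iA_+T}e^{-iA_-T}\big)^{-1}e^{-\beta Q}e^{iA_+T}e^{-iA_-T}$; the inverse exists. Then $$Z(c^-,c^+)=\det\!\big(1+e^{-\beta Q}e^{iA_+T}e^{-iA_-T}\big)\;e^{(c^-,\,e^{-iA_-T}f_\beta e^{iA_-T}c^+)}\;\lim_{N\to\infty}\big(\mu_{G^{(N)}}*e^{-i\mathcal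 V^{(N)}}\big)\big(\bar\zeta^{(N)},\zeta^{(N)}\big),$$ where the limit exists in any norm on $\mathbb C\{c^+,c^-\}$. -/

import Mathlib

open scoped Matrix

namespace Keldysh

noncomputable section

/-! ### Grassmann algebras and Grassmann Gaussian convolution -/

/-- The Grassmann algebra over `ℂ` with anticommuting generators labelled by `J`. -/
abbrev Grass (J : Type*) : Type _ := ExteriorAlgebra ℂ (J → ℂ)

/-- The generator with label `j`. -/
def gen {J : Type*} [DecidableEq J] (j : J) : Grass J :=
  ExteriorAlgebra.ι ℂ (Pi.single j (1 : ℂ))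

/-- The exponential `∑ xⁿ / n!` of a nilpotent element. In the Grassmann setting, it is only
applied to even elements without constant term; these are nilpotent. -/
def gexp {R : Type*} [Ring R] [Module ℚ R] (x : R) : R := IsNilpotent.exp x

/-- Linear substitution of the generators: the algebra homomorphism that sends the generator `j`
to `∑ k, w j k • gen k`. -/
def subst {J J' : Type*} [Fintype J] (w : J → J' → ℂ) : Grass J →ₐ[ℂ] Grass J' :=
  ExteriorAlgebra.map (Fintype.linearCombination ℂ w)

/-- The left derivative (an antiderivation) with respect to the generator `j`. -/
def leftDeriv {J : Type*} (j : J) : Module.End ℂ (Grass J) :=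
  CliffordAlgebra.contractLeft (LinearMap.proj j : (J → ℂ) →ₗ[ℂ] ℂ)

/-- `∫ dψ̄_k dψ_k`, where `Sum.inl (Sum.inl k)` labels `ψ̄_k` and `Sum.inl (Sum.inr k)` labels
`ψ_k`. The labels `Sum.inr _` are spectators. -/
def pairIntegral {K J : Type*} (k : K) : Module.End ℂ (Grass ((K ⊕ K) ⊕ J)) :=
  leftDeriv (Sum.inl (Sum.inl k)) * leftDeriv (Sum.inl (Sum.inr k))

theorem leftDeriv_anticomm {J : Type*} (i j : J) :
    leftDeriv i * leftDeriv j = -(leftDeriv j * leftDeriv i) := by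
  ext x
  exact CliffordAlgebra.contractLeft_comm _ _ _

theorem commute_of_anticomm {R : Type*} [Ring R] {a b c d : R} (h1 : b * c = -(c * b))
    (h2 : b * d = -(d * b)) (h3 : a * c = -(c * a)) (h4 : a * d = -(d * a)) :
    Commute (a * b) (c * d) := by
  calc a * b * (c * d) = a * (b * c) * d := by simp only [mul_assoc]
    _ = -((a * c) * (b * d)) := by rw [h1]; simp only [mul_assoc, mul_neg, neg_mul]
    _ = -(c * (a * d) * b) := by rw [h2, h3]; simp only [mul_assoc, mul_neg, neg_mul, neg_neg]
    _ = c * d * (a * b) := by rw [h4]; simp only [mul_assoc, mul_neg, neg_mul, neg_neg]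

theorem pairIntegral_commute {K J : Type*} (k l : K) :
    Commute (pairIntegral (J := J) k) (pairIntegral l) :=
  commute_of_anticomm (leftDeriv_anticomm _ _) (leftDeriv_anticomm _ _) (leftDeriv_anticomm _ _)
    (leftDeriv_anticomm _ _)

/-- The Grassmann (Berezin) integral `∫ ∏ₖ dψ̄_k dψ_k`. The value contains only spectators, and is
regarded as an element of the algebra generated by them. -/
def berezin {K J : Type*} [Fintype K] [Fintype J] [DecidableEq J] :
    Grass ((K ⊕ K) ⊕ J) →ₗ[ℂ] Grass J :=
  (subst (Sum.elim (fun _ => 0) (fun j => Pi.single j 1))).toLinearMap ∘ₗ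
    Finset.univ.noncommProd (fun k : K => pairIntegral (J := J) k)
      (fun k _ l _ _ => pairIntegral_commute k l)

/-- `(φ, M χ) = ε ∑_{x,y} φ(x) M_{xy} χ(y)`. -/
def pairing {X R : Type*} [Fintype X] [Ring R] [Algebra ℂ R] (ε : ℝ) (M : Matrix X X ℂ)
    (φ χ : X → R) : R :=
  (ε : ℂ) • ∑ x, ∑ y, M x y • (φ x * χ y)

/-- Grassmann Gaussian convolution with the covariance `G`,
`(μ_G * f)(η̄,η) = det G ∫ D(ψ̄,ψ) e^{-(ψ̄, G⁻¹ ψ)} f(ψ̄ + η̄, ψ + η)`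
with `D(ψ̄,ψ) = ε^{-|K|} ∏ₖ dψ̄_k dψ_k`. In `Grass (K ⊕ K)`, `Sum.inl` labels the barred
generators, and `Sum.inr` the unbarred ones. In the doubled algebra, `Sum.inl i` is the integration
variable and `Sum.inr i` the external variable with label `i`. -/
def gaussConv {K : Type*} [Fintype K] [DecidableEq K] (ε : ℝ) (G : Matrix K K ℂ)
    (f : Grass (K ⊕ K)) : Grass (K ⊕ K) :=
  (G.det * ((ε : ℂ) ^ Fintype.card K)⁻¹) •
    berezin
      (gexp (-pairing ε G⁻¹ (fun k => gen (Sum.inl (Sum.inl k))) (fun k => gen (Sum.inl (Sum.inr k))))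
        * subst (fun i => Pi.single (Sum.inl i) 1 + Pi.single (Sum.inr i) 1) f)

/-! ### The fermion system -/

/-- The data of the system: lattice constant `ε`, inverse temperature `β`, time `T`, one-particle
operators `A`, `B` (Hamiltonian) and `Q` (initial state) as matrices `(M f)(x) = ∑ y, M x y * f y`,
and interaction vertices `v m m' (x₁,…,x_m; y₁,…,y_m')`. -/
structure Data (X : Type*) where
  ε : ℝ
  β : ℝ
  T : ℝ
  A : Matrix X X ℂ
  B : Matrix X X ℂ
  Q : Matrix X X ℂ
  v : (m m' : ℕ) → (Fin m → X) → (Fin m' → X) → ℂ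

/-- The normal ordered polynomial with vertices `v`, evaluated at the fields `φbar`, `φ`:
`∑_{m,m'} ∫dᵐx ∫dᵐ'y v_{m,m'}(x;y) φbar(y₁)⋯φbar(y_m') φ(x₁)⋯φ(x_m)`, with `∫dx = ε ∑_x`.
The vertices that are antisymmetric in the `x` and in the `y` vanish if `m` or `m'` exceeds the
number of points, so that this is the sum over all `m`, `m'`. -/
def normalPoly {X R : Type*} [Fintype X] [Ring R] [Algebra ℂ R] (ε : ℝ)
    (v : (m m' : ℕ) → (Fin m → X) → (Fin m' → X) → ℂ) (φbar φ : X → R) : R :=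
  ∑ m ∈ Finset.range (Fintype.card X + 1), ∑ m' ∈ Finset.range (Fintype.card X + 1),
    ∑ x : Fin m → X, ∑ y : Fin m' → X, ((ε : ℂ) ^ (m + m') * v m m' x y) •
      ((List.ofFn fun j => φbar (y j)).prod * (List.ofFn fun i => φ (x i)).prod)

/-- The vertices of the adjoint `V†` of the operator with vertices `v`: the adjoint of
`a*(y₁)⋯a*(y_m') a(x₁)⋯a(x_m)` is `a*(x_m)⋯a*(x₁) a(y_m')⋯a(y₁)`. -/
def adjVertex {X : Type*} (v : (m m' : ℕ) → (Fin m → X) → (Fin m' → X) → ℂ) :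
    (m m' : ℕ) → (Fin m → X) → (Fin m' → X) → ℂ :=
  fun m m' x y => starRingEnd ℂ (v m' m (y ∘ Fin.rev) (x ∘ Fin.rev))

/-- Annihilation operator `a(x)` on the fermionic Fock space, in the orthonormal occupation number
basis labelled by the sets `S` of occupied points. With `|x⟩` normalized to `⟨x|x⟩ = ε⁻¹`, one has
`{a(x), a*(y)} = ε⁻¹ δ_{xy}`. The linear order on `X` only fixes the signs of the basis vectors. -/
def annih {X : Type*} [LinearOrder X] (ε : ℝ) (x : X) : Matrix (Finset X) (Finset X) ℂ :=
  Matrix.of fun S S' =>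
    if x ∉ S ∧ S' = insert x S then ((√ε)⁻¹ : ℝ) * (-1) ^ (S.filter (· < x)).card else 0

/-- Creation operator `a*(x)`, the adjoint of `a(x)`. -/
def creat {X : Type*} [LinearOrder X] (ε : ℝ) (x : X) : Matrix (Finset X) (Finset X) ℂ :=
  (annih ε x)ᴴ

/-- Labels of the sources: `Sum.inl x` for `c⁺(x)` and `Sum.inr x` for `c⁻(x)`. -/
abbrev Source (X : Type*) : Type _ := X ⊕ X

def cPlus {X : Type*} [DecidableEq X] (x : X) : Grass (Source X) := gen (Sum.inl x)

def cMinus {X : Type*} [DecidableEq X] (x : X) : Grass (Source X) := gen (Sum.inr x)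

/-- Operators on Fock space with coefficients in the Grassmann algebra of the sources. -/
abbrev SourceOp (X : Type*) : Type _ := Matrix (Finset X) (Finset X) (Grass (Source X))

/-- Fock space operators as operators with source-valued coefficients. -/
def liftOp {X : Type*} (M : Matrix (Finset X) (Finset X) ℂ) : SourceOp X :=
  M.map (algebraMap ℂ (Grass (Source X)))

/-- An odd element `c` of the source algebra as an operator: it is multiplied by the
fermion parity `(-1)^N`, so that it anticommutes with all `a(x)` and `a*(x)`. This realizes the graded tensor product of the
source algebra and the operators on Fock space, and since odd operators have trace zero, the matrix
trace of (a monomial in the sources) times an operator of the same parity is the monomial times the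
trace over Fock space. -/
def sourceOp {X : Type*} [DecidableEq X] (c : Grass (Source X)) : SourceOp X :=
  Matrix.diagonal fun S => (-1) ^ S.card * c

namespace Data

variable {X : Type*} [Fintype X] [LinearOrder X] (D : Data X)

/-- The interaction `V` as an operator on Fock space. -/
def V : Matrix (Finset X) (Finset X) ℂ := normalPoly D.ε D.v (creat D.ε) (annih D.ε)

/-- `A₊ = A + iB`. -/
def Aplus : Matrix X X ℂ := D.A + Complex.I • D.B

/-- `A₋ = A - iB`. -/
def Aminus : Matrix X X ℂ := D.A - Complex.I • D.B

/-- `H = H₀ + V`, `H₀ = (a*, (A - iB) a)`. -/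
def H : Matrix (Finset X) (Finset X) ℂ := pairing D.ε D.Aminus (creat D.ε) (annih D.ε) + D.V

/-- The unnormalized initial state `ρ₀ = e^{-β (a*, Q a)}`. -/
def rho0 : Matrix (Finset X) (Finset X) ℂ :=
  NormedSpace.exp (-(D.β : ℂ) • pairing D.ε D.Q (creat D.ε) (annih D.ε))

/-- The generating functional
`Z(c⁻,c⁺) = Tr(e^{iH†T} e^{(c⁺,a*)} e^{(c⁻,a)} e^{-iHT} ρ₀)`. -/
def Z : Grass (Source X) :=
  Matrix.trace
    (liftOp (NormedSpace.exp ((Complex.I * D.T) • D.Hᴴ))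
      * gexp (pairing D.ε 1 (fun x => sourceOp (cPlus x)) (fun x => liftOp (creat D.ε x)))
      * gexp (pairing D.ε 1 (fun x => sourceOp (cMinus x)) (fun x => liftOp (annih D.ε x)))
      * liftOp (NormedSpace.exp ((-Complex.I * D.T) • D.H))
      * liftOp D.rho0)

/-! ### One-particle quantities and the discretized Keldysh covariance -/

/-- `e^{-βQ} e^{iA₊T} e^{-iA₋T}`. -/
def W : Matrix X X ℂ :=
  NormedSpace.exp (-(D.β : ℂ) • D.Q) * NormedSpace.exp ((Complex.I * D.T) • D.Aplus)
    * NormedSpace.exp ((-Complex.I * D.T) • D.Aminus)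

/-- `f_β = (1 + W)⁻¹ W`. -/
def fBeta : Matrix X X ℂ := (1 + D.W)⁻¹ * D.W

/-- `e^{-iA₋T} f_β e^{iA₋T}`. -/
def sourceKernel : Matrix X X ℂ :=
  NormedSpace.exp ((-Complex.I * D.T) • D.Aminus) * D.fBeta
    * NormedSpace.exp ((Complex.I * D.T) • D.Aminus)

/-- `U_N = e^{-iA₋T/N}`, the one-particle evolution of one time step. -/
def U (N : ℕ) : Matrix X X ℂ := NormedSpace.exp ((-Complex.I * (D.T / N)) • D.Aminus)

end Data

/-- The forward branch of the Keldysh contour. -/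
abbrev plus : Bool := true

/-- The backward branch of the Keldysh contour. -/
abbrev minus : Bool := false

/-- `{+,-} × {1,…,N+1} × X`, where `i : Fin (N+1)` stands for the time index `i + 1`. -/
abbrev Contour (X : Type*) (N : ℕ) : Type _ := Bool × Fin (N + 1) × X

namespace Data

variable {X : Type*} [Fintype X] [LinearOrder X] (D : Data X)

/-- The blocks of the inverse covariance. -/
def invCovBlock (N : ℕ) (ρ : Bool) (m : Fin (N + 1)) (σ : Bool) (n : Fin (N + 1)) :
    Matrix X X ℂ :=
  (if ρ = σ ∧ m = n then 1 else 0)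
    - (if ρ = minus ∧ σ = minus ∧ (m : ℕ) + 1 = n then (D.U N)ᴴ else 0)
    - (if ρ = plus ∧ σ = plus ∧ (n : ℕ) + 1 = m then D.U N else 0)
    - (if ρ = minus ∧ σ = plus ∧ m = Fin.last N ∧ n = Fin.last N then 1 else 0)
    + (if ρ = plus ∧ σ = minus ∧ m = 0 ∧ n = 0 then NormedSpace.exp (-(D.β : ℂ) • D.Q) else 0)

/-- The inverse covariance `(G^{(N)})⁻¹`. -/
def invCov (N : ℕ) : Matrix (Contour X N) (Contour X N) ℂ :=
  Matrix.of fun k l => D.invCovBlock N k.1 k.2.1 l.1 l.2.1 k.2.2 l.2.2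

/-- The time discretized Keldysh covariance `G^{(N)}`. -/
def G (N : ℕ) : Matrix (Contour X N) (Contour X N) ℂ := (D.invCov N)⁻¹

/-- The generator `ψ̄^σ_m(x)`. -/
def psiBar {N : ℕ} (σ : Bool) (m : Fin (N + 1)) (x : X) : Grass (Contour X N ⊕ Contour X N) :=
  gen (Sum.inl (σ, m, x))

/-- The generator `ψ^σ_m(x)`. -/
def psi {N : ℕ} (σ : Bool) (m : Fin (N + 1)) (x : X) : Grass (Contour X N ⊕ Contour X N) :=
  gen (Sum.inr (σ, m, x))

/-- `𝒱^{(N)} = (T/N) (∑_{k=1}^{N} V(ψ̄⁺_{k+1},ψ⁺_k) - ∑_{ℓ=2}^{N+1} V†(ψ̄⁻_{ℓ-1},ψ⁻_ℓ))`. -/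
def action (N : ℕ) : Grass (Contour X N ⊕ Contour X N) :=
  ((D.T : ℂ) / N) •
    (∑ k : Fin N, normalPoly D.ε D.v (psiBar plus k.succ) (psi plus k.castSucc)
      - ∑ l : Fin N, normalPoly D.ε (adjVertex D.v) (psiBar minus l.castSucc) (psi minus l.succ))

/-- The source-dependent fields, as linear forms in the sources:
`ζ̄_k = ∑_y G_{(+,N+1,y),k} c⁻(y)` and `ζ_k = -∑_y G_{k,(-,N+1,y)} c⁺(y)`. -/
def zeta (N : ℕ) : Contour X N ⊕ Contour X N → Source X → ℂ :=
  Sum.elim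
    (fun k => Sum.elim (fun _ => 0) (fun y => D.G N (plus, Fin.last N, y) k))
    (fun k => Sum.elim (fun y => -D.G N k (minus, Fin.last N, y)) (fun _ => 0))

/-- `(μ_{G^{(N)}} * e^{-i𝒱^{(N)}})(ζ̄^{(N)}, ζ^{(N)})`. -/
def approx (N : ℕ) : Grass (Source X) :=
  subst (D.zeta N) (gaussConv D.ε (D.G N) (gexp (-Complex.I • D.action N)))

end Data

end

end Keldysh

/-!
The generating functional is a trace over Fock space, and traces of products of operators are
Grassmann integrals: between any two factors one inserts the resolution of the identity in terms of
fermionic coherent states. A coherent state is encoded by its components `cohR`, `cohL` in the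
occupation number basis, and the matrix elements of an operator between coherent states by `kernel`.
`listIntegral_coherent` is the resolution of the identity, and `listIntegral_chain` and
`chain_apply` express a product of operators with exponential kernels as an integral of an
exponential. Closing the trace changes the sign of the fields (`sum_cohR_mul_cohL`).

Operators with exponential kernels are those in normal order (`kernel_normalOrder`), exponentials of
bilinear operators (`kernel_exp_secondQuant`) and the source insertion (`kernel_sourceExp`). So
`e^{-iHT}` is replaced by the `N`-th power of the operator `stepOp`, whose kernel is, exactly, the
exponential of the quadratic part `(φbar, e^{-iA₋T/N} φ)` plus `-iT/N` times the interaction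
polynomial; similarly for `e^{iH†T}`. The trace with these time steps is `discreteZ N`, and by
`berezin_contour` it is exactly the Grassmann integral over fields on the closed time contour, whose
quadratic form is the inverse covariance.

It remains to transform both sides into each other at fixed `N`, and to take the limit. The sources
enter the exponent linearly in the fields at the last time. Shifting the integration variables by
`ζ̄` and `ζ` completes the square (`subst_berezin`, `pairing_invCov_shift`) and produces the exponent
quadratic in the sources, whose coefficient is the entry of the covariance between the two branches
at the last time (`G_corner`). The normalization is `det_invCov`: the matrix is a perturbation of
one with determinant `1` that factors through the one-particle space, so its determinant is
`det (1 + e^{-βQ} e^{iA₊T} e^{-iA₋T})`, independently of `N`. By cyclicity of determinants this is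
the determinant of a positive definite matrix (`isUnit_one_add_W`). The result is the exact identity
`approx_eq`. In the limit, only the first order of the time step in `T/N` counts, where it agrees
with the Hamiltonian (`tendsto_stepOp_pow`), and the convergence of the operators carries over to the
trace, since Fock space is finite dimensional (`tendsto_discreteZ`).
-/

open scoped Matrix

namespace Keldysh

noncomputable section

set_option linter.unusedSectionVars false

/-! ### Derivatives and substitutions in Grassmann algebras -/

section Calculus

variable {J J' : Type*}

theorem ι_anticomm (m m' : J → ℂ) :
    (ExteriorAlgebra.ι ℂ m * ExteriorAlgebra.ι ℂ m' : Grass J)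
      = -(ExteriorAlgebra.ι ℂ m' * ExteriorAlgebra.ι ℂ m) :=
  eq_neg_of_add_eq_zero_left (ExteriorAlgebra.ι_add_mul_swap m m')

theorem leftDeriv_ι_mul (j : J) (m : J → ℂ) (x : Grass J) :
    leftDeriv j (ExteriorAlgebra.ι ℂ m * x)
      = m j • x - ExteriorAlgebra.ι ℂ m * leftDeriv j x :=
  CliffordAlgebra.contractLeft_ι_mul _ _ _

theorem leftDeriv_ι (j : J) (m : J → ℂ) :
    leftDeriv j (ExteriorAlgebra.ι ℂ m : Grass J) = algebraMap ℂ _ (m j) :=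
  CliffordAlgebra.contractLeft_ι _ _ _

theorem leftDeriv_algebraMap (j : J) (r : ℂ) :
    leftDeriv j (algebraMap ℂ (Grass J) r) = 0 :=
  CliffordAlgebra.contractLeft_algebraMap _ _ _

theorem leftDeriv_one (j : J) : leftDeriv j (1 : Grass J) = 0 :=
  CliffordAlgebra.contractLeft_one _ _

theorem leftDeriv_leftDeriv (j : J) (x : Grass J) : leftDeriv j (leftDeriv j x) = 0 :=
  CliffordAlgebra.contractLeft_contractLeft _ _

theorem leftDeriv_swap (i j : J) (x : Grass J) :
    leftDeriv i (leftDeriv j x) = -leftDeriv j (leftDeriv i x) :=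
  CliffordAlgebra.contractLeft_comm _ _ _

/-- Left induction: to prove a property of all elements of a Grassmann algebra, pass from `x` to
`ι m * x`. -/
theorem grass_induction {C : Grass J → Prop} (one : C 1)
    (add : ∀ x y, C x → C y → C (x + y)) (smul : ∀ (r : ℂ) x, C x → C (r • x))
    (ι_mul : ∀ (m : J → ℂ) x, C x → C (ExteriorAlgebra.ι ℂ m * x)) (x : Grass J) : C x := by
  refine CliffordAlgebra.left_induction (Q := (0 : QuadraticForm ℂ (J → ℂ))) (P := C)
    (fun r => ?_) add (fun x m h => ι_mul m x h) x
  have := smul r 1 one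
  rwa [Algebra.smul_def, mul_one] at this

/-- The grade involution, `(-1)^p` on elements of degree `p`. -/
abbrev inv : Grass J →ₐ[ℂ] Grass J := CliffordAlgebra.involute

theorem inv_ι (m : J → ℂ) :
    inv (ExteriorAlgebra.ι ℂ m : Grass J) = -ExteriorAlgebra.ι ℂ m :=
  CliffordAlgebra.involute_ι _

theorem leftDeriv_mul (j : J) (x y : Grass J) :
    leftDeriv j (x * y) = leftDeriv j x * y + inv x * leftDeriv j y := by
  induction x using grass_induction with
  | one => simp [leftDeriv_one]
  | add a b ha hb => simp only [add_mul, map_add, ha, hb]; abel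
  | smul r a ha => simp only [smul_mul_assoc, map_smul, ha, smul_add]
  | ι_mul m a ha =>
    rw [mul_assoc, leftDeriv_ι_mul, ha, leftDeriv_ι_mul, map_mul, inv_ι]
    simp only [sub_mul, mul_add, mul_assoc, smul_mul_assoc, neg_mul]
    abel

theorem leftDeriv_inv (j : J) (x : Grass J) : leftDeriv j (inv x) = -inv (leftDeriv j x) := by
  induction x using grass_induction with
  | one => simp [leftDeriv_one]
  | add a b ha hb => simp only [map_add, ha, hb]; abel
  | smul r a ha => simp only [map_smul, ha, smul_neg]
  | ι_mul m a ha =>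
    rw [map_mul, inv_ι, leftDeriv_ι_mul, neg_mul, map_neg, leftDeriv_ι_mul, ha, map_sub, map_mul,
      inv_ι, map_smul]
    simp

theorem subst_ι [Fintype J] (w : J → J' → ℂ) (m : J → ℂ) :
    subst w (ExteriorAlgebra.ι ℂ m) = ExteriorAlgebra.ι ℂ (∑ j, m j • w j) := by
  rw [subst, ExteriorAlgebra.map_apply_ι, Fintype.linearCombination_apply]

theorem subst_congr [Fintype J] {w w' : J → J' → ℂ} (h : ∀ j, w j = w' j) (x : Grass J) :
    subst w x = subst w' x := by rw [funext h]

theorem subst_gen [Fintype J] [DecidableEq J] (w : J → J' → ℂ) (j : J) :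
    subst w (gen j) = ExteriorAlgebra.ι ℂ (w j) := by
  rw [gen, subst_ι]
  congr 1
  simp [Pi.single_apply, ite_smul]

theorem subst_subst {J'' : Type*} [Fintype J] [Fintype J'] (w : J → J' → ℂ) (w' : J' → J'' → ℂ)
    (x : Grass J) : subst w' (subst w x) = subst (fun j => ∑ i, w j i • w' i) x := by
  have : (subst w').comp (subst w) = subst (fun j => ∑ i, w j i • w' i) := by
    ext m
    simp only [AlgHom.toLinearMap_apply, LinearMap.comp_apply, AlgHom.comp_apply, subst_ι]
    congr 2
    simp only [Finset.sum_apply, Finset.smul_sum, Finset.sum_smul, Pi.smul_apply, smul_eq_mul,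
      smul_smul]
    exact Finset.sum_comm
  exact DFunLike.congr_fun this x

/-- A substitution in which the new derivative only sees the generator `i`. -/
theorem leftDeriv_subst [Fintype J] [DecidableEq J] (w : J → J' → ℂ) (i : J) (i' : J')
    (h : ∀ j, w j i' = if j = i then 1 else 0) (x : Grass J) :
    leftDeriv i' (subst w x) = subst w (leftDeriv i x) := by
  induction x using grass_induction with
  | one => simp [leftDeriv_one]
  | add a b ha hb => simp only [map_add, ha, hb]
  | smul r a ha => simp only [map_smul, ha]
  | ι_mul m a ha =>
    rw [map_mul, subst_ι, leftDeriv_ι_mul, leftDeriv_ι_mul, ha, map_sub, map_mul, map_smul,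
      subst_ι]
    simp [h]

/-- Every element is the sum of its part without the generator `i`, and of the generator times its
derivative. -/
theorem eq_subst_add_gen_mul_leftDeriv [Fintype J] [DecidableEq J] (i : J) (x : Grass J) :
    x = subst (fun j => if j = i then 0 else Pi.single j 1) x + gen i * leftDeriv i x := by
  induction x using grass_induction with
  | one => simp [leftDeriv_one]
  | add a b ha hb =>
    conv_lhs => rw [ha, hb]
    simp only [map_add, mul_add]; abel
  | smul r a ha =>
    conv_lhs => rw [ha]
    simp only [map_smul, smul_add, mul_smul_comm]
  | ι_mul m a ha =>
    have h1 : gen i * subst (fun j => if j = i then 0 else Pi.single j 1) a = gen i * a := by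
      conv_rhs => rw [ha, mul_add, ← mul_assoc, gen, ExteriorAlgebra.ι_sq_zero, zero_mul, add_zero]
      rfl
    have h2 : (∑ j, m j • (if j = i then 0 else Pi.single j (1 : ℂ)) : J → ℂ)
        = m - m i • Pi.single i 1 := by
      ext k
      rw [Finset.sum_apply, Finset.sum_eq_single k]
      · by_cases hk : k = i <;> simp [hk]
      · intro b _ hb
        by_cases hbi : b = i <;> simp [hbi, Ne.symm hb]
      · simp
    rw [map_mul, subst_ι, h2, map_sub, map_smul, sub_mul, leftDeriv_ι_mul, smul_mul_assoc]
    change _ = _ - m i • (gen i * _) + _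
    rw [h1, mul_sub, mul_smul_comm, ← mul_assoc (gen i), gen, ι_anticomm (Pi.single i 1) m]
    conv_lhs => rw [ha]
    rw [mul_add]
    simp only [gen, neg_mul, mul_assoc]
    abel

/-- The value of a substitution at an element whose derivatives with respect to some of the
generators vanish does not depend on what is substituted for these generators. -/
theorem subst_eq_subst_of_leftDeriv_eq_zero [Fintype J] [DecidableEq J] (S : Finset J)
    (w : J → J' → ℂ) (x : Grass J) (hx : ∀ i ∈ S, leftDeriv i x = 0) :
    subst w x = subst (fun j => if j ∈ S then 0 else w j) x := by
  induction S using Finset.induction_on with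
  | empty => simp
  | insert i S hi ih =>
    have h := eq_subst_add_gen_mul_leftDeriv i x
    rw [hx i (Finset.mem_insert_self _ _), mul_zero, add_zero] at h
    rw [ih fun k hk => hx k (Finset.mem_insert_of_mem hk)]
    conv_lhs => rw [h]
    rw [subst_subst]
    refine subst_congr (fun j => ?_) x
    by_cases hj : j = i
    · subst hj; simp
    · rw [Finset.sum_eq_single j]
      · simp [hj]
      · intro b _ hb
        simp [hj, hb]
      · simp

end Calculus

/-! ### The Grassmann integral -/

section Integral

variable {K J J' : Type*}

/-- The generators in `s` do not occur in `x`. -/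
def FreeOf (s : Set J) (x : Grass J) : Prop := ∀ j ∈ s, leftDeriv j x = 0

theorem FreeOf.mul {s : Set J} {x y : Grass J} (hx : FreeOf s x) (hy : FreeOf s y) :
    FreeOf s (x * y) := fun j hj => by rw [leftDeriv_mul, hx j hj, hy j hj, zero_mul, mul_zero, add_zero]

theorem FreeOf.add {s : Set J} {x y : Grass J} (hx : FreeOf s x) (hy : FreeOf s y) :
    FreeOf s (x + y) := fun j hj => by rw [map_add, hx j hj, hy j hj, add_zero]

theorem FreeOf.smul {s : Set J} {x : Grass J} (c : ℂ) (hx : FreeOf s x) :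
    FreeOf s (c • x) := fun j hj => by rw [map_smul, hx j hj, smul_zero]

theorem FreeOf.mono {s t : Set J} {x : Grass J} (hx : FreeOf s x) (h : t ⊆ s) : FreeOf t x :=
  fun j hj => hx j (h hj)

theorem freeOf_algebraMap (s : Set J) (c : ℂ) : FreeOf s (algebraMap ℂ (Grass J) c) :=
  fun j _ => leftDeriv_algebraMap j c

theorem freeOf_one (s : Set J) : FreeOf s (1 : Grass J) :=
  fun j _ => leftDeriv_one j

theorem FreeOf.sum {ι : Type*} {s : Set J} (t : Finset ι) (f : ι → Grass J)
    (h : ∀ i ∈ t, FreeOf s (f i)) : FreeOf s (∑ i ∈ t, f i) := fun j hj => by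
  rw [map_sum]; exact Finset.sum_eq_zero fun i hi => h i hi j hj

/-- The two generators that are integrated over at `k`. -/
def pairLabels (k : K) : Set ((K ⊕ K) ⊕ J) := {Sum.inl (Sum.inl k), Sum.inl (Sum.inr k)}

theorem pairIntegral_mul_left (k : K) {x : Grass ((K ⊕ K) ⊕ J)} (hx : FreeOf (pairLabels k) x)
    (y : Grass ((K ⊕ K) ⊕ J)) : pairIntegral k (x * y) = x * pairIntegral k y := by
  have h1 := hx (Sum.inl (Sum.inl k)) (by simp [pairLabels])
  have h2 := hx (Sum.inl (Sum.inr k)) (by simp [pairLabels])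
  simp only [pairIntegral, Module.End.mul_apply]
  rw [leftDeriv_mul, h2, zero_mul, zero_add, leftDeriv_mul, leftDeriv_inv, h1, map_zero, neg_zero,
    zero_mul, zero_add]
  congr 1
  exact CliffordAlgebra.involute_involute x

theorem pairIntegral_mul_right (k : K) {x : Grass ((K ⊕ K) ⊕ J)} (hx : FreeOf (pairLabels k) x)
    (y : Grass ((K ⊕ K) ⊕ J)) : pairIntegral k (y * x) = pairIntegral k y * x := by
  have h1 := hx (Sum.inl (Sum.inl k)) (by simp [pairLabels])
  have h2 := hx (Sum.inl (Sum.inr k)) (by simp [pairLabels])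
  simp only [pairIntegral, Module.End.mul_apply]
  rw [leftDeriv_mul, h2, mul_zero, add_zero, leftDeriv_mul, h1, mul_zero, add_zero]

theorem freeOf_pairIntegral (k : K) (x : Grass ((K ⊕ K) ⊕ J)) :
    FreeOf (pairLabels k) (pairIntegral k x) := by
  intro j hj
  simp only [pairLabels, Set.mem_insert_iff, Set.mem_singleton_iff] at hj
  simp only [pairIntegral, Module.End.mul_apply]
  rcases hj with rfl | rfl
  · rw [leftDeriv_leftDeriv]
  · rw [leftDeriv_swap, leftDeriv_leftDeriv, map_zero, neg_zero]

theorem FreeOf.pairIntegral {s : Set ((K ⊕ K) ⊕ J)} {x : Grass ((K ⊕ K) ⊕ J)} (hx : FreeOf s x)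
    (k : K) : FreeOf s (pairIntegral k x) := by
  intro j hj
  simp only [Keldysh.pairIntegral, Module.End.mul_apply]
  rw [leftDeriv_swap, leftDeriv_swap j, hx j hj]
  simp

/-- Iterated Grassmann integrals over the pairs of generators in a list. -/
def listIntegral (l : List K) : Module.End ℂ (Grass ((K ⊕ K) ⊕ J)) :=
  (l.map fun k => pairIntegral (J := J) k).prod

@[simp] theorem listIntegral_nil : listIntegral (J := J) ([] : List K) = 1 := rfl

@[simp] theorem listIntegral_cons (k : K) (l : List K) :
    listIntegral (J := J) (k :: l) = pairIntegral k * listIntegral l := rfl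

theorem listIntegral_append (l l' : List K) :
    listIntegral (J := J) (l ++ l') = listIntegral l * listIntegral l' := by
  simp [listIntegral]

/-- The generators that are integrated over in `listIntegral l`. -/
def listLabels (l : List K) : Set ((K ⊕ K) ⊕ J) := {j | ∃ k ∈ l, j ∈ pairLabels k}

theorem listLabels_cons_left (k : K) (l : List K) :
    pairLabels (J := J) k ⊆ listLabels (k :: l) := fun _ hj => ⟨k, by simp, hj⟩

theorem listLabels_cons_right (k : K) (l : List K) :
    listLabels (J := J) l ⊆ listLabels (k :: l) := by
  rintro j ⟨k', hk', hj⟩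
  exact ⟨k', by simp [hk'], hj⟩

theorem listIntegral_mul_left (l : List K) {x : Grass ((K ⊕ K) ⊕ J)} (hx : FreeOf (listLabels l) x)
    (y : Grass ((K ⊕ K) ⊕ J)) : listIntegral l (x * y) = x * listIntegral l y := by
  induction l with
  | nil => simp
  | cons k l ih =>
    rw [listIntegral_cons, Module.End.mul_apply, ih (hx.mono (listLabels_cons_right _ _)),
      pairIntegral_mul_left k (hx.mono (listLabels_cons_left _ _)), Module.End.mul_apply]

theorem listIntegral_mul_right (l : List K) {x : Grass ((K ⊕ K) ⊕ J)} (hx : FreeOf (listLabels l) x)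
    (y : Grass ((K ⊕ K) ⊕ J)) : listIntegral l (y * x) = listIntegral l y * x := by
  induction l with
  | nil => simp
  | cons k l ih =>
    rw [listIntegral_cons, Module.End.mul_apply, ih (hx.mono (listLabels_cons_right _ _)),
      pairIntegral_mul_right k (hx.mono (listLabels_cons_left _ _)), Module.End.mul_apply]

theorem freeOf_listIntegral (l : List K) (x : Grass ((K ⊕ K) ⊕ J)) :
    FreeOf (listLabels l) (listIntegral l x) := by
  induction l with
  | nil => rintro j ⟨k, hk, _⟩; simp at hk
  | cons k l ih =>
    rintro j ⟨k', hk', hj⟩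
    rw [listIntegral_cons, Module.End.mul_apply]
    rcases List.mem_cons.1 hk' with rfl | hk'
    · exact freeOf_pairIntegral _ _ j hj
    · exact ih.pairIntegral k j ⟨k', hk', hj⟩

/-- The projection of the algebra with integration variables to the spectators. -/
def toSpectators [Fintype K] [Fintype J] [DecidableEq J] : Grass ((K ⊕ K) ⊕ J) →ₐ[ℂ] Grass J :=
  subst (Sum.elim (fun _ => 0) (fun j => Pi.single j 1))

/-- The embedding of the spectators into the algebra with integration variables. -/
def ofSpectators [Fintype J] [DecidableEq K] [DecidableEq J] :
    Grass J →ₐ[ℂ] Grass ((K ⊕ K) ⊕ J) :=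
  subst (fun j => Pi.single (Sum.inr j) 1)

theorem subst_single [Fintype J] [DecidableEq J] (x : Grass J) :
    subst (fun j => Pi.single j 1) x = x := by
  have : subst (fun j : J => Pi.single j (1 : ℂ)) = AlgHom.id ℂ (Grass J) := by
    apply ExteriorAlgebra.hom_ext
    ext j
    simp [subst_ι, Pi.single_apply]
  rw [this]; rfl

theorem toSpectators_ofSpectators [Fintype K] [Fintype J] [DecidableEq K] [DecidableEq J]
    (x : Grass J) : toSpectators (K := K) (ofSpectators x) = x := by
  rw [toSpectators, ofSpectators, subst_subst]
  conv_rhs => rw [← subst_single x]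
  refine subst_congr (fun j => ?_) x
  simp [Pi.single_apply, ite_smul]

theorem freeOf_ofSpectators [Fintype J] [DecidableEq K] [DecidableEq J] (l : List K) (x : Grass J) :
    FreeOf (listLabels l) (ofSpectators (K := K) x) := by
  rintro j ⟨k, _, hj⟩
  have h : ∀ j' : J, (Pi.single (Sum.inr j') 1 : (K ⊕ K) ⊕ J → ℂ) j = 0 := by
    intro j'
    simp only [pairLabels, Set.mem_insert_iff, Set.mem_singleton_iff] at hj
    rcases hj with rfl | rfl <;> simp
  induction x using grass_induction with
  | one => simp [leftDeriv_one]
  | add a b ha hb => simp only [map_add, ha, hb, add_zero]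
  | smul r a ha => simp only [map_smul, ha, smul_zero]
  | ι_mul m a ha =>
    rw [map_mul, ofSpectators, subst_ι, leftDeriv_ι_mul]
    change _ - _ * leftDeriv j (ofSpectators a) = 0
    rw [ha]
    simp [h]

/-- The Grassmann integral as an iterated integral, in any order of the labels: the integrations
over the pairs `ψbar_k, ψ_k` are even, so that they commute. -/
theorem berezin_eq [Fintype K] [Fintype J] [DecidableEq J] (l : List K) (hl : l.Nodup)
    (hu : ∀ k, k ∈ l) (x : Grass ((K ⊕ K) ⊕ J)) :
    berezin x = toSpectators (listIntegral l x) := by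
  classical
  have h : Finset.univ.noncommProd (fun k : K => pairIntegral (J := J) k)
      (fun k _ l _ _ => pairIntegral_commute k l) = listIntegral l := by
    have : (Finset.univ : Finset K) = l.toFinset := by ext k; simp [hu]
    exact (Finset.noncommProd_congr this (fun _ _ => rfl) _).trans
      (Finset.noncommProd_toFinset l _ (fun k _ l _ _ => pairIntegral_commute k l) hl)
  rw [berezin, h]
  rfl

/-- The Grassmann integral is invariant under translations of the integration variables by linear
forms in the spectators, and commutes with linear substitutions of the spectators. -/
theorem subst_berezin [Fintype K] [Fintype J] [Fintype J'] [DecidableEq K] [DecidableEq J]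
    [DecidableEq J']
    (z : J → J' → ℂ) (u : K ⊕ K → J' → ℂ) (x : Grass ((K ⊕ K) ⊕ J)) :
    subst z (berezin x) = berezin (subst (Sum.elim
      (fun i => Pi.single (Sum.inl i) 1 + Sum.elim (fun _ => 0) (u i))
      (fun j => Sum.elim (fun _ => 0) (z j))) x) := by
  set w : (K ⊕ K) ⊕ J → (K ⊕ K) ⊕ J' → ℂ := Sum.elim
      (fun i => Pi.single (Sum.inl i) 1 + Sum.elim (fun _ => 0) (u i))
      (fun j => Sum.elim (fun _ => 0) (z j)) with hw
  have hd : ∀ (i : K ⊕ K) (y : Grass ((K ⊕ K) ⊕ J)),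
      leftDeriv (Sum.inl i) (subst w y) = subst w (leftDeriv (Sum.inl i) y) := by
    intro i y
    apply leftDeriv_subst
    rintro (j | j)
    · simp [hw, Pi.single_apply, eq_comm (a := i)]
    · simp [hw]
  have hl : ∀ (l : List K) (y : Grass ((K ⊕ K) ⊕ J)),
      listIntegral l (subst w y) = subst w (listIntegral l y) := by
    intro l y
    induction l with
    | nil => simp
    | cons k l ih =>
      simp only [listIntegral_cons, Module.End.mul_apply, ih, pairIntegral, hd]
  have hfin : ∀ k, k ∈ (Finset.univ : Finset K).toList := by simp
  rw [berezin_eq _ (Finset.nodup_toList _) hfin, berezin_eq _ (Finset.nodup_toList _) hfin, hl,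
    toSpectators, toSpectators, subst_subst, subst_subst]
  set y := listIntegral (Finset.univ : Finset K).toList x with hy
  have hfree : ∀ i ∈ (Finset.univ : Finset (K ⊕ K)).image (Sum.inl : _ → (K ⊕ K) ⊕ J),
      leftDeriv i y = 0 := by
    intro i hi
    obtain ⟨k, _, rfl⟩ := Finset.mem_image.1 hi
    rcases k with k | k <;>
    exact freeOf_listIntegral _ _ _ ⟨k, hfin k, by simp [pairLabels]⟩
  rw [subst_eq_subst_of_leftDeriv_eq_zero _ _ y hfree,
    subst_eq_subst_of_leftDeriv_eq_zero _ (fun j => ∑ i, w j i • _) y hfree]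
  refine subst_congr (fun j => ?_) y
  rcases j with j | j
  · simp
  · ext k
    simp [hw, Pi.single_apply, Finset.sum_apply, ite_apply]

end Integral

/-! ### Exponentials of central nilpotent elements -/

section Exponential

/-- Central nilpotent elements, such as the even elements without constant term of a Grassmann
algebra. On these, `gexp` turns sums into products. -/
def Bos {R : Type*} [Ring R] (x : R) : Prop := (∀ y, Commute x y) ∧ IsNilpotent x

variable {R : Type*} [Ring R]

theorem Bos.zero : Bos (0 : R) := ⟨fun y => Commute.zero_left y, IsNilpotent.zero⟩

theorem Bos.add {x y : R} (hx : Bos x) (hy : Bos y) : Bos (x + y) :=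
  ⟨fun z => (hx.1 z).add_left (hy.1 z), (hx.1 y).isNilpotent_add hx.2 hy.2⟩

theorem Bos.neg {x : R} (hx : Bos x) : Bos (-x) := ⟨fun z => (hx.1 z).neg_left, hx.2.neg⟩

theorem Bos.sub {x y : R} (hx : Bos x) (hy : Bos y) : Bos (x - y) := by
  rw [sub_eq_add_neg]; exact hx.add hy.neg

theorem Bos.smul [Algebra ℂ R] {x : R} (hx : Bos x) (c : ℂ) : Bos (c • x) :=
  ⟨fun z => (hx.1 z).smul_left c, hx.2.smul c⟩

theorem Bos.sum {ι : Type*} (s : Finset ι) (f : ι → R) (h : ∀ i ∈ s, Bos (f i)) :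
    Bos (∑ i ∈ s, f i) :=
  Finset.sum_induction f Bos (fun _ _ => Bos.add) Bos.zero h

variable [Module ℚ R]

theorem gexp_zero : gexp (0 : R) = 1 := IsNilpotent.exp_zero

theorem gexp_add {x y : R} (hx : Bos x) (hy : Bos y) : gexp (x + y) = gexp x * gexp y :=
  IsNilpotent.exp_add_of_commute (hx.1 y) hx.2 hy.2

theorem gexp_neg_mul_gexp {x : R} (hx : Bos x) : gexp (-x) * gexp x = 1 :=
  IsNilpotent.exp_neg_mul_exp_self hx.2

theorem gexp_of_sq_eq_zero {x : R} (hx : x * x = 0) : gexp x = 1 + x := by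
  rw [gexp, IsNilpotent.exp_eq_sum (k := 2) (by rw [pow_two, hx])]
  simp [Finset.sum_range_succ]

theorem commute_gexp {x y : R} (h : Commute x y) : Commute (gexp x) y := by
  rw [gexp, IsNilpotent.exp]
  refine Commute.sum_left _ _ _ fun i _ => ?_
  have := (h.pow_left i)
  rw [commute_iff_eq] at this ⊢
  rw [← DistribSMul.toAddMonoidHom_apply R (i.factorial : ℚ)⁻¹ (x ^ i)]
  have h1 := map_rat_smul (AddMonoidHom.mulRight y) (i.factorial : ℚ)⁻¹ (x ^ i)
  have h2 := map_rat_smul (AddMonoidHom.mulLeft y) (i.factorial : ℚ)⁻¹ (x ^ i)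
  simp only [AddMonoidHom.coe_mulRight, AddMonoidHom.coe_mulLeft] at h1 h2
  simp only [DistribSMul.toAddMonoidHom_apply, h1, h2, this]

theorem map_gexp {R' F : Type*} [Ring R'] [Module ℚ R'] [FunLike F R R'] [RingHomClass F R R']
    {x : R} (hx : IsNilpotent x) (f : F) : f (gexp x) = gexp (f x) :=
  IsNilpotent.map_exp hx f

theorem FreeOf.gexp {J : Type*} {s : Set J} {x : Grass J} (hx : FreeOf s x) :
    FreeOf s (gexp x) := by
  rw [Keldysh.gexp, IsNilpotent.exp]
  refine FreeOf.sum _ _ fun i _ j hj => ?_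
  have h : ∀ i : ℕ, FreeOf s (x ^ i) := by
    intro i
    induction i with
    | zero => rw [pow_zero]; exact freeOf_one s
    | succ i ih => rw [pow_succ]; exact ih.mul hx
  rw [map_rat_smul, h i j hj, smul_zero]

end Exponential

/-! ### Linear forms in the generators -/

section Forms

variable {J : Type*}

/-- The linear form with coefficients `m` in the generators. -/
abbrev form (m : J → ℂ) : Grass J := ExteriorAlgebra.ι ℂ m

theorem form_mul_self (m : J → ℂ) : form m * form m = 0 := ExteriorAlgebra.ι_sq_zero m

theorem form_mul_form_mul_self (m : J → ℂ) (x : Grass J) : form m * (form m * x) = 0 := by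
  rw [← mul_assoc, form_mul_self, zero_mul]

theorem form_mul_list_prod (m : J → ℂ) (l : List (J → ℂ)) :
    form m * (l.map form).prod = ((-1 : ℂ) ^ l.length) • ((l.map form).prod * form m) := by
  induction l with
  | nil => simp
  | cons a l ih =>
    rw [List.map_cons, List.prod_cons, ← mul_assoc, ι_anticomm m a, neg_mul, mul_assoc, ih,
      List.length_cons, pow_succ, mul_smul_comm, mul_assoc]
    simp

theorem commute_of_commute_form {x : Grass J} (h : ∀ m, Commute x (form m)) (y : Grass J) :
    Commute x y := by
  induction y using grass_induction with
  | one => exact Commute.one_right x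
  | add a b ha hb => exact ha.add_right hb
  | smul r a ha => exact ha.smul_right r
  | ι_mul m a ha => exact (h m).mul_right ha

theorem bos_list_prod (l : List (J → ℂ)) (he : Even l.length) (hl : l ≠ []) :
    Bos (l.map form).prod := by
  have hc : ∀ y, Commute (l.map form).prod y := commute_of_commute_form fun m => by
    rw [commute_iff_eq, form_mul_list_prod, he.neg_one_pow, one_smul]
  refine ⟨hc, 2, ?_⟩
  obtain ⟨a, l', rfl⟩ := List.exists_cons_of_ne_nil hl
  rw [pow_two]
  nth_rewrite 1 [List.map_cons, List.prod_cons]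
  rw [mul_assoc, ← (hc _).eq]
  simp only [List.map_cons, List.prod_cons, mul_assoc]
  rw [form_mul_form_mul_self]

theorem bos_form_mul_form (m m' : J → ℂ) : Bos (form m * form m') := by
  simpa using bos_list_prod [m, m'] (by simp) (by simp)

theorem bos_pairing {X : Type*} [Fintype X] (ε : ℝ) (M : Matrix X X ℂ) (p q : X → J → ℂ) :
    Bos (pairing ε M (fun x => form (p x)) (fun x => form (q x))) :=
  Bos.smul (Bos.sum _ _ fun _ _ => Bos.sum _ _ fun _ _ => (bos_form_mul_form _ _).smul _) _

theorem bos_normalPoly {X : Type*} [Fintype X] (ε : ℝ)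
    (v : (m m' : ℕ) → (Fin m → X) → (Fin m' → X) → ℂ) (p q : X → J → ℂ)
    (heven : ∀ m m' : ℕ, Odd (m + m') → ∀ x y, v m m' x y = 0) (hconst : ∀ x y, v 0 0 x y = 0) :
    Bos (normalPoly ε v (fun x => form (p x)) (fun x => form (q x))) := by
  refine Bos.sum _ _ fun m _ => Bos.sum _ _ fun m' _ => Bos.sum _ _ fun x _ =>
    Bos.sum _ _ fun y _ => ?_
  by_cases hv : v m m' x y = 0
  · rw [hv, mul_zero, zero_smul]; exact Bos.zero
  · refine Bos.smul ?_ _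
    have h := bos_list_prod ((List.ofFn fun j => p (y j)) ++ (List.ofFn fun i => q (x i))) ?_ ?_
    · simpa [List.map_ofFn, Function.comp_def] using h
    · rw [List.length_append, List.length_ofFn, List.length_ofFn]
      by_contra hodd
      exact hv (heven m m' (by rw [add_comm]; exact Nat.not_even_iff_odd.1 hodd) x y)
    · intro h0
      have := congrArg List.length h0
      simp only [List.length_append, List.length_ofFn, List.length_nil, Nat.add_eq_zero_iff] at this
      obtain ⟨rfl, rfl⟩ := this
      exact hv (hconst x y)

end Forms

/-! ### Coherent states -/

section Coherent

variable {X J : Type*} [LinearOrder X] (ε : ℝ)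

/-- Component at `|S⟩` of the coherent state `|φ⟩`, `φ x = form (q x)`: the eigenvector of all
`a(x)` with vacuum component `1`. The eigenvalue equation
carries a sign `(-1)^|S|`, because Grassmann variables anticommute with the field operators and
here multiply components rather than vectors. -/
def cohR (q : X → J → ℂ) (S : Finset X) : Grass J :=
  ((√ε : ℂ) ^ S.card) • (((S.sort (· ≥ ·)).map q).map form).prod

/-- Component at `⟨S|` of the dual coherent state `⟨φbar|`, `φbar x = form (p x)`. -/
def cohL (p : X → J → ℂ) (S : Finset X) : Grass J := CliffordAlgebra.reverse (cohR ε p S)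

theorem form_mul_cohR (m : J → ℂ) (q : X → J → ℂ) (S : Finset X) :
    form m * cohR ε q S = ((-1 : ℂ) ^ S.card) • (cohR ε q S * form m) := by
  rw [cohR, mul_smul_comm, form_mul_list_prod, smul_mul_assoc, smul_comm]
  simp

theorem reverse_form (m : J → ℂ) : CliffordAlgebra.reverse (form m) = form m :=
  CliffordAlgebra.reverse_ι _

theorem form_mul_cohL (m : J → ℂ) (p : X → J → ℂ) (S : Finset X) :
    form m * cohL ε p S = ((-1 : ℂ) ^ S.card) • (cohL ε p S * form m) := by
  have h := congrArg CliffordAlgebra.reverse (form_mul_cohR ε m p S)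
  rw [CliffordAlgebra.reverse.map_mul, map_smul, CliffordAlgebra.reverse.map_mul] at h
  rw [reverse_form] at h
  rw [cohL, h, smul_smul, ← mul_pow]
  simp

/-- Moving a factor into its place in a descending product costs the sign that also appears in the
creation and annihilation operators. -/
theorem form_mul_sorted (q : X → J → ℂ) (x : X) (l : List X) (hl : l.Pairwise (· ≥ ·)) :
    form (q x) * ((l.map q).map form).prod
      = ((-1 : ℂ) ^ (l.filter (x < ·)).length)
        • (((l.orderedInsert (· ≥ ·) x).map q).map form).prod := by
  induction l with
  | nil => simp
  | cons y l ih =>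
    rw [List.pairwise_cons] at hl
    by_cases h : y ≤ x
    · have h0 : (y :: l).filter (x < ·) = [] := by
        rw [List.filter_eq_nil_iff]
        intro z hz
        rcases List.mem_cons.1 hz with rfl | hz
        · simpa using h
        · simpa using (hl.1 z hz).trans h
      rw [h0, List.orderedInsert_cons_of_le (· ≥ ·) _ h]
      simp
    · rw [List.orderedInsert_of_not_le (· ≥ ·) _ h]
      simp only [List.map_cons, List.prod_cons]
      rw [← mul_assoc, ι_anticomm (q x) (q y), neg_mul, mul_assoc, ih hl.2]
      rw [List.filter_cons_of_pos (by simpa using h), List.length_cons, pow_succ, mul_smul_comm]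
      simp

theorem cohR_insert (q : X → J → ℂ) {x : X} {S : Finset X} (hx : x ∉ S) :
    cohR ε q (insert x S)
      = ((-1 : ℂ) ^ (S.filter (x < ·)).card * √ε) • (form (q x) * cohR ε q S) := by
  have h1 : (insert x S).sort (· ≥ ·) = (S.sort (· ≥ ·)).orderedInsert (· ≥ ·) x := by
    refine List.Perm.eq_of_pairwise (le := (· ≥ ·)) ?_ (Finset.pairwise_sort _ _)
      ((Finset.pairwise_sort S _).orderedInsert x _) ?_
    · intro a b _ _ h h'; exact le_antisymm h' h
    · refine List.Perm.trans ?_ (List.perm_orderedInsert _ x _).symm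
      rw [← Multiset.coe_eq_coe, ← Multiset.cons_coe, Finset.sort_eq, Finset.sort_eq,
        Finset.insert_val_of_notMem hx]
  have h2 : ((S.sort (· ≥ ·)).filter (x < ·)).length = (S.filter (x < ·)).card := by
    rw [Finset.card_def, Finset.filter_val, ← Finset.sort_eq S (· ≥ ·), Multiset.filter_coe,
      Multiset.coe_card]
  rw [cohR, cohR, h1, mul_smul_comm, form_mul_sorted q x _ (Finset.pairwise_sort S _), h2,
    Finset.card_insert_of_notMem hx, smul_smul, smul_smul, pow_succ]
  congr 1
  have : ((-1 : ℂ) ^ (S.filter (x < ·)).card) * ((-1 : ℂ) ^ (S.filter (x < ·)).card) = 1 := by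
    rw [← mul_pow]; simp
  linear_combination (-(√ε : ℂ) * √ε ^ S.card) * this

theorem cohL_insert (p : X → J → ℂ) {x : X} {S : Finset X} (hx : x ∉ S) :
    cohL ε p (insert x S)
      = ((-1 : ℂ) ^ (S.filter (x < ·)).card * √ε) • (cohL ε p S * form (p x)) := by
  rw [cohL, cohR_insert ε p hx, map_smul, CliffordAlgebra.reverse.map_mul, reverse_form]
  rfl

@[simp] theorem cohR_empty (q : X → J → ℂ) : cohR ε q ∅ = 1 := by simp [cohR]

@[simp] theorem cohL_empty (p : X → J → ℂ) : cohL ε p ∅ = 1 := by simp [cohL]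

theorem form_mul_cohR_of_mem (q : X → J → ℂ) {x : X} {S : Finset X} (hx : x ∈ S) :
    form (q x) * cohR ε q S = 0 := by
  rw [← Finset.insert_erase hx, cohR_insert ε q (Finset.notMem_erase x S), mul_smul_comm,
    form_mul_form_mul_self, smul_zero]

theorem cohL_mul_form_of_mem (p : X → J → ℂ) {x : X} {S : Finset X} (hx : x ∈ S) :
    cohL ε p S * form (p x) = 0 := by
  rw [← Finset.insert_erase hx, cohL_insert ε p (Finset.notMem_erase x S), smul_mul_assoc,
    mul_assoc, form_mul_self, mul_zero, smul_zero]

theorem card_filter_lt_add_card_filter_gt {x : X} {S : Finset X} (hx : x ∉ S) :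
    (S.filter (· < x)).card + (S.filter (x < ·)).card = S.card := by
  rw [← Finset.card_union_of_disjoint]
  · congr 1
    ext y
    simp only [Finset.mem_union, Finset.mem_filter]
    constructor
    · rintro (h | h) <;> exact h.1
    · intro h
      rcases lt_trichotomy y x with h' | h' | h'
      · exact Or.inl ⟨h, h'⟩
      · exact absurd (h' ▸ h) hx
      · exact Or.inr ⟨h, h'⟩
  · rw [Finset.disjoint_filter]
    intro y _ h h'
    exact lt_asymm h h'

theorem neg_one_pow_card_lt {x : X} {S : Finset X} (hx : x ∉ S) :
    (-1 : ℂ) ^ (S.filter (· < x)).card * (-1) ^ (S.filter (x < ·)).card = (-1) ^ S.card := by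
  rw [← pow_add, card_filter_lt_add_card_filter_gt hx]

variable {ε}

/-- Numerical operators on Fock space as operators with Grassmann valued coefficients. -/
def lift (M : Matrix (Finset X) (Finset X) ℂ) : Matrix (Finset X) (Finset X) (Grass J) :=
  M.map (algebraMap ℂ (Grass J))

theorem cohL_mul_cohR_insert (hε : 0 < ε) (p q : X → J → ℂ) {x : X} {S : Finset X} (hx : x ∉ S) :
    cohL ε p (insert x S) * cohR ε q (insert x S)
      = ((ε : ℂ) • (form (p x) * form (q x))) * (cohL ε p S * cohR ε q S) := by
  have hs : ((√ε : ℂ)) * √ε = ε := by exact_mod_cast Real.mul_self_sqrt hε.le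
  rw [cohL_insert ε p hx, cohR_insert ε q hx, smul_mul_smul_comm, smul_mul_assoc,
    mul_mul_mul_comm, ← mul_pow, hs]
  simp only [mul_neg, mul_one, neg_neg, one_pow, one_mul]
  congr 1
  rw [← mul_assoc, mul_assoc (cohL ε p S),
    (((bos_form_mul_form (p x) (q x)).1 _).eq).symm, mul_assoc]

theorem cohR_mul_cohL_insert (hε : 0 < ε) (p q : X → J → ℂ) {x : X} {S : Finset X} (hx : x ∉ S) :
    cohR ε q (insert x S) * cohL ε p (insert x S)
      = ((ε : ℂ) • (form (q x) * form (p x))) * (cohR ε q S * cohL ε p S) := by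
  have hs : ((√ε : ℂ)) * √ε = ε := by exact_mod_cast Real.mul_self_sqrt hε.le
  have hc : cohR ε q S * cohL ε p S * form (p x) = form (p x) * (cohR ε q S * cohL ε p S) := by
    rw [← mul_assoc, form_mul_cohR, smul_mul_assoc, mul_assoc (cohR ε q S) (form _), form_mul_cohL,
      mul_smul_comm, smul_smul, ← mul_pow]
    simp [mul_assoc]
  rw [cohL_insert ε p hx, cohR_insert ε q hx, smul_mul_smul_comm, smul_mul_assoc,
    mul_mul_mul_comm, ← mul_pow, hs]
  simp only [mul_neg, mul_one, neg_neg, one_pow, one_mul]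
  congr 1
  rw [mul_assoc, ← mul_assoc (cohR ε q S), hc, mul_assoc (form (q x))]

theorem bos_form_sq (c : ℂ) (m m' : J → ℂ) :
    (c • (form m * form m')) * (c • (form m * form m')) = 0 := by
  rw [smul_mul_smul_comm, ← mul_assoc, mul_assoc (form m), ι_anticomm m' m, mul_neg,
    form_mul_form_mul_self]
  simp

variable [Fintype X]

theorem lift_mul (M M' : Matrix (Finset X) (Finset X) ℂ) :
    lift (J := J) (M * M') = lift M * lift M' := Matrix.map_mul

theorem lift_one : lift (J := J) (1 : Matrix (Finset X) (Finset X) ℂ) = 1 :=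
  Matrix.map_one _ (map_zero _) (map_one _)

theorem annih_mulVec (x : X) (u : Finset X → Grass J) (S : Finset X) :
    (lift (annih ε x) *ᵥ u) S = if x ∈ S then 0 else
      (((√ε : ℂ))⁻¹ * (-1) ^ (S.filter (· < x)).card) • u (insert x S) := by
  simp only [Matrix.mulVec, dotProduct, lift, Matrix.map_apply, annih, Matrix.of_apply]
  rw [Finset.sum_eq_single (insert x S)]
  · split_ifs <;> simp_all [Algebra.smul_def]
  · intro b _ hb; simp [hb]
  · simp

theorem vecMul_creat (x : X) (u : Finset X → Grass J) (S : Finset X) :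
    (u ᵥ* lift (creat ε x)) S = if x ∈ S then 0 else
      (((√ε : ℂ))⁻¹ * (-1) ^ (S.filter (· < x)).card) • u (insert x S) := by
  simp only [Matrix.vecMul, dotProduct, lift, Matrix.map_apply, creat, Matrix.conjTranspose_apply,
    annih, Matrix.of_apply, ← Algebra.commutes]
  rw [Finset.sum_eq_single (insert x S)]
  · split_ifs <;> simp_all [Algebra.smul_def]
  · intro b _ hb; simp [hb]
  · simp

/-- The coherent state is an eigenvector of the annihilation operators. -/
theorem annih_mulVec_cohR (hε : 0 < ε) (q : X → J → ℂ) (x : X) (S : Finset X) :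
    (lift (annih ε x) *ᵥ cohR ε q) S = ((-1 : ℂ) ^ S.card) • (form (q x) * cohR ε q S) := by
  have h0 : (√ε : ℂ) ≠ 0 := by exact_mod_cast (Real.sqrt_pos.2 hε).ne'
  rw [annih_mulVec]
  split_ifs with hx
  · rw [form_mul_cohR_of_mem ε q hx, smul_zero]
  · rw [cohR_insert ε q hx, smul_smul, ← neg_one_pow_card_lt hx]
    congr 1
    field_simp

/-- The coherent state is determined by its vacuum component and the eigenvalue equations. To show
that an operator maps coherent states to coherent states it is enough to verify these. -/
theorem eq_cohR (hε : 0 < ε) (q : X → J → ℂ) (u : Finset X → Grass J) (h1 : u ∅ = 1)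
    (h : ∀ x S, (lift (annih ε x) *ᵥ u) S = ((-1 : ℂ) ^ S.card) • (form (q x) * u S)) :
    u = cohR ε q := by
  have h0 : (√ε : ℂ) ≠ 0 := by exact_mod_cast (Real.sqrt_pos.2 hε).ne'
  funext S
  induction S using Finset.induction_on with
  | empty => simp [h1]
  | insert x S hx ih =>
    have e1 := h x S
    have e2 := annih_mulVec_cohR hε q x S
    rw [ih, ← e2, annih_mulVec, annih_mulVec, if_neg hx, if_neg hx] at e1
    refine smul_right_injective _ (mul_ne_zero (inv_ne_zero h0) (pow_ne_zero _ (by norm_num))) e1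

theorem vecMul_creat_cohL (hε : 0 < ε) (p : X → J → ℂ) (x : X) (S : Finset X) :
    (cohL ε p ᵥ* lift (creat ε x)) S = ((-1 : ℂ) ^ S.card) • (cohL ε p S * form (p x)) := by
  have h0 : (√ε : ℂ) ≠ 0 := by exact_mod_cast (Real.sqrt_pos.2 hε).ne'
  rw [vecMul_creat]
  split_ifs with hx
  · rw [cohL_mul_form_of_mem ε p hx, smul_zero]
  · rw [cohL_insert ε p hx, smul_smul, ← neg_one_pow_card_lt hx]
    congr 1
    field_simp

/-- The matrix element `⟨φbar| O |φ⟩` between coherent states. -/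
def kernel (ε : ℝ) (p : X → J → ℂ) (O : Matrix (Finset X) (Finset X) (Grass J)) (q : X → J → ℂ) :
    Grass J := cohL ε p ⬝ᵥ (O *ᵥ cohR ε q)

/-- A creation operator on the left acts on `⟨φbar|` as multiplication by `φbar x`. -/
theorem kernel_creat_mul (hε : 0 < ε) (p q : X → J → ℂ)
    (O : Matrix (Finset X) (Finset X) (Grass J)) (x : X) :
    kernel ε p (lift (creat ε x) * O) q = form (p x) * kernel ε p O q := by
  rw [kernel, ← Matrix.mulVec_mulVec, Matrix.dotProduct_mulVec, kernel, dotProduct, dotProduct,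
    Finset.mul_sum]
  refine Finset.sum_congr rfl fun S _ => ?_
  rw [vecMul_creat_cohL hε, ← mul_assoc, form_mul_cohL]

/-- The fermion parity. -/
def parity : Matrix (Finset X) (Finset X) ℂ := Matrix.diagonal fun S => (-1) ^ S.card

theorem lift_parity_mulVec (u : Finset X → Grass J) (S : Finset X) :
    (lift parity *ᵥ u) S = ((-1 : ℂ) ^ S.card) • u S := by
  rw [lift, parity, Matrix.diagonal_map (map_zero _), Matrix.mulVec_diagonal, Algebra.smul_def]

/-- An annihilation operator on the right acts on `|φ⟩` as multiplication by `φ x`; moving `φ x`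
through `O` conjugates `O` with the parity. -/
theorem kernel_mul_annih (hε : 0 < ε) (p q : X → J → ℂ)
    (O : Matrix (Finset X) (Finset X) ℂ) (x : X) :
    kernel ε p (lift (parity * O * parity * annih ε x)) q
      = form (q x) * kernel ε p (lift O) q := by
  have h1 : lift parity *ᵥ (lift (annih ε x) *ᵥ cohR ε q)
      = fun S => form (q x) * cohR ε q S := by
    funext S
    rw [lift_parity_mulVec, annih_mulVec_cohR hε, smul_smul, ← mul_pow]
    simp
  have h2 : lift O *ᵥ (fun S => form (q x) * cohR ε q S)
      = fun S => form (q x) * (lift O *ᵥ cohR ε q) S := by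
    funext S
    simp only [Matrix.mulVec, dotProduct, Finset.mul_sum, lift, Matrix.map_apply]
    refine Finset.sum_congr rfl fun S' _ => ?_
    rw [← mul_assoc, Algebra.commutes, mul_assoc]
  rw [kernel, lift_mul, lift_mul, lift_mul, ← Matrix.mulVec_mulVec, ← Matrix.mulVec_mulVec,
    ← Matrix.mulVec_mulVec, h1, h2, kernel, dotProduct, dotProduct, Finset.mul_sum]
  refine Finset.sum_congr rfl fun S _ => ?_
  rw [lift_parity_mulVec, ← mul_assoc (form (q x)), form_mul_cohL]
  simp [mul_assoc]

/-- The overlap of coherent states. -/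
theorem kernel_one (hε : 0 < ε) (p q : X → J → ℂ) :
    kernel ε p 1 q = gexp ((ε : ℂ) • ∑ x, form (p x) * form (q x)) := by
  have h : ∀ T : Finset X, ∑ S ∈ T.powerset, cohL ε p S * cohR ε q S
      = gexp (∑ x ∈ T, (ε : ℂ) • (form (p x) * form (q x))) := by
    intro T
    induction T using Finset.induction_on with
    | empty => simp [gexp_zero]
    | insert x T hx ih =>
      rw [Finset.sum_powerset_insert hx, Finset.sum_insert hx,
        gexp_add ((bos_form_mul_form _ _).smul _)
          (Bos.sum _ _ fun _ _ => (bos_form_mul_form _ _).smul _), ← ih,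
        gexp_of_sq_eq_zero (bos_form_sq _ _ _), add_mul, one_mul, Finset.mul_sum]
      congr 1
      refine Finset.sum_congr rfl fun S hS => ?_
      rw [cohL_mul_cohR_insert hε p q fun h => hx (Finset.mem_powerset.1 hS h)]
  rw [kernel, Matrix.one_mulVec, dotProduct, Finset.smul_sum, ← h Finset.univ,
    Finset.powerset_univ]

end Coherent

/-! ### Resolution of the identity -/

section Resolution

variable {X K J : Type*} [LinearOrder X] [DecidableEq K] [DecidableEq J] {ε : ℝ}

/-- The integration variables `ψbar_{k x}`. -/
def barField (k : X → K) (x : X) : (K ⊕ K) ⊕ J → ℂ := Pi.single (Sum.inl (Sum.inl (k x))) 1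

/-- The integration variables `ψ_{k x}`. -/
def field (k : X → K) (x : X) : (K ⊕ K) ⊕ J → ℂ := Pi.single (Sum.inl (Sum.inr (k x))) 1

theorem freeOf_form {s : Set J} {m : J → ℂ} (h : ∀ j ∈ s, m j = 0) : FreeOf s (form m) :=
  fun j hj => by rw [leftDeriv_ι, h j hj, map_zero]

theorem freeOf_cohR {s : Set J} (q : X → J → ℂ) (S : Finset X)
    (h : ∀ x ∈ S, ∀ j ∈ s, q x j = 0) : FreeOf s (cohR ε q S) := by
  induction S using Finset.induction_on with
  | empty => rw [cohR_empty]; exact freeOf_one s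
  | insert x S hx ih =>
    rw [cohR_insert ε q hx]
    exact ((freeOf_form (h x (Finset.mem_insert_self _ _))).mul
      (ih fun y hy => h y (Finset.mem_insert_of_mem hy))).smul _

theorem freeOf_cohL {s : Set J} (p : X → J → ℂ) (S : Finset X)
    (h : ∀ x ∈ S, ∀ j ∈ s, p x j = 0) : FreeOf s (cohL ε p S) := by
  induction S using Finset.induction_on with
  | empty => rw [cohL_empty]; exact freeOf_one s
  | insert x S hx ih =>
    rw [cohL_insert ε p hx]
    exact ((ih fun y hy => h y (Finset.mem_insert_of_mem hy)).mul
      (freeOf_form (h x (Finset.mem_insert_self _ _)))).smul _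

/-- The integral vanishes if the integrand is independent of one of the integration variables. -/
theorem listIntegral_eq_zero {l : List K} {k : K} (hk : k ∈ l) {j : (K ⊕ K) ⊕ J}
    (hj : j ∈ pairLabels k) {y : Grass ((K ⊕ K) ⊕ J)} (hy : leftDeriv j y = 0) :
    listIntegral l y = 0 := by
  have hpass : ∀ l : List K, FreeOf {j} (listIntegral l y) := by
    intro l
    induction l with
    | nil => rintro i rfl; exact hy
    | cons k l ih => rw [listIntegral_cons, Module.End.mul_apply]; exact ih.pairIntegral k
  induction l with
  | nil => simp at hk
  | cons k' l ih =>
    rw [listIntegral_cons, Module.End.mul_apply]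
    by_cases h : k ∈ l
    · rw [ih h, map_zero]
    · obtain rfl : k = k' := by simpa [h] using hk
      have h0 := hpass l j rfl
      simp only [pairLabels, Set.mem_insert_iff, Set.mem_singleton_iff] at hj
      simp only [pairIntegral, Module.End.mul_apply]
      rcases hj with rfl | rfl
      · rw [leftDeriv_swap, h0, map_zero, neg_zero]
      · rw [h0, map_zero]

variable (ε) in
/-- The exponent `-(ψbar, ψ)` of the Gaussian weight of the fields with labels `k x`, `x ∈ T`. -/
def weight (k : X → K) (T : Finset X) : Grass ((K ⊕ K) ⊕ J) :=
  -∑ x ∈ T, (ε : ℂ) • (form (barField k x) * form (field k x))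

theorem bos_weight (k : X → K) (T : Finset X) : Bos (weight (J := J) ε k T) :=
  (Bos.sum _ _ fun _ _ => (bos_form_mul_form _ _).smul _).neg

theorem gexp_weight_insert (k : X → K) {x : X} {T : Finset X} (hx : x ∉ T) :
    gexp (weight (J := J) ε k (insert x T))
      = (1 - (ε : ℂ) • (form (barField k x) * form (field k x))) * gexp (weight ε k T) := by
  have : weight (J := J) ε k (insert x T)
      = -((ε : ℂ) • (form (barField k x) * form (field k x))) + weight ε k T := by
    rw [weight, Finset.sum_insert hx, neg_add]; rfl
  rw [this, gexp_add (((bos_form_mul_form _ _).smul _).neg) (bos_weight k T),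
    gexp_of_sq_eq_zero (by rw [neg_mul_neg, bos_form_sq]), sub_eq_add_neg]

theorem mem_listLabels_map {k : X → K} {l : List X} {j : (K ⊕ K) ⊕ J} :
    j ∈ listLabels (l.map k) ↔
      ∃ x ∈ l, j = Sum.inl (Sum.inl (k x)) ∨ j = Sum.inl (Sum.inr (k x)) := by
  simp [listLabels, pairLabels]

theorem pairIntegral_fields (i : K) :
    pairIntegral i (form (Pi.single (Sum.inl (Sum.inl i)) 1)
      * form (Pi.single (Sum.inl (Sum.inr i)) 1) : Grass ((K ⊕ K) ⊕ J)) = -1 := by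
  simp only [pairIntegral, Module.End.mul_apply]
  rw [leftDeriv_ι_mul, leftDeriv_ι]
  simp [leftDeriv_ι]

theorem listIntegral_coherent_diag (hε : 0 < ε) (k : X → K) (hk : Function.Injective k)
    (l : List X) (hl : l.Nodup) (S : Finset X) (hS : S ⊆ l.toFinset) :
    listIntegral (l.map k) (cohR ε (field k) S * cohL ε (barField k) S
      * gexp (weight (J := J) ε k l.toFinset)) = algebraMap ℂ _ ((ε : ℂ) ^ l.length) := by
  induction l generalizing S with
  | nil =>
    obtain rfl : S = ∅ := by simpa using hS
    simp [weight, gexp_zero]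
  | cons x l ih =>
    have hxl : x ∉ l.toFinset := by simpa using (List.nodup_cons.1 hl).1
    have hl' := (List.nodup_cons.1 hl).2
    have hfree : FreeOf (listLabels (l.map k))
        (form (field k x) * form (barField k x) : Grass ((K ⊕ K) ⊕ J)) ∧
        FreeOf (listLabels (l.map k))
        (form (barField k x) * form (field k x) : Grass ((K ⊕ K) ⊕ J)) := by
      have h : ∀ j ∈ listLabels (J := J) (l.map k), field k x j = 0 ∧ barField k x j = 0 := by
        intro j hj
        obtain ⟨y, hy, h⟩ := mem_listLabels_map.1 hj
        have hyx : k y ≠ k x := fun h' => hxl (by rw [← hk h']; simpa using hy)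
        rcases h with rfl | rfl <;> simp [field, barField, hyx]
      exact ⟨(freeOf_form fun j hj => (h j hj).1).mul (freeOf_form fun j hj => (h j hj).2),
        (freeOf_form fun j hj => (h j hj).2).mul (freeOf_form fun j hj => (h j hj).1)⟩
    have hpair := pairIntegral_fields (J := J) (k x)
    change pairIntegral (k x) (form (barField k x) * form (field k x)) = -1 at hpair
    rw [List.toFinset_cons, gexp_weight_insert k hxl, List.map_cons, listIntegral_cons,
      Module.End.mul_apply, List.length_cons, pow_succ']
    by_cases hx : x ∈ S
    · have hS' : S.erase x ⊆ l.toFinset := by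
        intro y hy
        rw [Finset.mem_erase] at hy
        have := hS hy.2
        rw [List.toFinset_cons, Finset.mem_insert] at this
        exact this.resolve_left hy.1
      rw [← Finset.insert_erase hx, cohR_mul_cohL_insert hε _ _ (Finset.notMem_erase x S)]
      have hz : ∀ a b : Grass ((K ⊕ K) ⊕ J),
          (ε : ℂ) • (form (field k x) * form (barField k x)) * a
            * ((1 - (ε : ℂ) • (form (barField k x) * form (field k x))) * b)
          = (ε : ℂ) • (form (field k x) * form (barField k x)) * (a * b) := by
        intro a b
        have hc := ((bos_form_mul_form (barField (J := J) k x) (field k x)).smul (ε : ℂ)).1 a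
        rw [sub_mul, one_mul, mul_sub, mul_assoc _ a b, mul_assoc _ a (_ * b), ← mul_assoc a _ b,
          ← hc.eq]
        simp only [smul_mul_assoc, mul_smul_comm, mul_assoc, form_mul_form_mul_self, mul_zero,
          smul_zero, sub_zero]
      rw [hz, listIntegral_mul_left _ (hfree.1.smul _), ih hl' _ hS',
        pairIntegral_mul_right _ (freeOf_algebraMap _ _), map_smul, ι_anticomm, map_neg, hpair,
        neg_neg, map_mul, Algebra.smul_def, mul_one]
    · have hS' : S ⊆ l.toFinset := by
        intro y hy
        have := hS hy
        rw [List.toFinset_cons, Finset.mem_insert] at this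
        exact this.resolve_left fun h => hx (h ▸ hy)
      have hc := (((bos_form_mul_form (barField (J := J) k x) (field k x)).smul (ε : ℂ)).1
        (cohR ε (field k) S * cohL ε (barField k) S))
      rw [← mul_assoc, mul_sub, mul_one, ← hc.eq, ← one_sub_mul, mul_assoc,
        listIntegral_mul_left _ ?_, ih hl' _ hS',
        pairIntegral_mul_right _ (freeOf_algebraMap _ _), map_sub, map_smul, hpair, map_mul]
      · congr 1
        rw [Algebra.algebraMap_eq_smul_one]
        simp [pairIntegral, leftDeriv_one]
      · rw [sub_eq_add_neg, ← neg_smul]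
        exact (freeOf_one _).add (hfree.2.smul _)

/-- The resolution of the identity `∫ e^{-(ψbar, ψ)} |ψ⟩⟨ψbar| = 1`, in components. The power of `ε`
is the normalization of the Grassmann measure. -/
theorem listIntegral_coherent [Fintype X] (hε : 0 < ε) (k : X → K) (hk : Function.Injective k)
    (l : List X) (hl : l.Nodup) (hl' : ∀ x, x ∈ l) (S S' : Finset X) :
    listIntegral (l.map k) (cohR ε (field k) S * cohL ε (barField k) S'
      * gexp (weight (J := J) ε k Finset.univ))
        = if S = S' then algebraMap ℂ _ ((ε : ℂ) ^ Fintype.card X) else 0 := by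
  have hu : l.toFinset = Finset.univ := by ext x; simp [hl']
  split_ifs with h
  · subst h
    rw [← hu, listIntegral_coherent_diag hε k hk l hl S (by rw [hu]; exact Finset.subset_univ _),
      ← Finset.card_univ, ← hu, List.toFinset_card_of_nodup hl]
  -- an unmatched mode is integrated to zero
  obtain ⟨x, hx⟩ : ∃ x, ¬ (x ∈ S ↔ x ∈ S') := by
    by_contra! h'; exact h (Finset.ext h')
  have hweight : ∀ j ∈ pairLabels (K := K) (J := J) (k x),
      FreeOf {j} (gexp (weight (J := J) ε k (Finset.univ.erase x))) := by
    intro j hj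
    refine FreeOf.gexp ?_
    rw [weight, ← neg_one_smul ℂ]
    refine (FreeOf.sum _ _ fun y hy => ?_).smul _
    have hyx : k y ≠ k x := fun h' => (Finset.mem_erase.1 hy).1 (hk h')
    simp only [pairLabels, Set.mem_insert_iff, Set.mem_singleton_iff] at hj
    refine ((freeOf_form ?_).mul (freeOf_form ?_)).smul _ <;>
    · rintro i rfl
      rcases hj with rfl | rfl <;> simp [field, barField, hyx.symm]
  have hdrop : cohR ε (field k) S * cohL ε (barField k) S'
        * ((ε : ℂ) • (form (barField k x) * form (field k x))) = (0 : Grass ((K ⊕ K) ⊕ J)) →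
      cohR ε (field k) S * cohL ε (barField k) S' * gexp (weight (J := J) ε k Finset.univ)
        = cohR ε (field k) S * cohL ε (barField k) S'
          * gexp (weight (J := J) ε k (Finset.univ.erase x)) := by
    intro h0
    rw [← Finset.insert_erase (Finset.mem_univ x), gexp_weight_insert k (Finset.notMem_erase _ _),
      ← mul_assoc, mul_sub, h0, mul_one, sub_zero, Finset.insert_erase (Finset.mem_univ x)]
  have hmem : k x ∈ l.map k := List.mem_map_of_mem (hl' x)
  by_cases hxS : x ∈ S
  · have hxS' : x ∉ S' := fun h' => hx (by simp [hxS, h'])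
    have h0 : cohR ε (field k) S * cohL ε (barField k) S'
        * ((ε : ℂ) • (form (barField k x) * form (field k x))) = (0 : Grass ((K ⊕ K) ⊕ J)) := by
      rw [← (((bos_form_mul_form (barField (J := J) k x) (field k x)).smul (ε : ℂ)).1 _).eq,
        smul_mul_assoc, mul_assoc, ← mul_assoc (form (field k x)), form_mul_cohR_of_mem ε _ hxS]
      simp
    rw [hdrop h0]
    have hj : (Sum.inl (Sum.inl (k x)) : (K ⊕ K) ⊕ J) ∈ pairLabels (J := J) (k x) := by
      simp [pairLabels]
    refine listIntegral_eq_zero hmem hj (((FreeOf.mul ?_ ?_).mul (hweight _ hj)) _ rfl)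
    · exact freeOf_cohR _ _ (by rintro y - j rfl; simp [field])
    · refine freeOf_cohL _ _ ?_
      rintro y hy j rfl
      have : k x ≠ k y := fun h' => hxS' (hk h' ▸ hy)
      simp [barField, this]
  · have hxS' : x ∈ S' := by by_contra h'; exact hx (by simp [hxS, h'])
    have h0 : cohR ε (field k) S * cohL ε (barField k) S'
        * ((ε : ℂ) • (form (barField k x) * form (field k x))) = (0 : Grass ((K ⊕ K) ⊕ J)) := by
      rw [mul_smul_comm, mul_assoc, ← mul_assoc (cohL _ _ _), cohL_mul_form_of_mem ε _ hxS']
      simp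
    rw [hdrop h0]
    have hj : (Sum.inl (Sum.inr (k x)) : (K ⊕ K) ⊕ J) ∈ pairLabels (J := J) (k x) := by
      simp [pairLabels]
    refine listIntegral_eq_zero hmem hj (((FreeOf.mul ?_ ?_).mul (hweight _ hj)) _ rfl)
    · refine freeOf_cohR _ _ ?_
      rintro y hy j rfl
      have : k x ≠ k y := fun h' => hxS (hk h' ▸ hy)
      simp [field, this]
    · exact freeOf_cohL _ _ (by rintro y - j rfl; simp [barField])

end Resolution

/-! ### Traces of operator products as Grassmann integrals -/

section Trace

variable {X K J : Type*} [LinearOrder X] [Fintype X] [DecidableEq K] [DecidableEq J]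

theorem cohR_mul_cohL (ε : ℝ) (p q : X → J → ℂ) (S S' : Finset X) :
    cohR ε q S * cohL ε p S'
      = ((-1 : ℂ) ^ (S.card * S'.card)) • (cohL ε p S' * cohR ε q S) := by
  induction S using Finset.induction_on with
  | empty => simp
  | insert x S hx ih =>
    rw [cohR_insert ε q hx, smul_mul_assoc, mul_assoc, ih, mul_smul_comm, ← mul_assoc,
      form_mul_cohL, Finset.card_insert_of_notMem hx, mul_smul_comm, add_mul, one_mul, pow_add,
      smul_mul_assoc, mul_assoc, smul_smul, smul_smul, smul_smul]
    congr 1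
    ring

theorem cohR_neg (ε : ℝ) (q : X → J → ℂ) (S : Finset X) :
    cohR ε (-q) S = ((-1 : ℂ) ^ S.card) • cohR ε q S := by
  induction S using Finset.induction_on with
  | empty => simp
  | insert x S hx ih =>
    rw [cohR_insert ε _ hx, cohR_insert ε _ hx, ih, Finset.card_insert_of_notMem hx, pow_succ,
      smul_comm]
    simp

/-- Cyclicity of the trace changes the sign of the fields, which leads to the antiperiodic boundary
condition in time. -/
theorem sum_cohR_mul_cohL (ε : ℝ) (p q : X → J → ℂ) (ρ : Matrix (Finset X) (Finset X) ℂ)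
    (hρ : parity * ρ = ρ * parity) :
    ∑ S, cohR ε q S * (cohL ε p ᵥ* lift ρ) S = kernel ε p (lift ρ) (-q) := by
  have hpar : ∀ S' S, ρ S' S ≠ 0 → (-1 : ℂ) ^ S'.card = (-1) ^ S.card := by
    intro S' S h
    have h1 := congrFun (congrFun hρ S') S
    rw [parity, Matrix.diagonal_mul, Matrix.mul_diagonal, mul_comm] at h1
    exact mul_left_cancel₀ h h1
  simp only [kernel, Matrix.vecMul, Matrix.mulVec, dotProduct, Finset.mul_sum, lift,
    Matrix.map_apply]
  rw [Finset.sum_comm]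
  refine Finset.sum_congr rfl fun S' _ => Finset.sum_congr rfl fun S _ => ?_
  by_cases h : ρ S' S = 0
  · simp [h]
  have h2 : (-1 : ℂ) ^ (S.card * S'.card) = (-1) ^ S.card := by
    rw [pow_mul, ← hpar S' S h, ← pow_mul]
    rcases Nat.even_or_odd S'.card with h' | h'
    · rw [h'.neg_one_pow, (h'.mul_right _).neg_one_pow]
    · rw [h'.neg_one_pow, (h'.mul h').neg_one_pow]
  rw [← mul_assoc, cohR_mul_cohL, h2, cohR_neg, ← Algebra.commutes, ← Algebra.smul_def,
    ← Algebra.smul_def]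
  simp only [mul_smul_comm]

variable (ε : ℝ) (κ : ℕ → X → K) (O : ℕ → Matrix (Finset X) (Finset X) (Grass ((K ⊕ K) ⊕ J)))

/-- `|ψ_j⟩ e^{-(ψbar_j, ψ_j)} ⟨ψbar_j|`, which integrates to the identity. -/
def slice (k : X → K) : Matrix (Finset X) (Finset X) (Grass ((K ⊕ K) ⊕ J)) :=
  Matrix.of fun S S' => cohR ε (field k) S * cohL ε (barField k) S' * gexp (weight ε k Finset.univ)

/-- The operators `O 0, …, O (n-1)`, each preceded by a resolution of the identity. -/
def chain : ℕ → Matrix (Finset X) (Finset X) (Grass ((K ⊕ K) ⊕ J))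
  | 0 => 1
  | n + 1 => chain n * (slice ε (κ n) * O n)

/-- `O 0 * ⋯ * O (n-1)`. -/
def opProd {M : Type*} [Monoid M] (O : ℕ → M) : ℕ → M
  | 0 => 1
  | n + 1 => opProd O n * O n

/-- The labels of the fields at the sites `0, …, n-1`. -/
def chainLabels : ℕ → List K
  | 0 => []
  | n + 1 => (Finset.univ : Finset X).toList.map (κ n) ++ chainLabels n

theorem mem_chainLabels (n : ℕ) (k : K) : k ∈ chainLabels κ n ↔ ∃ j < n, ∃ x, κ j x = k := by
  induction n with
  | zero => simp [chainLabels]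
  | succ n ih =>
    simp only [chainLabels, List.mem_append, List.mem_map, Finset.mem_toList, Finset.mem_univ,
      true_and, ih, Nat.lt_succ_iff_lt_or_eq]
    constructor
    · rintro (⟨x, rfl⟩ | ⟨j, hj, x, rfl⟩)
      · exact ⟨n, Or.inr rfl, x, rfl⟩
      · exact ⟨j, Or.inl hj, x, rfl⟩
    · rintro ⟨j, hj | rfl, x, rfl⟩
      · exact Or.inr ⟨j, hj, x, rfl⟩
      · exact Or.inl ⟨x, rfl⟩

/-- The sites `0, …, n-1` of the chain are distinct. -/
def ChainInj (n : ℕ) : Prop := ∀ i < n, ∀ j < n, ∀ x y, κ i x = κ j y → i = j ∧ x = y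

theorem nodup_chainLabels (n : ℕ) (hκ : ChainInj κ n) : (chainLabels κ n).Nodup := by
  induction n with
  | zero => simp [chainLabels]
  | succ n ih =>
    rw [chainLabels, List.nodup_append]
    refine ⟨(Finset.nodup_toList _).map_on fun x _ y _ h =>
      (hκ n (by omega) n (by omega) x y h).2, ih fun i hi j hj => hκ i (by omega) j (by omega), ?_⟩
    rintro a ha b hb rfl
    obtain ⟨x, _, rfl⟩ := List.mem_map.1 ha
    obtain ⟨j, hj, y, h⟩ := (mem_chainLabels κ n _).1 hb
    have := (hκ j (by omega) n (by omega) y x h).1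
    omega

/-- Integrating out the fields of a chain, one resolution of the identity at a time, leaves the
product of the operators. -/
theorem listIntegral_chain {ε : ℝ} (hε : 0 < ε) (n : ℕ) (hκ : ChainInj κ n)
    (hO : ∀ j < n, ∀ S S', ∀ l : List K, FreeOf (listLabels l) (O j S S')) (S S' : Finset X) :
    listIntegral (chainLabels κ n) (chain ε κ O n S S')
      = ((ε : ℂ) ^ (Fintype.card X * n)) • opProd O n S S' := by
  induction n generalizing S' with
  | zero => simp [chainLabels, chain, opProd]
  | succ n ih =>
    have hprod : ∀ m ≤ n, ∀ S S', ∀ l : List K, FreeOf (listLabels l) (opProd O m S S') := by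
      intro m hm
      induction m with
      | zero =>
        intro S S' l
        rw [opProd, Matrix.one_apply]
        split_ifs
        · exact freeOf_one _
        · intro j _; exact map_zero _
      | succ m ihm =>
        intro S S' l
        rw [opProd, Matrix.mul_apply]
        exact FreeOf.sum _ _ fun S1 _ => (ihm (by omega) _ _ _).mul (hO m (by omega) _ _ _)
    have hslice : ∀ S S', FreeOf (listLabels (chainLabels κ n)) (slice (J := J) ε (κ n) S S') := by
      intro S S'
      have hz : ∀ (x : X), ∀ j ∈ listLabels (J := J) (chainLabels κ n),
          field (κ n) x j = 0 ∧ barField (κ n) x j = 0 := by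
        rintro x j ⟨k, hk, hj⟩
        obtain ⟨i, hi, y, rfl⟩ := (mem_chainLabels κ n k).1 hk
        have hne : κ i y ≠ κ n x := fun h => by
          have := (hκ i (by omega) n (by omega) y x h).1; omega
        simp only [pairLabels, Set.mem_insert_iff, Set.mem_singleton_iff] at hj
        rcases hj with rfl | rfl <;> simp [field, barField, hne]
      refine ((freeOf_cohR _ _ fun x _ j hj => (hz x j hj).1).mul
        (freeOf_cohL _ _ fun x _ j hj => (hz x j hj).2)).mul (FreeOf.gexp ?_)
      rw [weight, ← neg_one_smul ℂ]
      exact (FreeOf.sum _ _ fun x _ => ((freeOf_form fun j hj => (hz x j hj).2).mul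
        (freeOf_form fun j hj => (hz x j hj).1)).smul _).smul _
    have hstep : ∀ S1 S2 : Finset X, listIntegral ((Finset.univ : Finset X).toList.map (κ n))
        ((slice ε (κ n) * O n : Matrix _ _ (Grass ((K ⊕ K) ⊕ J))) S1 S2)
          = ((ε : ℂ) ^ Fintype.card X) • O n S1 S2 := by
      intro S1 S2
      rw [Matrix.mul_apply, map_sum]
      rw [Finset.sum_eq_single S1]
      · rw [listIntegral_mul_right _ (hO n (by omega) _ _ _), slice, Matrix.of_apply,
          listIntegral_coherent hε _ (fun x y h => (hκ n (by omega) n (by omega) x y h).2) _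
            (Finset.nodup_toList _) (by simp), if_pos rfl, ← Algebra.smul_def]
      · intro S3 _ h
        rw [listIntegral_mul_right _ (hO n (by omega) _ _ _), slice, Matrix.of_apply,
          listIntegral_coherent hε _ (fun x y h => (hκ n (by omega) n (by omega) x y h).2) _
            (Finset.nodup_toList _) (by simp), if_neg h.symm, zero_mul]
      · simp
    rw [chainLabels, listIntegral_append, Module.End.mul_apply, chain, Matrix.mul_apply, map_sum,
      map_sum, opProd, Matrix.mul_apply, Finset.smul_sum]
    refine Finset.sum_congr rfl fun S1 _ => ?_
    rw [listIntegral_mul_right, ih (fun i hi j hj => hκ i (by omega) j (by omega))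
      (fun j hj => hO j (by omega)), smul_mul_assoc, map_smul,
      listIntegral_mul_left _ (hprod n le_rfl _ _ _), hstep, mul_smul_comm, smul_smul, ← pow_add,
      mul_add, mul_one]
    rw [Matrix.mul_apply]
    exact FreeOf.sum _ _ fun S2 _ => (hslice _ _).mul (hO n (by omega) _ _ _)

/-- If the operators have exponential kernels `e^{E j}`, then the chain is an exponential, up to the
coherent states at its two ends. -/
theorem chain_apply (n : ℕ) (E : ℕ → Grass ((K ⊕ K) ⊕ J)) (hE : ∀ j, Bos (E j))
    (hker : ∀ j < n, kernel ε (barField (κ j)) (O j) (field (κ (j + 1))) = gexp (E j))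
    (S S' : Finset X) :
    chain ε κ O (n + 1) S S'
      = gexp ((∑ j ∈ Finset.range (n + 1), weight ε (κ j) Finset.univ)
          + ∑ j ∈ Finset.range n, E j)
        * (cohR ε (field (κ 0)) S * (cohL ε (barField (κ n)) ᵥ* O n) S') := by
  have hslice : ∀ (j : ℕ) (S S' : Finset X),
      (slice ε (κ j) * O j : Matrix _ _ (Grass ((K ⊕ K) ⊕ J))) S S'
        = gexp (weight ε (κ j) Finset.univ)
      * (cohR ε (field (κ j)) S * (cohL ε (barField (κ j)) ᵥ* O j) S') := by
    intro j S S'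
    rw [Matrix.mul_apply, Matrix.vecMul, dotProduct, Finset.mul_sum, Finset.mul_sum]
    refine Finset.sum_congr rfl fun S1 _ => ?_
    rw [slice, Matrix.of_apply, ← (commute_gexp ((bos_weight (J := J) (κ j) Finset.univ).1 _)).eq]
    simp only [mul_assoc]
  induction n generalizing S' with
  | zero => simp [chain, hslice]
  | succ n ih =>
    rw [chain, Matrix.mul_apply]
    have hw : ∀ m, Bos (∑ j ∈ Finset.range m, weight (J := J) ε (κ j) Finset.univ) :=
      fun m => Bos.sum _ _ fun j _ => bos_weight _ _
    have hEs : ∀ m, Bos (∑ j ∈ Finset.range m, E j) := fun m => Bos.sum _ _ fun j _ => hE j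
    have hsplit : gexp ((∑ j ∈ Finset.range (n + 1 + 1), weight ε (κ j) Finset.univ)
          + ∑ j ∈ Finset.range (n + 1), E j)
        = gexp ((∑ j ∈ Finset.range (n + 1), weight ε (κ j) Finset.univ)
          + ∑ j ∈ Finset.range n, E j) * gexp (weight (J := J) ε (κ (n + 1)) Finset.univ)
          * gexp (E n) := by
      rw [← gexp_add ((hw _).add (hEs _)) (bos_weight _ _),
        ← gexp_add (((hw _).add (hEs _)).add (bos_weight _ _)) (hE n), Finset.sum_range_succ _ (n + 1),
        Finset.sum_range_succ E n]
      congr 1; abel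
    have hg : ∀ y, Commute (gexp (weight (J := J) ε (κ (n + 1)) Finset.univ)) y :=
      fun y => commute_gexp ((bos_weight (J := J) _ _).1 y)
    rw [hsplit, mul_assoc _ (gexp (E n)), ← mul_assoc (gexp (E n)),
      (commute_gexp ((hE n).1 (cohR ε (field (κ 0)) S))).eq, ← hker n (by omega), kernel,
      Matrix.dotProduct_mulVec, dotProduct]
    simp only [ih (fun j hj => hker j (by omega)), hslice]
    rw [Finset.mul_sum, Finset.sum_mul, Finset.mul_sum]
    refine Finset.sum_congr rfl fun S1 _ => ?_
    rw [mul_assoc _ _ (gexp _ * _), ← mul_assoc _ (gexp _), ← (hg _).eq]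
    simp only [mul_assoc]

end Trace

/-! ### Canonical anticommutation relations -/

section CAR

variable {X : Type*} [LinearOrder X] [Fintype X] {ε : ℝ}

theorem annih_mul_apply (x : X) (M : Matrix (Finset X) (Finset X) ℂ) (S S' : Finset X) :
    (annih ε x * M) S S' = if x ∈ S then 0 else
      (√ε : ℂ)⁻¹ * (-1) ^ (S.filter (· < x)).card * M (insert x S) S' := by
  rw [Matrix.mul_apply, Finset.sum_eq_single (insert x S)]
  · by_cases h : x ∈ S <;> simp [annih, h]
  · intro b _ hb; simp [annih, hb]
  · simp

theorem creat_mul_apply (x : X) (M : Matrix (Finset X) (Finset X) ℂ) (S S' : Finset X) :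
    (creat ε x * M) S S' = if x ∈ S then
      (√ε : ℂ)⁻¹ * (-1) ^ (S.filter (· < x)).card * M (S.erase x) S' else 0 := by
  rw [Matrix.mul_apply, Finset.sum_eq_single (S.erase x)]
  · by_cases h : x ∈ S
    · have hf : ((S.erase x).filter (· < x)) = S.filter (· < x) := by
        ext y; simp only [Finset.mem_filter, Finset.mem_erase]
        exact ⟨fun h => ⟨h.1.2, h.2⟩, fun h => ⟨⟨h.2.ne, h.1⟩, h.2⟩⟩
      simp [creat, annih, h, Matrix.conjTranspose_apply, hf]
    · have : S ≠ insert x S := fun h' => h (h' ▸ Finset.mem_insert_self _ _)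
      simp [creat, annih, h, Matrix.conjTranspose_apply, this]
  · intro b _ hb
    have : ¬ (x ∉ b ∧ S = insert x b) := by
      rintro ⟨h1, rfl⟩; exact hb (by rw [Finset.erase_insert h1])
    simp only [creat, annih, Matrix.conjTranspose_apply, Matrix.of_apply, if_neg this, star_zero,
      zero_mul]
  · simp

theorem card_filter_insert {x : X} {S : Finset X} (hx : x ∉ S) (y : X) :
    ((insert x S).filter (· < y)).card = (S.filter (· < y)).card + if x < y then 1 else 0 := by
  rw [Finset.filter_insert]
  split_ifs with h
  · rw [Finset.card_insert_of_notMem (by simp [hx])]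
  · simp

theorem annih_anticomm (x y : X) : annih ε x * annih ε y = -(annih ε y * annih ε x) := by
  rw [← mul_one (annih ε x * annih ε y), ← mul_one (annih ε y * annih ε x), mul_assoc, mul_assoc]
  ext S S'
  rw [Matrix.neg_apply]
  simp only [annih_mul_apply]
  by_cases hxy : x = y
  · subst hxy; simp
  by_cases hx : x ∈ S
  · simp [hx]
  by_cases hy : y ∈ S
  · simp [hy]
  rw [Finset.insert_comm]
  simp only [hx, hy, Finset.mem_insert, hxy, Ne.symm hxy, or_self, if_false, card_filter_insert hx,
    card_filter_insert hy]
  rcases lt_or_gt_of_ne hxy with h | h <;> simp only [h, h.not_gt, if_true, if_false] <;> ring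

theorem creat_anticomm (x y : X) : creat ε x * creat ε y = -(creat ε y * creat ε x) := by
  have := congrArg Matrix.conjTranspose (annih_anticomm (ε := ε) y x)
  rwa [Matrix.conjTranspose_neg, Matrix.conjTranspose_mul, Matrix.conjTranspose_mul] at this

theorem annih_mul_creat (hε : 0 < ε) (x y : X) :
    annih ε x * creat ε y
      = (if x = y then ((ε : ℂ)⁻¹) • 1 else 0) - creat ε y * annih ε x := by
  have hs : (√ε : ℂ)⁻¹ * (√ε : ℂ)⁻¹ = (ε : ℂ)⁻¹ := by
    rw [← mul_inv]; congr 1; exact_mod_cast Real.mul_self_sqrt hε.le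
  have hsq : ∀ n : ℕ, (-1 : ℂ) ^ n * (-1) ^ n = 1 := fun n => by rw [← mul_pow]; simp
  rw [← mul_one (annih ε x * creat ε y), ← mul_one (creat ε y * annih ε x), mul_assoc, mul_assoc]
  ext S S'
  rw [Matrix.sub_apply]
  simp only [annih_mul_apply, creat_mul_apply, Matrix.one_apply]
  by_cases hxy : x = y
  · subst hxy
    by_cases hx : x ∈ S
    · have hf : ((S.erase x).filter (· < x)) = S.filter (· < x) := by
        ext y; simp only [Finset.mem_filter, Finset.mem_erase]
        exact ⟨fun h => ⟨h.1.2, h.2⟩, fun h => ⟨⟨h.2.ne, h.1⟩, h.2⟩⟩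
      simp only [hx, if_true, Finset.mem_erase, ne_eq, not_true_eq_false, false_and, if_false, hf,
        Finset.insert_erase hx, Matrix.smul_apply, smul_eq_mul, Matrix.one_apply]
      linear_combination (if S = S' then (1 : ℂ) else 0)
        * (hs + (√ε : ℂ)⁻¹ * (√ε : ℂ)⁻¹ * hsq ((S.filter (· < x)).card))
    · simp only [hx, if_true, if_false, Finset.mem_insert_self, card_filter_insert hx,
        Finset.erase_insert hx, lt_irrefl, add_zero, Matrix.smul_apply, smul_eq_mul,
        Matrix.one_apply]
      linear_combination (if S = S' then (1 : ℂ) else 0)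
        * (hs + (√ε : ℂ)⁻¹ * (√ε : ℂ)⁻¹ * hsq ((S.filter (· < x)).card))
  · by_cases hx : x ∈ S
    · simp [hx, hxy]
    by_cases hy : y ∈ S
    · obtain ⟨S0, hy0, rfl⟩ : ∃ S0, y ∉ S0 ∧ S = insert y S0 :=
        ⟨S.erase y, Finset.notMem_erase y S, (Finset.insert_erase hy).symm⟩
      have hx0 : x ∉ S0 := fun h => hx (Finset.mem_insert_of_mem h)
      have hyx0 : y ∉ insert x S0 := by simp [hy0, Ne.symm hxy]
      simp only [hx, hxy, if_false, Finset.mem_insert_self, if_true, Finset.insert_comm x y,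
        Finset.erase_insert hy0, Finset.erase_insert hyx0, hx0, card_filter_insert hy0,
        card_filter_insert hyx0, card_filter_insert hx0, lt_irrefl, Matrix.zero_apply]
      rcases lt_or_gt_of_ne hxy with h | h <;> simp only [h, h.not_gt, if_true, if_false] <;> ring
    · simp [hx, hy, hxy, Ne.symm hxy]

theorem parity_mul_parity : (parity : Matrix (Finset X) (Finset X) ℂ) * parity = 1 := by
  rw [parity, Matrix.diagonal_mul_diagonal, ← Matrix.diagonal_one]
  congr 1; funext S; rw [← mul_pow]; simp

theorem parity_mul_annih (x : X) : parity * annih ε x = -(annih ε x * parity) := by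
  ext S S'
  rw [parity, Matrix.diagonal_mul, Matrix.neg_apply, Matrix.mul_diagonal, annih, Matrix.of_apply]
  split_ifs with h
  · rw [h.2, Finset.card_insert_of_notMem h.1]; ring
  · simp

theorem parity_conjTranspose : (parity : Matrix (Finset X) (Finset X) ℂ)ᴴ = parity := by
  rw [parity, Matrix.diagonal_conjTranspose]
  congr 1; funext S; simp

theorem parity_mul_creat (x : X) : parity * creat ε x = -(creat ε x * parity) := by
  have := congrArg Matrix.conjTranspose (parity_mul_annih (ε := ε) x)
  rw [Matrix.conjTranspose_neg, Matrix.conjTranspose_mul, Matrix.conjTranspose_mul,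
    parity_conjTranspose] at this
  rw [creat, this, neg_neg]

end CAR

/-! ### Exponentials of bilinear operators -/

section Exp

attribute [local instance] Matrix.linftyOpNormedRing Matrix.linftyOpNormedAlgebra

/-- An intertwiner of two matrices intertwines their exponentials. -/
theorem mul_exp_of_mul_eq {m n : Type*} [Fintype m] [Fintype n] [DecidableEq m] [DecidableEq n]
    (C : Matrix m n ℂ) (A : Matrix n n ℂ) (B : Matrix m m ℂ) (h : C * A = B * C) :
    C * NormedSpace.exp A = NormedSpace.exp B * C := by
  have hp : ∀ k : ℕ, C * A ^ k = B ^ k * C := by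
    intro k
    induction k with
    | zero => simp
    | succ k ih => rw [pow_succ, ← Matrix.mul_assoc, ih, Matrix.mul_assoc, h, ← Matrix.mul_assoc, ← pow_succ]
  have hA := (NormedSpace.exp_series_hasSum_exp' (𝕂 := ℂ) A).map
    (AddMonoidHom.mk' (fun M : Matrix n n ℂ => C * M) (fun a b => Matrix.mul_add C a b))
    (by exact continuous_const.matrix_mul continuous_id)
  have hB := (NormedSpace.exp_series_hasSum_exp' (𝕂 := ℂ) B).map
    (AddMonoidHom.mk' (fun M : Matrix m m ℂ => M * C) (fun a b => Matrix.add_mul a b C))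
    (by exact continuous_id.matrix_mul continuous_const)
  refine hA.unique ?_
  have : (fun M : Matrix n n ℂ => C * M) ∘ (fun k : ℕ => ((k.factorial : ℂ)⁻¹ • A ^ k))
      = (fun M : Matrix m m ℂ => M * C) ∘ (fun k : ℕ => ((k.factorial : ℂ)⁻¹ • B ^ k)) := by
    funext k
    simp [hp]
  change HasSum _ _
  rw [show ⇑(AddMonoidHom.mk' (fun M : Matrix n n ℂ => C * M) (fun a b => Matrix.mul_add C a b))
    = fun M : Matrix n n ℂ => C * M from rfl, this]
  exact hB

open scoped Kronecker in
theorem exp_kronecker_one {m n : Type*} [Fintype m] [Fintype n] [DecidableEq m] [DecidableEq n]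
    (M : Matrix m m ℂ) :
    NormedSpace.exp (M ⊗ₖ (1 : Matrix n n ℂ)) = NormedSpace.exp M ⊗ₖ (1 : Matrix n n ℂ) := by
  let f : Matrix m m ℂ →ₐ[ℂ] Matrix (m × n) (m × n) ℂ :=
    AlgHom.ofLinearMap ((Matrix.kroneckerBilinear (R := ℂ)).flip (1 : Matrix n n ℂ))
      (Matrix.one_kronecker_one) (fun a b => by
        change (a * b) ⊗ₖ (1 : Matrix n n ℂ) = (a ⊗ₖ 1) * (b ⊗ₖ 1)
        rw [← Matrix.mul_kronecker_mul, one_mul])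
  exact (NormedSpace.map_exp f (LinearMap.continuous_of_finiteDimensional f.toLinearMap) M).symm

open scoped Kronecker in
theorem exp_one_kronecker {m n : Type*} [Fintype m] [Fintype n] [DecidableEq m] [DecidableEq n]
    (M : Matrix n n ℂ) :
    NormedSpace.exp ((1 : Matrix m m ℂ) ⊗ₖ M) = (1 : Matrix m m ℂ) ⊗ₖ NormedSpace.exp M := by
  let f : Matrix n n ℂ →ₐ[ℂ] Matrix (m × n) (m × n) ℂ :=
    AlgHom.ofLinearMap ((Matrix.kroneckerBilinear (R := ℂ)) (1 : Matrix m m ℂ))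
      (Matrix.one_kronecker_one) (fun a b => by
        change (1 : Matrix m m ℂ) ⊗ₖ (a * b) = (1 ⊗ₖ a) * (1 ⊗ₖ b)
        rw [← Matrix.mul_kronecker_mul, one_mul])
  exact (NormedSpace.map_exp f (LinearMap.continuous_of_finiteDimensional f.toLinearMap) M).symm

variable {X : Type*} [LinearOrder X] [Fintype X] {ε : ℝ}

/-- The second quantization `(a*, M a)` of a one-particle operator. -/
abbrev secondQuant (ε : ℝ) (M : Matrix X X ℂ) : Matrix (Finset X) (Finset X) ℂ :=
  pairing ε M (creat ε) (annih ε)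

theorem annih_mul_secondQuant (hε : 0 < ε) (M : Matrix X X ℂ) (x : X) :
    annih ε x * secondQuant ε M = secondQuant ε M * annih ε x + ∑ y, M x y • annih ε y := by
  have h1 : ∀ y z, annih ε x * (creat ε y * annih ε z)
      = (if x = y then (ε : ℂ)⁻¹ • annih ε z else 0) + creat ε y * annih ε z * annih ε x := by
    intro y z
    rw [← mul_assoc, annih_mul_creat hε, sub_mul, mul_assoc (creat ε y), annih_anticomm x z,
      mul_neg, sub_neg_eq_add, mul_assoc]
    congr 1
    split_ifs <;> simp
  have hε' : (ε : ℂ) ≠ 0 := by exact_mod_cast hε.ne'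
  simp only [secondQuant, pairing, mul_smul_comm, smul_mul_assoc, Finset.mul_sum, Finset.sum_mul,
    h1, smul_add, Finset.sum_add_distrib]
  rw [add_comm]
  congr 1
  simp only [smul_ite, smul_zero]
  rw [Finset.sum_eq_single x]
  · simp only [if_true, Finset.smul_sum]
    refine Finset.sum_congr rfl fun y _ => ?_
    rw [smul_smul, smul_smul, mul_right_comm, mul_inv_cancel₀ hε', one_mul]
  · intro y _ hy; simp [hy.symm]
  · simp

open scoped Kronecker in
/-- The Heisenberg evolution of the annihilation operators under a bilinear Hamiltonian. -/
theorem annih_mul_exp_secondQuant (hε : 0 < ε) (M : Matrix X X ℂ) (x : X) :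
    annih ε x * NormedSpace.exp (secondQuant ε M)
      = ∑ y, NormedSpace.exp M x y • (NormedSpace.exp (secondQuant ε M) * annih ε y) := by
  -- the column of all annihilation operators intertwines the evolutions
  set C : Matrix (X × Finset X) (Finset X) ℂ := Matrix.of fun i S => annih ε i.1 i.2 S with hC
  set D := secondQuant ε M with hD
  have hCm : ∀ (N : Matrix (Finset X) (Finset X) ℂ) i S, (C * N) i S = (annih ε i.1 * N) i.2 S :=
    fun N i S => rfl
  have hK : ∀ (M' : Matrix X X ℂ) (N : Matrix (Finset X) (Finset X) ℂ) i S,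
      ((M' ⊗ₖ N) * C) i S = ∑ y, M' i.1 y * (N * annih ε y) i.2 S := by
    intro M' N i S
    rw [Matrix.mul_apply, Fintype.sum_prod_type]
    simp only [Matrix.kroneckerMap_apply, Matrix.mul_apply, Finset.mul_sum, hC, Matrix.of_apply,
      mul_assoc]
  have h : C * D = (M ⊗ₖ (1 : Matrix (Finset X) (Finset X) ℂ) + (1 : Matrix X X ℂ) ⊗ₖ D) * C := by
    ext i S
    rw [Matrix.add_mul, Matrix.add_apply, hK, hK, hCm, annih_mul_secondQuant hε, Matrix.add_apply, add_comm]
    congr 1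
    · simp [Matrix.sum_apply]
    · rw [Finset.sum_eq_single i.1]
      · simp [hD]
      · intro y _ hy; simp [hy.symm]
      · simp
  have hcomm : Commute (M ⊗ₖ (1 : Matrix (Finset X) (Finset X) ℂ)) ((1 : Matrix X X ℂ) ⊗ₖ D) := by
    rw [commute_iff_eq, ← Matrix.mul_kronecker_mul, ← Matrix.mul_kronecker_mul]; simp
  have h2 := mul_exp_of_mul_eq C D _ h
  rw [Matrix.exp_add_of_commute _ _ hcomm, exp_kronecker_one, exp_one_kronecker,
    ← Matrix.mul_kronecker_mul, mul_one, one_mul] at h2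
  ext S S'
  have h3 := congrFun (congrFun h2 (x, S)) S'
  rw [hCm, hK] at h3
  rw [h3]
  simp [Matrix.sum_apply]

theorem parity_mul_exp_secondQuant (M : Matrix X X ℂ) :
    parity * NormedSpace.exp (secondQuant ε M) = NormedSpace.exp (secondQuant ε M) * parity := by
  refine mul_exp_of_mul_eq _ _ _ ?_
  simp only [secondQuant, pairing, mul_smul_comm, smul_mul_assoc, Finset.mul_sum, Finset.sum_mul]
  simp only [← mul_assoc, parity_mul_creat, neg_mul]
  simp only [mul_assoc, parity_mul_annih, mul_neg, neg_neg]

theorem exp_secondQuant_empty (M : Matrix X X ℂ) (S : Finset X) :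
    NormedSpace.exp (secondQuant ε M) ∅ S = if S = ∅ then 1 else 0 := by
  set C : Matrix Unit (Finset X) ℂ := Matrix.of fun _ S => if S = ∅ then 1 else 0 with hC
  have hCm : ∀ (N : Matrix (Finset X) (Finset X) ℂ) i S, (C * N) i S = N ∅ S := by
    intro N i S
    rw [Matrix.mul_apply, Finset.sum_eq_single ∅] <;> simp +contextual [hC]
  have h : C * secondQuant ε M = (0 : Matrix Unit Unit ℂ) * C := by
    ext i S
    rw [hCm, Matrix.zero_mul, secondQuant, pairing, Matrix.smul_apply, Matrix.sum_apply]
    simp only [Matrix.sum_apply, Matrix.smul_apply, creat_mul_apply]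
    simp
  have h2 := congrFun (congrFun (mul_exp_of_mul_eq C _ 0 h) ()) S
  rw [hCm, NormedSpace.exp_zero, Matrix.one_mul] at h2
  exact h2

/-- The matrix element of the exponential of a bilinear operator between coherent states. -/
theorem kernel_exp_secondQuant {J : Type*} (hε : 0 < ε) (M : Matrix X X ℂ) (p q : X → J → ℂ) :
    kernel ε p (lift (NormedSpace.exp (secondQuant ε M))) q
      = gexp (pairing ε (NormedSpace.exp M) (fun x => form (p x)) (fun x => form (q x))) := by
  have h : lift (NormedSpace.exp (secondQuant ε M)) *ᵥ cohR ε q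
      = cohR ε (fun x => ∑ y, NormedSpace.exp M x y • q y) := by
    refine eq_cohR hε _ _ ?_ fun x S => ?_
    · rw [Matrix.mulVec, dotProduct, Finset.sum_eq_single ∅]
      · simp [lift, exp_secondQuant_empty]
      · intro S _ hS; simp [lift, exp_secondQuant_empty, hS]
      · simp
    · rw [Matrix.mulVec_mulVec, ← lift_mul, annih_mul_exp_secondQuant hε]
      have hl : ∀ y, lift (NormedSpace.exp M x y • (NormedSpace.exp (secondQuant ε M) * annih ε y))
          = (NormedSpace.exp M x y) • lift (J := J) (NormedSpace.exp (secondQuant ε M) * annih ε y) := by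
        intro y; ext S S'
        rw [lift, Matrix.map_apply, Matrix.smul_apply, Matrix.smul_apply, smul_eq_mul, map_mul,
          ← Algebra.smul_def]
        rfl
      have hsum : lift (J := J) (∑ y, NormedSpace.exp M x y
            • (NormedSpace.exp (secondQuant ε M) * annih ε y))
          = ∑ y, NormedSpace.exp M x y
            • lift (J := J) (NormedSpace.exp (secondQuant ε M) * annih ε y) := by
        rw [← Finset.sum_congr rfl fun y _ => hl y]
        ext S S'
        simp [lift, Matrix.sum_apply]
      have hy : ∀ y, (lift (J := J) (NormedSpace.exp (secondQuant ε M) * annih ε y) *ᵥ cohR ε q) S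
          = ((-1 : ℂ) ^ S.card) • (form (q y)
            * (lift (NormedSpace.exp (secondQuant ε M)) *ᵥ cohR ε q) S) := by
        intro y
        rw [lift_mul, ← Matrix.mulVec_mulVec, Matrix.mulVec, Matrix.mulVec, dotProduct, dotProduct,
          Finset.mul_sum, Finset.smul_sum]
        refine Finset.sum_congr rfl fun S' _ => ?_
        by_cases h0 : NormedSpace.exp (secondQuant ε M) S S' = 0
        · simp [lift, h0]
        have hpar : (-1 : ℂ) ^ S.card = (-1) ^ S'.card := by
          have h1 := congrFun (congrFun (parity_mul_exp_secondQuant (ε := ε) M) S) S'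
          rw [parity, Matrix.diagonal_mul, Matrix.mul_diagonal, mul_comm] at h1
          exact mul_left_cancel₀ h0 h1
        rw [annih_mulVec_cohR hε, hpar, mul_smul_comm]
        congr 1
        simp only [lift, Matrix.map_apply]
        rw [← mul_assoc, Algebra.commutes, mul_assoc]
      rw [hsum, Matrix.sum_mulVec, Finset.sum_apply]
      simp only [Matrix.smul_mulVec, Pi.smul_apply, hy, map_sum, map_smul, Finset.sum_mul,
        Finset.smul_sum, smul_mul_assoc]
      exact Finset.sum_congr rfl fun y _ => smul_comm _ _ _
  have h1 := kernel_one hε p (fun x => ∑ y, NormedSpace.exp M x y • q y)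
  rw [kernel, Matrix.one_mulVec] at h1
  rw [kernel, h, h1, pairing]
  simp only [map_sum, map_smul, Finset.mul_sum, mul_smul_comm]

end Exp

/-! ### Normal ordering -/

section NormalOrder

variable {X : Type*} [LinearOrder X] [Fintype X] {ε : ℝ}

/-- Left multiplication by the creation operators, and graded right multiplication by the
annihilation operators; these maps anticommute. -/
def orderedField (ε : ℝ) :
    (X ⊕ X → ℂ) →ₗ[ℂ] Module.End ℂ (Matrix (Finset X) (Finset X) ℂ) :=
  Fintype.linearCombination ℂ (Sum.elim
    (fun x => LinearMap.mulLeft ℂ (creat ε x))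
    (fun x => LinearMap.mulRight ℂ (parity * annih ε x) ∘ₗ LinearMap.mulLeft ℂ parity))

theorem linearComb_sq {n : Type*} [Fintype n] {R : Type*} [Ring R] [Algebra ℂ R] (a : n → R)
    (ha : ∀ x y, a x * a y = -(a y * a x)) (m : n → ℂ) :
    (∑ x, m x • a x) * (∑ x, m x • a x) = 0 := by
  have h : (∑ x, m x • a x) * (∑ x, m x • a x) = -((∑ x, m x • a x) * (∑ x, m x • a x)) := by
    conv_lhs => rw [Finset.sum_mul_sum, Finset.sum_comm]
    rw [Finset.sum_mul_sum, ← Finset.sum_neg_distrib]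
    refine Finset.sum_congr rfl fun x _ => ?_
    rw [← Finset.sum_neg_distrib]
    refine Finset.sum_congr rfl fun y _ => ?_
    rw [smul_mul_smul_comm, smul_mul_smul_comm, ha, smul_neg, mul_comm]
  have h2 := eq_neg_iff_add_eq_zero.1 h
  rw [← two_smul ℂ] at h2
  exact (smul_eq_zero.1 h2).resolve_left two_ne_zero

theorem orderedField_apply (m : X ⊕ X → ℂ) (O : Matrix (Finset X) (Finset X) ℂ) :
    orderedField ε m O = (∑ x, m (Sum.inl x) • creat ε x) * O
      + parity * O * parity * (∑ x, m (Sum.inr x) • annih ε x) := by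
  simp only [orderedField, Fintype.linearCombination_apply, Fintype.sum_sum_type, Sum.elim_inl,
    Sum.elim_inr, LinearMap.add_apply, LinearMap.sum_apply, LinearMap.smul_apply,
    LinearMap.mulLeft_apply, LinearMap.comp_apply, LinearMap.mulRight_apply, Finset.sum_mul,
    Finset.mul_sum, smul_mul_assoc, mul_smul_comm, mul_assoc]

theorem orderedField_sq (m : X ⊕ X → ℂ) : orderedField ε m * orderedField ε m = 0 := by
  refine LinearMap.ext fun O => ?_
  rw [Module.End.mul_apply]
  simp only [orderedField_apply]
  have hA := linearComb_sq (creat ε) creat_anticomm (fun x : X => m (Sum.inl x))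
  have hB := linearComb_sq (annih ε) annih_anticomm (fun x : X => m (Sum.inr x))
  have hpA : parity * (∑ x, m (Sum.inl x) • creat ε x)
      = -((∑ x, m (Sum.inl x) • creat ε x) * parity) := by
    simp [Finset.mul_sum, Finset.sum_mul, parity_mul_creat]
  have hpB : parity * (∑ x, m (Sum.inr x) • annih ε x)
      = -((∑ x, m (Sum.inr x) • annih ε x) * parity) := by
    simp [Finset.mul_sum, Finset.sum_mul, parity_mul_annih]
  set A := ∑ x, m (Sum.inl x) • creat ε x
  set B := ∑ x, m (Sum.inr x) • annih ε x
  set γ : Matrix (Finset X) (Finset X) ℂ := parity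
  have hγ : γ * γ = 1 := parity_mul_parity
  have e1 : A * (A * O) = 0 := by rw [← mul_assoc, hA, zero_mul]
  have e2 : γ * (A * O) * γ * B = -(A * (γ * O * γ * B)) := by
    rw [← mul_assoc γ A, hpA]; simp only [neg_mul, mul_assoc]
  have e3 : γ * (γ * O * γ * B) * γ * B = 0 := by
    calc γ * (γ * O * γ * B) * γ * B = γ * γ * O * (γ * B) * γ * B := by simp only [mul_assoc]
      _ = -(γ * γ * O * B * (γ * γ) * B) := by rw [hpB]; simp only [mul_neg, neg_mul, mul_assoc]
      _ = -(O * (B * B)) := by rw [hγ]; simp only [one_mul, mul_one, mul_assoc]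
      _ = 0 := by rw [hB, mul_zero, neg_zero]
  simp only [mul_add, add_mul, e1, e2, e3, LinearMap.zero_apply]
  abel

/-- Polynomials in fields acting on operators: `ψbar x` by left multiplication with `a*(x)`, and
`ψ x` by graded right multiplication with `a(x)`. Applied to the identity, this gives the normal
ordered operator. -/
def normalOrder (ε : ℝ) : Grass (X ⊕ X) →ₐ[ℂ] Module.End ℂ (Matrix (Finset X) (Finset X) ℂ) :=
  ExteriorAlgebra.lift ℂ ⟨orderedField ε, orderedField_sq⟩

theorem normalOrder_form (m : X ⊕ X → ℂ) : normalOrder ε (form m) = orderedField ε m :=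
  ExteriorAlgebra.lift_ι_apply _ _ _ _

theorem normalOrder_gen_inl (x : X) (O : Matrix (Finset X) (Finset X) ℂ) :
    normalOrder ε (gen (Sum.inl x)) O = creat ε x * O := by
  rw [gen, normalOrder_form, orderedField_apply]
  simp [Pi.single_apply, ite_smul]

theorem normalOrder_gen_inr (x : X) (O : Matrix (Finset X) (Finset X) ℂ) :
    normalOrder ε (gen (Sum.inr x)) O = parity * O * parity * annih ε x := by
  rw [gen, normalOrder_form, orderedField_apply]
  simp [Pi.single_apply, ite_smul]

theorem normalOrder_list_inl (l : List X) (O : Matrix (Finset X) (Finset X) ℂ) :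
    normalOrder ε (l.map fun x => gen (Sum.inl x)).prod O = (l.map (creat ε)).prod * O := by
  induction l with
  | nil => simp
  | cons x l ih =>
    rw [List.map_cons, List.prod_cons, map_mul, Module.End.mul_apply, ih, normalOrder_gen_inl,
      List.map_cons, List.prod_cons, mul_assoc]

theorem normalOrder_list_inr (l : List X) :
    normalOrder ε (l.map fun x => gen (Sum.inr x)).prod (1 : Matrix (Finset X) (Finset X) ℂ)
      = (l.map (annih ε)).prod := by
  have h : ∀ (l : List X) (x : X), parity * (l.map (annih ε)).prod * parity * annih ε x
      = annih ε x * (l.map (annih ε)).prod := by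
    intro l x
    induction l with
    | nil => simp [parity_mul_parity]
    | cons y l ih =>
      rw [List.map_cons, List.prod_cons, ← mul_assoc parity, parity_mul_annih]
      simp only [mul_assoc] at ih
      simp only [neg_mul, mul_assoc, ih]
      rw [← mul_assoc, annih_anticomm y x, neg_mul, neg_neg, mul_assoc]
  induction l with
  | nil => simp
  | cons x l ih =>
    rw [List.map_cons, List.prod_cons, map_mul, Module.End.mul_apply, ih, normalOrder_gen_inr, h,
      List.map_cons, List.prod_cons]

theorem map_normalPoly {R R' F : Type*} [Ring R] [Algebra ℂ R] [Ring R'] [Algebra ℂ R']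
    [FunLike F R R'] [AlgHomClass F ℂ R R'] (f : F) (v : (m m' : ℕ) → (Fin m → X) → (Fin m' → X) → ℂ)
    (φbar φ : X → R) :
    f (normalPoly ε v φbar φ) = normalPoly ε v (fun x => f (φbar x)) (fun x => f (φ x)) := by
  simp only [normalPoly, map_sum, map_smul, map_mul, map_list_prod, List.map_ofFn,
    Function.comp_def]

theorem map_pairing {K R R' F : Type*} [Fintype K] [Ring R] [Algebra ℂ R] [Ring R'] [Algebra ℂ R']
    [FunLike F R R'] [AlgHomClass F ℂ R R'] (f : F) (M : Matrix K K ℂ) (φbar φ : K → R) :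
    f (pairing ε M φbar φ) = pairing ε M (fun x => f (φbar x)) (fun x => f (φ x)) := by
  simp only [pairing, map_sum, map_smul, map_mul]

theorem normalOrder_normalPoly (v : (m m' : ℕ) → (Fin m → X) → (Fin m' → X) → ℂ) :
    normalOrder ε (normalPoly ε v (fun x => gen (Sum.inl x)) (fun x => gen (Sum.inr x)))
      (1 : Matrix (Finset X) (Finset X) ℂ) = normalPoly ε v (creat ε) (annih ε) := by
  simp only [normalPoly, map_sum, map_smul, LinearMap.sum_apply, LinearMap.smul_apply, map_mul,
    Module.End.mul_apply]
  refine Finset.sum_congr rfl fun m _ => Finset.sum_congr rfl fun m' _ =>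
    Finset.sum_congr rfl fun x _ => Finset.sum_congr rfl fun y _ => ?_
  have h1 := normalOrder_list_inl (ε := ε) (List.ofFn y)
  have h2 := normalOrder_list_inr (ε := ε) (List.ofFn x)
  simp only [List.map_ofFn, Function.comp_def] at h1 h2
  rw [h2, h1]

theorem normalOrder_pairing (M : Matrix X X ℂ) :
    normalOrder ε (pairing ε M (fun x => gen (Sum.inl x)) (fun x => gen (Sum.inr x)))
      (1 : Matrix (Finset X) (Finset X) ℂ) = secondQuant ε M := by
  simp only [pairing, map_sum, map_smul, LinearMap.sum_apply, LinearMap.smul_apply, map_mul,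
    Module.End.mul_apply, normalOrder_gen_inr, normalOrder_gen_inl, mul_one, parity_mul_parity,
    one_mul]

theorem subst_elim_gen {J : Type*} (p q : X → J → ℂ) :
    (∀ x, subst (Sum.elim p q) (gen (Sum.inl x)) = form (p x)) ∧
    (∀ x, subst (Sum.elim p q) (gen (Sum.inr x)) = form (q x)) :=
  ⟨fun _ => subst_gen _ _, fun _ => subst_gen _ _⟩

/-- Between coherent states, the fields in a normal ordered operator are replaced by their
values. -/
theorem kernel_normalOrder {J : Type*} (hε : 0 < ε) (p q : X → J → ℂ) (f : Grass (X ⊕ X))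
    (O : Matrix (Finset X) (Finset X) ℂ) :
    kernel ε p (lift (normalOrder ε f O)) q = subst (Sum.elim p q) f * kernel ε p (lift O) q := by
  have hadd : ∀ O O' : Matrix (Finset X) (Finset X) ℂ,
      kernel ε p (lift (O + O')) q = kernel ε p (lift O) q + kernel ε p (lift O') q := by
    intro O O'
    have : lift (J := J) (O + O') = lift O + lift O' := by ext; simp [lift]
    rw [kernel, this, Matrix.add_mulVec, dotProduct_add]; rfl
  have hsmul : ∀ (c : ℂ) (O : Matrix (Finset X) (Finset X) ℂ),
      kernel ε p (lift (c • O)) q = c • kernel ε p (lift O) q := by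
    intro c O
    have : lift (J := J) (c • O) = c • lift O := by
      ext S S'
      rw [lift, Matrix.map_apply, Matrix.smul_apply, Matrix.smul_apply, smul_eq_mul, map_mul,
        ← Algebra.smul_def]
      rfl
    rw [kernel, this, Matrix.smul_mulVec, dotProduct_smul]; rfl
  have hsum : ∀ (s : Finset X) (g : X → Matrix (Finset X) (Finset X) ℂ),
      kernel ε p (lift (∑ x ∈ s, g x)) q = ∑ x ∈ s, kernel ε p (lift (g x)) q := by
    intro s g
    let k : Matrix (Finset X) (Finset X) ℂ →+ Grass J :=
      AddMonoidHom.mk' (fun O => kernel ε p (lift O) q) hadd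
    exact map_sum k g s
  induction f using grass_induction generalizing O with
  | one => simp
  | add a b ha hb => rw [map_add, LinearMap.add_apply, hadd, ha, hb, map_add, add_mul]
  | smul r a ha => rw [map_smul, LinearMap.smul_apply, hsmul, ha, map_smul, smul_mul_assoc]
  | ι_mul m a ha =>
    rw [map_mul, map_mul, Module.End.mul_apply, normalOrder_form, orderedField_apply, hadd,
      mul_assoc (subst _ _), ← ha, subst_ι, Fintype.sum_sum_type, map_add, add_mul]
    simp only [Finset.sum_mul, Finset.mul_sum, hsum, map_sum, Sum.elim_inl, Sum.elim_inr, map_smul,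
      smul_mul_assoc, mul_smul_comm, hsmul, lift_mul, kernel_creat_mul hε]
    congr 1
    refine Finset.sum_congr rfl fun x _ => ?_
    rw [← kernel_mul_annih hε]
    simp only [lift_mul]

end NormalOrder

/-! ### The time step and the Trotter limit -/

section Step

attribute [local instance] Matrix.linftyOpNormedRing Matrix.linftyOpNormedAlgebra

variable {X : Type*} [LinearOrder X] [Fintype X] {ε : ℝ}

/-- The operator of a time step. Its matrix elements between coherent states are
`e^{(φbar, e^{t M} φ) + t z v(φbar, φ)}`. -/
def stepOp (ε : ℝ) (M : Matrix X X ℂ) (v : (m m' : ℕ) → (Fin m → X) → (Fin m' → X) → ℂ) (z t : ℂ) :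
    Matrix (Finset X) (Finset X) ℂ :=
  normalOrder ε (gexp (pairing ε (NormedSpace.exp (t • M) - 1)
      (fun x => gen (Sum.inl x)) (fun x => gen (Sum.inr x)))
    * gexp ((t * z) • normalPoly ε v (fun x => gen (Sum.inl x)) (fun x => gen (Sum.inr x)))) 1

variable (M : Matrix X X ℂ) (v : (m m' : ℕ) → (Fin m → X) → (Fin m' → X) → ℂ) (z : ℂ)

/-- The operator of a time step has an exponential kernel. This is exact in `t`, since normal
ordering is built into `stepOp`. -/
theorem kernel_stepOp {J : Type*} (hε : 0 < ε)
    (heven : ∀ m m' : ℕ, Odd (m + m') → ∀ x y, v m m' x y = 0) (hconst : ∀ x y, v 0 0 x y = 0)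
    (p q : X → J → ℂ) (t : ℂ) :
    kernel ε p (lift (stepOp ε M v z t)) q
      = gexp (pairing ε (NormedSpace.exp (t • M)) (fun x => form (p x)) (fun x => form (q x))
        + (t * z) • normalPoly ε v (fun x => form (p x)) (fun x => form (q x))) := by
  have h1 : Bos (pairing ε (NormedSpace.exp (t • M) - 1)
      (fun x : X => (gen (Sum.inl x) : Grass (X ⊕ X))) (fun x => gen (Sum.inr x))) :=
    bos_pairing _ _ _ _
  have h2 : Bos (normalPoly ε v
      (fun x : X => (gen (Sum.inl x) : Grass (X ⊕ X))) (fun x => gen (Sum.inr x))) :=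
    bos_normalPoly ε v _ _ heven hconst
  have hone : (ε : ℂ) • ∑ x, form (p x) * form (q x)
      = pairing ε 1 (fun x => form (p x)) (fun x => form (q x)) := by
    simp [pairing, Matrix.one_apply, ite_smul]
  rw [stepOp, kernel_normalOrder hε, lift_one, kernel_one hε, map_mul, map_gexp h1.2,
    map_gexp (h2.smul _).2, map_smul, map_pairing, map_normalPoly, hone]
  simp only [(subst_elim_gen p q).1, (subst_elim_gen p q).2]
  rw [mul_assoc, ((commute_gexp (((bos_normalPoly ε v p q heven hconst).smul (t * z)).1 _))).eq,
    ← mul_assoc, ← gexp_add (bos_pairing _ _ _ _) (bos_pairing _ _ _ _),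
    ← gexp_add ((bos_pairing _ _ _ _).add (bos_pairing _ _ _ _))
      ((bos_normalPoly ε v p q heven hconst).smul _)]
  congr 2
  simp only [pairing, ← smul_add, ← Finset.sum_add_distrib, ← add_smul, Matrix.sub_apply,
    sub_add_cancel]

/-- An algebra homomorphism from a Grassmann algebra to a Banach algebra maps the exponential of a
nilpotent element to the analytic exponential. -/
theorem map_gexp_eq_exp {J 𝔸 : Type*} [NormedRing 𝔸] [NormedAlgebra ℂ 𝔸] (f : Grass J →ₐ[ℂ] 𝔸)
    {a : Grass J} (ha : IsNilpotent a) : f (gexp a) = NormedSpace.exp (f a) := by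
  let _ : Module ℚ 𝔸 := Module.compHom 𝔸 (algebraMap ℚ ℂ)
  obtain ⟨k, hk⟩ := ha
  have hk' : f a ^ k = 0 := by rw [← map_pow, hk, map_zero]
  rw [map_gexp ⟨k, hk⟩, gexp, IsNilpotent.exp_eq_sum hk', NormedSpace.exp_eq_tsum ℂ]
  simp only
  rw [tsum_eq_sum (s := Finset.range k)]
  · refine Finset.sum_congr rfl fun i _ => ?_
    rw [← Rat.cast_smul_eq_qsmul ℂ]
    simp
  · intro i hi
    rw [pow_eq_zero_of_le (by simpa using hi) hk', smul_zero]

/-- The product `exp (L (h t)) * exp ((t * z) • a)`, whose exponents vanish at `t = 0`, has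
derivative `L h' + z • a` there. -/
theorem hasDerivAt_exp_mul_exp {E 𝔸 F : Type*} [NormedAddCommGroup E] [NormedSpace ℂ E]
    [FiniteDimensional ℂ E] [NormedRing 𝔸] [NormedAlgebra ℂ 𝔸] [FiniteDimensional ℂ 𝔸]
    [NormedAddCommGroup F] [NormedSpace ℂ F] (L : E →ₗ[ℂ] 𝔸) (ev : 𝔸 →ₗ[ℂ] F) (h : ℂ → E) (h' : E)
    (hh : HasDerivAt h h' 0) (h0 : h 0 = 0) (z : ℂ) (a : 𝔸) :
    HasDerivAt (fun t => ev (NormedSpace.exp (L (h t)) * NormedSpace.exp ((t * z) • a)))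
      (ev (L h' + z • a)) 0 := by
  have _ : CompleteSpace 𝔸 := FiniteDimensional.complete ℂ 𝔸
  have hexp : ∀ (g : ℂ → 𝔸) (g' : 𝔸), HasDerivAt g g' 0 → g 0 = 0 →
      HasDerivAt (fun t => NormedSpace.exp (g t)) g' 0 := by
    intro g g' hg hg0
    have h := hasFDerivAt_exp_zero (𝕂 := ℂ) (𝔸 := 𝔸)
    rw [← hg0] at h
    exact h.comp_hasDerivAt (0 : ℂ) hg
  have h1 := hexp _ _ ((LinearMap.toContinuousLinearMap L).hasFDerivAt.comp_hasDerivAt (0 : ℂ) hh)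
    (by simp [h0])
  have h2 := hexp (fun t : ℂ => (t * z) • a) (z • a)
    (by simpa using ((hasDerivAt_id (0 : ℂ)).mul_const z).smul_const a) (by simp)
  have h3 := (LinearMap.toContinuousLinearMap ev).hasFDerivAt.comp_hasDerivAt (0 : ℂ) (h1.mul h2)
  simpa [h0, Function.comp_def] using h3

/-- To first order in `t`, the operator of a time step agrees with the evolution generated by the free
part plus `z` times the interaction. -/
theorem hasDerivAt_stepOp
    (heven : ∀ m m' : ℕ, Odd (m + m') → ∀ x y, v m m' x y = 0) (hconst : ∀ x y, v 0 0 x y = 0) :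
    HasDerivAt (stepOp ε M v z) (secondQuant ε M + z • normalPoly ε v (creat ε) (annih ε)) 0 := by
  -- endomorphisms of the operator space as matrices, where the exponential is available
  set e := LinearMap.toMatrixAlgEquiv (Matrix.stdBasis ℂ (Finset X) (Finset X)) with he
  let ev : Matrix (Finset X × Finset X) (Finset X × Finset X) ℂ →ₗ[ℂ]
      Matrix (Finset X) (Finset X) ℂ := LinearMap.applyₗ 1 ∘ₗ e.symm.toLinearMap
  have hev : ∀ A, ev (e A) = A 1 := fun A => by
    change e.symm (e A) 1 = A 1
    rw [AlgEquiv.symm_apply_apply]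
  set P : Grass (X ⊕ X) →ₐ[ℂ] Matrix (Finset X × Finset X) (Finset X × Finset X) ℂ :=
    (e : _ →ₐ[ℂ] _).comp (normalOrder ε) with hP
  have hPe : ∀ f, P f = e (normalOrder ε f) := fun f => rfl
  let L : Matrix X X ℂ →ₗ[ℂ] Matrix (Finset X × Finset X) (Finset X × Finset X) ℂ :=
    { toFun := fun A => P (pairing ε A (fun x => gen (Sum.inl x)) (fun x => gen (Sum.inr x)))
      map_add' := fun A B => by
        rw [← map_add]; congr 1
        simp only [pairing, Matrix.add_apply, add_smul, Finset.sum_add_distrib, smul_add]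
      map_smul' := fun c A => by
        rw [RingHom.id_apply, ← map_smul]; congr 1
        simp only [pairing, Matrix.smul_apply, smul_eq_mul, mul_smul, Finset.smul_sum]
        refine Finset.sum_congr rfl fun x _ => Finset.sum_congr rfl fun y _ => smul_comm _ _ _ }
  have h1 : HasDerivAt (fun t : ℂ => NormedSpace.exp (t • M) - 1) M 0 := by
    have h1 := (hasDerivAt_exp_smul_const (𝕂 := ℂ) M (0 : ℂ)).sub_const 1
    rwa [zero_smul, NormedSpace.exp_zero, one_mul] at h1
  have h2 := hasDerivAt_exp_mul_exp L ev _ _ h1 (by simp) z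
    (P (normalPoly ε v (fun x => gen (Sum.inl x)) (fun x => gen (Sum.inr x))))
  have hfun : stepOp ε M v z = fun t => ev (NormedSpace.exp (L (NormedSpace.exp (t • M) - 1))
      * NormedSpace.exp ((t * z) • P (normalPoly ε v (fun x => gen (Sum.inl x))
        (fun x => gen (Sum.inr x))))) := by
    funext t
    have hb1 : Bos (pairing ε (NormedSpace.exp (t • M) - 1)
      (fun x : X => (gen (Sum.inl x) : Grass (X ⊕ X))) (fun x => gen (Sum.inr x))) :=
      bos_pairing _ _ _ _
    have hb2 : Bos (normalPoly ε v
      (fun x : X => (gen (Sum.inl x) : Grass (X ⊕ X))) (fun x => gen (Sum.inr x))) :=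
      bos_normalPoly ε v _ _ heven hconst
    rw [← map_smul P]
    change _ = ev (NormedSpace.exp (P _) * NormedSpace.exp (P _))
    have e1 : ∀ a, IsNilpotent a → NormedSpace.exp (P a) = P (gexp a) :=
      fun a ha => (map_gexp_eq_exp P ha).symm
    rw [e1 _ hb1.2, e1 _ (hb2.smul _).2, ← map_mul, hPe, hev]
    rfl
  have hval : secondQuant ε M + z • normalPoly ε v (creat ε) (annih ε)
      = ev (L M + z • P (normalPoly ε v (fun x => gen (Sum.inl x)) (fun x => gen (Sum.inr x)))) := by
    change _ = ev (P _ + z • P _)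
    rw [← map_smul, ← map_add, hPe, hev, map_add, map_smul, LinearMap.add_apply,
      LinearMap.smul_apply, normalOrder_normalPoly, normalOrder_pairing]
  rw [hfun, hval]
  exact h2

theorem stepOp_zero : stepOp ε M v z 0 = 1 := by
  simp [stepOp, pairing, gexp_zero]

theorem norm_pow_sub_pow_le {𝔸 : Type*} [NormedRing 𝔸] [NormOneClass 𝔸] (a b : 𝔸) (r : ℝ)
    (hr : 1 ≤ r) (ha : ‖a‖ ≤ r) (hb : ‖b‖ ≤ r) (n : ℕ) :
    ‖a ^ n - b ^ n‖ ≤ n * ‖a - b‖ * r ^ n := by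
  induction n with
  | zero => simp
  | succ n ih =>
    have h : a ^ (n + 1) - b ^ (n + 1) = a * (a ^ n - b ^ n) + (a - b) * b ^ n := by
      rw [pow_succ', pow_succ']; noncomm_ring
    have hbn : ‖b ^ n‖ ≤ r ^ n := (norm_pow_le b n).trans (by gcongr)
    have hr0 : 0 ≤ r := by linarith
    calc ‖a ^ (n + 1) - b ^ (n + 1)‖ ≤ ‖a * (a ^ n - b ^ n)‖ + ‖(a - b) * b ^ n‖ := by
          rw [h]; exact norm_add_le _ _
      _ ≤ r * (n * ‖a - b‖ * r ^ n) + ‖a - b‖ * r ^ n := by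
          refine add_le_add ((norm_mul_le _ _).trans ?_) ((norm_mul_le _ _).trans ?_)
          · gcongr
          · gcongr
      _ ≤ r * (n * ‖a - b‖ * r ^ n) + r * (‖a - b‖ * r ^ n) := by
          have : 0 ≤ ‖a - b‖ * r ^ n := by positivity
          nlinarith
      _ = _ := by push_cast; ring

/-- A curve through `1` with derivative `Y` approximates the one-parameter group `e^{t Y}`. -/
theorem tendsto_pow_exp {𝔸 : Type*} [NormedRing 𝔸] [NormOneClass 𝔸] [NormedAlgebra ℂ 𝔸]
    [CompleteSpace 𝔸] (K : ℂ → 𝔸) (Y : 𝔸) (hK : HasDerivAt K Y 0) (h0 : K 0 = 1) (T : ℂ) :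
    Filter.Tendsto (fun N : ℕ => K (T / N) ^ N) Filter.atTop (nhds (NormedSpace.exp (T • Y))) := by
  have key : ∀ K : ℂ → 𝔸, HasDerivAt K Y 0 → K 0 = 1 → Filter.Tendsto
      (fun N : ℕ => (N : ℂ) • (K (T / N) - 1)) Filter.atTop (nhds (T • Y)) := by
    intro K hK h0
    have h1 : HasDerivAt (fun s : ℂ => K (T * s)) (T • Y) 0 := by
      have hK' : HasDerivAt K Y (T * 0) := by rwa [mul_zero]
      have := HasDerivAt.scomp (0 : ℂ) hK' ((hasDerivAt_id (0 : ℂ)).const_mul T)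
      simpa [Function.comp_def] using this
    have h2 := hasDerivAt_iff_tendsto_slope.1 h1
    have h3 : Filter.Tendsto (fun N : ℕ => ((N : ℂ))⁻¹) Filter.atTop (nhdsWithin 0 {0}ᶜ) := by
      refine tendsto_nhdsWithin_iff.2 ⟨tendsto_inv_atTop_nhds_zero_nat, ?_⟩
      filter_upwards [Filter.eventually_gt_atTop 0] with N hN
      simpa using hN.ne'
    refine (h2.comp h3).congr fun N => ?_
    simp [slope, h0, div_eq_mul_inv]
  have hE : HasDerivAt (fun t : ℂ => NormedSpace.exp (t • Y)) Y 0 := by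
    have := hasDerivAt_exp_smul_const (𝕂 := ℂ) Y (0 : ℂ)
    rwa [zero_smul, NormedSpace.exp_zero, one_mul] at this
  have k1 := key K hK h0
  have k2 := key _ hE (by simp)
  have k3 : Filter.Tendsto (fun N : ℕ => (N : ℝ) * ‖K (T / N) - NormedSpace.exp ((T / N : ℂ) • Y)‖)
      Filter.atTop (nhds 0) := by
    have := (k1.sub k2).norm
    rw [sub_self, norm_zero] at this
    refine this.congr fun N => ?_
    rw [← smul_sub, norm_smul, sub_sub_sub_cancel_right]
    simp
  have hb : ∀ K : ℂ → 𝔸, Filter.Tendsto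
      (fun N : ℕ => (N : ℂ) • (K (T / N) - 1)) Filter.atTop (nhds (T • Y)) →
      ∀ᶠ N : ℕ in Filter.atTop, ‖K (T / N)‖ ≤ 1 + (‖T • Y‖ + 1) / N := by
    intro K hk
    filter_upwards [hk.norm.eventually_lt_const (lt_add_one _), Filter.eventually_gt_atTop 0]
      with N hN hN0
    have hN' : (0 : ℝ) < N := by exact_mod_cast hN0
    rw [norm_smul] at hN
    have h1 : ‖K (T / N) - 1‖ ≤ (‖T • Y‖ + 1) / N := by
      rw [le_div_iff₀ hN', mul_comm]
      simpa using hN.le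
    calc ‖K (T / N)‖ = ‖1 + (K (T / N) - 1)‖ := by congr 1; abel
      _ ≤ ‖(1 : 𝔸)‖ + ‖K (T / N) - 1‖ := norm_add_le _ _
      _ ≤ _ := by rw [norm_one]; linarith
  rw [tendsto_iff_norm_sub_tendsto_zero]
  have k4 := k3.mul_const (Real.exp (‖T • Y‖ + 1))
  rw [zero_mul] at k4
  refine squeeze_zero' (Filter.Eventually.of_forall fun N => norm_nonneg _) ?_ k4
  filter_upwards [hb _ k1, hb (fun t => NormedSpace.exp (t • Y)) k2,
    Filter.eventually_gt_atTop 0] with N h1 h2 hN0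
  have hN' : (0 : ℝ) < N := by exact_mod_cast hN0
  have hpow : NormedSpace.exp (T • Y) = NormedSpace.exp ((T / N : ℂ) • Y) ^ N := by
    let _ : NormedAlgebra ℚ 𝔸 := NormedAlgebra.restrictScalars ℚ ℂ 𝔸
    rw [← NormedSpace.exp_nsmul, ← Nat.cast_smul_eq_nsmul ℂ, smul_smul, mul_div_cancel₀]
    exact_mod_cast hN0.ne'
  have hc : (0 : ℝ) ≤ (‖T • Y‖ + 1) / N := by positivity
  rw [hpow]
  refine (norm_pow_sub_pow_le _ _ _ (by linarith) h1 h2 N).trans ?_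
  gcongr
  calc (1 + (‖T • Y‖ + 1) / N) ^ N ≤ (Real.exp ((‖T • Y‖ + 1) / N)) ^ N := by
        gcongr; rw [add_comm]; exact Real.add_one_le_exp _
    _ = Real.exp (‖T • Y‖ + 1) := by
        rw [← Real.exp_nat_mul]; congr 1; field_simp

/-- The Trotter limit. Only the first order of the time step in `t` matters. -/
theorem tendsto_stepOp_pow
    (heven : ∀ m m' : ℕ, Odd (m + m') → ∀ x y, v m m' x y = 0) (hconst : ∀ x y, v 0 0 x y = 0)
    (T : ℂ) : Filter.Tendsto (fun N : ℕ => stepOp ε M v z (T / N) ^ N) Filter.atTop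
      (nhds (NormedSpace.exp (T • (secondQuant ε M + z • normalPoly ε v (creat ε) (annih ε))))) :=
  tendsto_pow_exp _ _ (hasDerivAt_stepOp M v z heven hconst) (stepOp_zero M v z) T

end Step

/-! ### Source operators -/

section Sources

variable {X J : Type*} [LinearOrder X] [Fintype X] {ε : ℝ}

/-- A Grassmann linear form as an operator on Fock space that anticommutes with the fields. -/
def formOp (m : J → ℂ) : Matrix (Finset X) (Finset X) (Grass J) :=
  Matrix.diagonal fun S => (-1) ^ S.card * form m

theorem neg_one_pow_mul_eq_smul (n : ℕ) (x : Grass J) : (-1) ^ n * x = ((-1 : ℂ) ^ n) • x := by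
  rcases Nat.even_or_odd n with h | h <;> simp [h.neg_one_pow]

theorem formOp_mul_creat_vecMul (hε : 0 < ε) (m : J → ℂ) (p : X → J → ℂ) (x : X) :
    cohL ε p ᵥ* (formOp m * lift (creat ε x)) = fun S => form m * form (p x) * cohL ε p S := by
  have h : cohL ε p ᵥ* formOp m = fun S => form m * cohL ε p S := by
    funext S
    rw [formOp, Matrix.vecMul_diagonal, neg_one_pow_mul_eq_smul, mul_smul_comm, form_mul_cohL]
  funext S
  rw [← Matrix.vecMul_vecMul, h]
  have h2 : ((fun S => form m * cohL ε p S) ᵥ* lift (creat ε x)) S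
      = form m * (cohL ε p ᵥ* lift (creat ε x)) S := by
    simp only [Matrix.vecMul, dotProduct, Finset.mul_sum, mul_assoc]
  rw [h2, vecMul_creat_cohL hε, mul_assoc, form_mul_cohL]

theorem formOp_mul_annih_mulVec (hε : 0 < ε) (m : J → ℂ) (q : X → J → ℂ) (x : X) :
    (formOp m * lift (annih ε x)) *ᵥ cohR ε q = fun S => form m * form (q x) * cohR ε q S := by
  funext S
  rw [← Matrix.mulVec_mulVec, formOp, Matrix.mulVec_diagonal, annih_mulVec_cohR hε,
    neg_one_pow_mul_eq_smul, smul_mul_smul_comm, ← mul_pow]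
  simp [mul_assoc]

/-- If `u` is an eigenvector of `τ` with eigenvalue `s`, then it is one of `gexp τ` with eigenvalue
`gexp s`. -/
theorem vecMul_gexp {n : Type*} [Fintype n] [DecidableEq n] (u : n → Grass J)
    (τ : Matrix n n (Grass J)) (hτ : IsNilpotent τ) (s : Grass J) (hs : IsNilpotent s)
    (h : u ᵥ* τ = fun S => s * u S) : u ᵥ* gexp τ = fun S => gexp s * u S := by
  obtain ⟨a, ha⟩ := hτ
  obtain ⟨b, hb⟩ := hs
  have ha' : τ ^ (a + b) = 0 := pow_eq_zero_of_le (by omega) ha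
  have hb' : s ^ (a + b) = 0 := pow_eq_zero_of_le (by omega) hb
  have hk : ∀ k, u ᵥ* τ ^ k = fun S => s ^ k * u S := by
    intro k
    induction k with
    | zero => simp
    | succ k ih =>
      rw [pow_succ, ← Matrix.vecMul_vecMul, ih]
      funext S
      have := congrFun h S
      simp only [Matrix.vecMul, dotProduct, mul_assoc] at this ⊢
      rw [← Finset.mul_sum, this, ← mul_assoc, ← pow_succ]
  funext S
  rw [gexp, gexp, IsNilpotent.exp_eq_sum ha', IsNilpotent.exp_eq_sum hb', Matrix.vecMul_sum,
    Finset.sum_apply, Finset.sum_mul]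
  refine Finset.sum_congr rfl fun k _ => ?_
  rw [← Rat.cast_smul_eq_qsmul ℂ, ← Rat.cast_smul_eq_qsmul ℂ, Matrix.vecMul_smul, Pi.smul_apply, hk,
    smul_mul_assoc]

theorem gexp_mulVec {n : Type*} [Fintype n] [DecidableEq n] (u : n → Grass J)
    (τ : Matrix n n (Grass J)) (hτ : IsNilpotent τ) (s : Grass J) (hs : Bos s)
    (h : τ *ᵥ u = fun S => s * u S) : gexp τ *ᵥ u = fun S => gexp s * u S := by
  obtain ⟨a, ha⟩ := hτ
  obtain ⟨b, hb⟩ := hs.2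
  have ha' : τ ^ (a + b) = 0 := pow_eq_zero_of_le (by omega) ha
  have hb' : s ^ (a + b) = 0 := pow_eq_zero_of_le (by omega) hb
  have hk : ∀ k, τ ^ k *ᵥ u = fun S => s ^ k * u S := by
    intro k
    induction k with
    | zero => simp
    | succ k ih =>
      rw [pow_succ', ← Matrix.mulVec_mulVec, ih]
      funext S
      have := congrFun h S
      simp only [Matrix.mulVec, dotProduct] at this ⊢
      have hc : ∀ y, Commute (s ^ k) y := fun y => (hs.1 y).pow_left k
      simp only [← mul_assoc, ← (hc _).eq]
      simp only [mul_assoc]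
      rw [← Finset.mul_sum, this, ← mul_assoc, ← pow_succ, pow_succ']
  funext S
  rw [gexp, gexp, IsNilpotent.exp_eq_sum ha', IsNilpotent.exp_eq_sum hb', Matrix.sum_mulVec,
    Finset.sum_apply, Finset.sum_mul]
  refine Finset.sum_congr rfl fun k _ => ?_
  rw [← Rat.cast_smul_eq_qsmul ℂ, ← Rat.cast_smul_eq_qsmul ℂ, Matrix.smul_mulVec, Pi.smul_apply, hk,
    smul_mul_assoc]

/-- Products of sources and fields commute and square to zero. -/
theorem isNilpotent_source (a : X → Matrix (Finset X) (Finset X) ℂ)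
    (ha : ∀ x y, a x * a y = -(a y * a x)) (hp : ∀ x, parity * a x = -(a x * parity))
    (m : X → J → ℂ) :
    IsNilpotent (pairing ε 1 (fun x => formOp (m x)) (fun x => lift (J := J) (a x))) := by
  have hform : ∀ m : J → ℂ, (formOp m : Matrix (Finset X) (Finset X) (Grass J))
      = Matrix.diagonal (fun _ => form m) * lift parity := by
    intro m
    rw [formOp, lift, parity, Matrix.diagonal_map (map_zero _), Matrix.diagonal_mul_diagonal]
    congr 1; funext S
    simp only [map_pow, map_neg, map_one]
    exact ((Commute.neg_one_left (form m)).pow_left _).eq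
  have hcomm : ∀ (m : J → ℂ) (M : Matrix (Finset X) (Finset X) ℂ),
      lift M * Matrix.diagonal (fun _ => form m) = Matrix.diagonal (fun _ => form m) * lift M := by
    intro m M
    ext S S'
    rw [Matrix.mul_diagonal, Matrix.diagonal_mul, lift, Matrix.map_apply, Algebra.commutes]
  have hneg : ∀ M : Matrix (Finset X) (Finset X) ℂ, lift (J := J) (-M) = -lift M := by
    intro M; ext; simp [lift]
  have hprod : ∀ x y, formOp (m x) * lift (a x) * (formOp (m y) * lift (a y))
      = Matrix.diagonal (fun _ => form (m x) * form (m y)) * lift (J := J) (-(a x * a y)) := by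
    intro x y
    have h1 : parity * (a x * (parity * a y)) = -(a x * a y) := by
      rw [← mul_assoc, hp, neg_mul, mul_assoc, ← mul_assoc parity parity, parity_mul_parity, one_mul]
    rw [hform, hform]
    calc _ = Matrix.diagonal (fun _ => form (m x)) * (lift parity * ((lift (a x)
            * Matrix.diagonal (fun _ => form (m y))) * (lift parity * lift (a y)))) := by
          simp only [mul_assoc]
      _ = Matrix.diagonal (fun _ => form (m x)) * ((lift parity
            * Matrix.diagonal (fun _ => form (m y))) * (lift (a x) * (lift parity * lift (a y)))) := by
          rw [hcomm]; simp only [mul_assoc]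
      _ = (Matrix.diagonal (fun _ => form (m x)) * Matrix.diagonal (fun _ => form (m y)))
            * (lift parity * (lift (a x) * (lift parity * lift (a y)))) := by
          rw [hcomm]; simp only [mul_assoc]
      _ = _ := by
          rw [Matrix.diagonal_mul_diagonal, ← lift_mul, ← lift_mul, ← lift_mul, h1]
  have hone : pairing ε 1 (fun x => formOp (m x)) (fun x => lift (J := J) (a x))
      = (ε : ℂ) • ∑ x, formOp (m x) * lift (J := J) (a x) := by
    simp [pairing, Matrix.one_apply, ite_smul]
  rw [hone]
  refine IsNilpotent.smul ?_ _
  refine Commute.isNilpotent_sum (fun x _ => ⟨2, ?_⟩) fun x y _ _ => ?_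
  · rw [pow_two, hprod, form_mul_self, Matrix.diagonal_zero, zero_mul]
  · rw [commute_iff_eq, hprod, hprod, ι_anticomm (m x) (m y), ha x y, neg_neg]
    ext S S'
    simp [Matrix.diagonal_mul, hneg]

/-- The operator `e^{(c⁺, a*)} e^{(c⁻, a)}`, where `c⁺ x = form (mp x)` and `c⁻ x = form (mm x)`. -/
def sourceExp (ε : ℝ) (mp mm : X → J → ℂ) : Matrix (Finset X) (Finset X) (Grass J) :=
  gexp (pairing ε 1 (fun x => formOp (mp x)) (fun x => lift (creat ε x)))
    * gexp (pairing ε 1 (fun x => formOp (mm x)) (fun x => lift (annih ε x)))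

theorem pairing_one {R : Type*} [Ring R] [Algebra ℂ R] (φ χ : X → R) :
    pairing ε 1 φ χ = (ε : ℂ) • ∑ x, φ x * χ x := by
  simp [pairing, Matrix.one_apply, ite_smul]

/-- In the source insertion the creation operators stand to the left of the annihilation operators, so
that between coherent states the fields are replaced by their values. -/
theorem kernel_sourceExp (hε : 0 < ε) (mp mm p q : X → J → ℂ) :
    kernel ε p (sourceExp ε mp mm) q
      = gexp (pairing ε 1 (fun x => form (p x)) (fun x => form (q x))
        + (pairing ε 1 (fun x => form (mp x)) (fun x => form (p x))
          + pairing ε 1 (fun x => form (mm x)) (fun x => form (q x)))) := by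
  have hB : ∀ p q : X → J → ℂ, Bos (pairing ε 1 (fun x => form (p x)) (fun x => form (q x))) :=
    fun p q => bos_pairing _ _ _ _
  have h1 := vecMul_gexp (cohL ε p) _
    (isNilpotent_source (ε := ε) (creat ε) creat_anticomm parity_mul_creat mp)
    (pairing ε 1 (fun x => form (mp x)) (fun x => form (p x))) (hB _ _).2 (by
      funext S
      rw [pairing_one, pairing_one, Matrix.vecMul_smul, Matrix.vecMul_sum, Pi.smul_apply,
        Finset.sum_apply]
      simp only [formOp_mul_creat_vecMul hε, smul_mul_assoc, Finset.sum_mul])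
  have h2 := gexp_mulVec (cohR ε q) _
    (isNilpotent_source (ε := ε) (annih ε) annih_anticomm parity_mul_annih mm)
    (pairing ε 1 (fun x => form (mm x)) (fun x => form (q x))) (hB _ _) (by
      funext S
      rw [pairing_one, pairing_one, Matrix.smul_mulVec, Matrix.sum_mulVec, Pi.smul_apply,
        Finset.sum_apply]
      simp only [formOp_mul_annih_mulVec hε, smul_mul_assoc, Finset.sum_mul])
  rw [kernel, sourceExp, ← Matrix.mulVec_mulVec, Matrix.dotProduct_mulVec, h1, h2,
    gexp_add (hB _ _) ((hB _ _).add (hB _ _)), gexp_add (hB _ _) (hB _ _), pairing_one (ε := ε)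
    (fun x => form (p x)) (fun x => form (q x)), ← kernel_one hε, kernel, Matrix.one_mulVec,
    dotProduct, dotProduct, Finset.sum_mul]
  refine Finset.sum_congr rfl fun S _ => ?_
  rw [(commute_gexp ((hB mp p).1 (cohL ε p S))).eq]
  have hc := fun y => (commute_gexp ((hB mm q).1 y)).eq
  have hc' := fun y => (commute_gexp ((hB mp p).1 y)).eq
  rw [mul_assoc, hc, ← mul_assoc (gexp _), hc' (cohR ε q S), mul_assoc, mul_assoc]

end Sources

/-! ### The discretized Keldysh covariance -/

section Covariance

variable {X : Type*} [Fintype X] [DecidableEq X] {N : ℕ}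

/-- The blocks of the inverse covariance, with the one-step evolutions `U` (forward) and `U'`
(backward), and the initial state `P`. -/
def keldyshBlock (N : ℕ) (U U' P : Matrix X X ℂ) (ρ : Bool) (m : Fin (N + 1)) (σ : Bool)
    (n : Fin (N + 1)) : Matrix X X ℂ :=
  (if ρ = σ ∧ m = n then 1 else 0)
    - (if ρ = minus ∧ σ = minus ∧ (m : ℕ) + 1 = n then U' else 0)
    - (if ρ = plus ∧ σ = plus ∧ (n : ℕ) + 1 = m then U else 0)
    - (if ρ = minus ∧ σ = plus ∧ m = Fin.last N ∧ n = Fin.last N then 1 else 0)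
    + (if ρ = plus ∧ σ = minus ∧ m = 0 ∧ n = 0 then P else 0)

/-- The inverse covariance on the contour, without the restriction that `U'` is the adjoint of `U`
and `P` a Gibbs factor. Time indices start from `0`. -/
def keldysh (N : ℕ) (U U' P : Matrix X X ℂ) : Matrix (Contour X N) (Contour X N) ℂ :=
  Matrix.of fun k l => keldyshBlock N U U' P k.1 k.2.1 l.1 l.2.1 k.2.2 l.2.2

/-- A column of blocks. -/
def blockCol (v : Bool → ℕ → Matrix X X ℂ) : Matrix (Contour X N) X ℂ :=
  Matrix.of fun k y => v k.1 k.2.1 k.2.2 y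

theorem apply_congr_of_eq {m n α : Type*} {A B : Matrix m n α} (h : A = B) (i : m) (j : n) :
    A i j = B i j := by rw [h]

theorem keldysh_mul_blockCol (U U' P : Matrix X X ℂ) (v : Bool → ℕ → Matrix X X ℂ) :
    keldysh N U U' P * blockCol (N := N) v = blockCol (N := N) (fun ρ m => if ρ = plus then
      (if m = 0 then v plus 0 + P * v minus 0 else v plus m - U * v plus (m - 1))
      else (if m = N then v minus N - v plus N else v minus m - U' * v minus (m + 1))) := by
  ext ⟨ρ, m, x⟩ y
  have hsum : ∀ (B : Bool → Fin (N + 1) → Matrix X X ℂ),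
      ∑ l : Contour X N, B l.1 l.2.1 x l.2.2 * blockCol (N := N) v l y
        = (∑ σ : Bool, ∑ n : Fin (N + 1), B σ n * v σ n) x y := by
    intro B
    rw [Fintype.sum_prod_type, Matrix.sum_apply]
    refine Finset.sum_congr rfl fun σ _ => ?_
    rw [Fintype.sum_prod_type, Matrix.sum_apply]
    refine Finset.sum_congr rfl fun n _ => ?_
    rw [Matrix.mul_apply]
    rfl
  rw [Matrix.mul_apply]
  refine (hsum (fun σ n => keldyshBlock N U U' P ρ m σ n)).trans ?_
  simp only [blockCol, Matrix.of_apply]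
  refine apply_congr_of_eq ?_ x y
  rw [Fintype.sum_bool]
  cases ρ with
  | true =>
    simp only [if_true]
    have h1 : ∑ n : Fin (N + 1), keldyshBlock N U U' P true m true n * v true n
        = v true m - (if (m : ℕ) = 0 then 0 else U * v true (m - 1)) := by
      simp only [keldyshBlock, true_and, reduceCtorEq, false_and, if_false, sub_zero,
        add_zero, sub_mul, Finset.sum_sub_distrib, ite_mul, one_mul, zero_mul]
      congr 1
      · simp
      · split_ifs with h0
        · exact Finset.sum_eq_zero fun n _ => if_neg (by omega)
        · rw [Finset.sum_eq_single ⟨m - 1, by omega⟩]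
          · rw [if_pos (by simp; omega)]
          · intro n _ hn
            rw [if_neg]
            intro h; exact hn (Fin.ext (by simp; omega))
          · simp
    have h2 : ∑ n : Fin (N + 1), keldyshBlock N U U' P true m false n * v false n
        = if (m : ℕ) = 0 then P * v false 0 else 0 := by
      simp only [keldyshBlock, true_and, reduceCtorEq, false_and, if_false, sub_zero,
        zero_add, ite_mul, zero_mul]
      have hm : m = 0 ↔ (m : ℕ) = 0 := by rw [Fin.ext_iff]; rfl
      split_ifs with h0
      · rw [Finset.sum_eq_single 0]
        · simp [hm, h0]
        · intro n _ hn; simp [hn]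
        · simp
      · exact Finset.sum_eq_zero fun n _ => if_neg fun h => h0 (hm.1 h.1)
    rw [h1, h2]
    split_ifs with h0
    · rw [h0, sub_zero]
    · rw [add_zero]
  | false =>
    simp only [reduceCtorEq, if_false]
    have h1 : ∑ n : Fin (N + 1), keldyshBlock N U U' P false m false n * v false n
        = v false m - (if (m : ℕ) = N then 0 else U' * v false (m + 1)) := by
      simp only [keldyshBlock, true_and, reduceCtorEq, false_and, if_false, sub_zero,
        add_zero, sub_mul, Finset.sum_sub_distrib, ite_mul, one_mul, zero_mul]
      congr 1
      · simp
      · split_ifs with h0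
        · exact Finset.sum_eq_zero fun n _ => if_neg (by omega)
        · rw [Finset.sum_eq_single ⟨m + 1, by omega⟩]
          · rw [if_pos (by simp)]
          · intro n _ hn
            rw [if_neg]
            intro h; exact hn (Fin.ext (by simp; omega))
          · simp
    have h2 : ∑ n : Fin (N + 1), keldyshBlock N U U' P false m true n * v true n
        = if (m : ℕ) = N then -v true N else 0 := by
      simp only [keldyshBlock, true_and, reduceCtorEq, false_and, if_false, sub_zero,
        zero_sub, add_zero, neg_mul, ite_mul, one_mul, zero_mul]
      have hm : m = Fin.last N ↔ (m : ℕ) = N := by rw [Fin.ext_iff]; rfl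
      split_ifs with h0
      · rw [Finset.sum_eq_single (Fin.last N)]
        · simp [hm, h0]
        · intro n _ hn; simp [hn]
        · simp
      · exact Finset.sum_eq_zero fun n _ => by rw [if_neg fun h => h0 (hm.1 h.1), neg_zero]
    rw [h1, h2]
    split_ifs with h0
    · rw [h0, sub_zero]; abel
    · rw [zero_add]

theorem det_keldysh_zero (U U' : Matrix X X ℂ) : (keldysh N U U' 0).det = 1 := by
  -- ordered along the contour, the matrix is upper triangular with unit diagonal
  let b : Contour X N → ℕ := fun k => if k.1 = minus then (k.2.1 : ℕ) else 2 * N + 1 - k.2.1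
  have hinj : ∀ k l, b k = b l → k.1 = l.1 ∧ k.2.1 = l.2.1 := by
    rintro ⟨ρ, m, x⟩ ⟨σ, n, y⟩ h
    have h1 := m.2
    have h2 := n.2
    cases ρ <;> cases σ <;> simp [b, minus] at h ⊢ <;> (try ext) <;> omega
  have hentry : ∀ k l, b k = b l → keldysh N U U' 0 k l = (1 : Matrix X X ℂ) k.2.2 l.2.2 := by
    rintro ⟨ρ, m, x⟩ ⟨σ, n, y⟩ h
    obtain ⟨h1, h2⟩ := hinj _ _ h
    simp only at h1 h2
    subst h1 h2
    cases ρ <;> simp [keldysh, keldyshBlock]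
  have htri : (keldysh N U U' 0).BlockTriangular b := by
    rintro ⟨ρ, m, x⟩ ⟨σ, n, y⟩ h
    have h1 := m.2
    have h2 := n.2
    have hz : keldyshBlock N U U' 0 ρ m σ n = 0 := by
      cases ρ <;> cases σ <;> simp only [b, minus, if_true, if_false, reduceCtorEq] at h <;>
        simp only [keldyshBlock, true_and, false_and, if_false, reduceCtorEq, sub_zero, zero_sub,
          add_zero, ite_self, Fin.ext_iff, Fin.val_last]
      · rw [if_neg (by omega), if_neg (by omega), sub_zero]
      · rw [if_neg (by omega), neg_zero]
      · rw [if_neg (by omega), if_neg (by omega), sub_zero]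
    simp [keldysh, hz]
  rw [htri.det]
  refine Finset.prod_eq_one fun a _ => ?_
  have : (keldysh N U U' 0).toSquareBlock b a = 1 := by
    ext ⟨k, hk⟩ ⟨l, hl⟩
    have hkl : b k = b l := hk.trans hl.symm
    rw [Matrix.toSquareBlock_def, Matrix.of_apply, hentry k l hkl, Matrix.one_apply, Matrix.one_apply]
    have := hinj k l hkl
    congr 1
    simp [Prod.ext_iff, this]
  rw [this, Matrix.det_one]

/-- Without `P` the matrix has determinant `1`. The block with `P` is a perturbation that factors
through the one-particle space, so that its effect on the determinant is a determinant there. -/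
theorem det_keldysh (U U' P : Matrix X X ℂ) :
    (keldysh N U U' P).det = (1 + P * U' ^ N * U ^ N).det := by
  set v : Bool → ℕ → Matrix X X ℂ := fun ρ m =>
    if ρ = plus then U ^ m else U' ^ (N - m) * U ^ N with hv
  let row : Matrix X (Contour X N) ℂ := Matrix.of fun x k =>
    if k.1 = minus ∧ k.2.1 = 0 then (1 : Matrix X X ℂ) x k.2.2 else 0
  have hcol : keldysh N U U' 0 * blockCol (N := N) v
      = blockCol (N := N) (fun ρ m => if ρ = plus ∧ m = 0 then 1 else 0) := by
    rw [keldysh_mul_blockCol]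
    ext ⟨ρ, m, x⟩ y
    simp only [blockCol, Matrix.of_apply]
    refine apply_congr_of_eq ?_ x y
    have hm := m.2
    cases ρ
    · simp only [hv, reduceCtorEq, if_false, false_and, if_true]
      split_ifs with h
      · simp
      · rw [show N - (m : ℕ) = (N - (m + 1)) + 1 by omega, pow_succ', mul_assoc, sub_self]
    · simp only [hv, if_true, true_and, reduceCtorEq, if_false]
      split_ifs with h
      · simp
      · obtain ⟨k, hk⟩ := Nat.exists_eq_succ_of_ne_zero h
        rw [hk, Nat.succ_sub_one, Nat.succ_eq_add_one, pow_succ', sub_self]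
  have hfac : keldysh N U U' P = keldysh N U U' 0 * (1 + blockCol (N := N) v * (P * row)) := by
    rw [Matrix.mul_add, Matrix.mul_one, ← Matrix.mul_assoc, hcol]
    ext ⟨ρ, m, x⟩ ⟨σ, n, y⟩
    rw [Matrix.add_apply, Matrix.mul_apply]
    have hrow : ∀ z, (P * row) z (σ, n, y) = if σ = minus ∧ n = 0 then P z y else 0 := by
      intro z
      rw [Matrix.mul_apply]
      by_cases h : σ = minus ∧ n = 0
      · simp only [row, Matrix.of_apply, h, and_self, if_true, Matrix.one_apply, mul_ite, mul_one,
          mul_zero]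
        simp
      · simp [row, h]
    simp only [hrow, blockCol, Matrix.of_apply, keldysh, keldyshBlock, Matrix.add_apply,
      Matrix.sub_apply, ite_self, Matrix.zero_apply, add_zero]
    congr 1
    have hm : m = 0 ↔ (m : ℕ) = 0 := by rw [Fin.ext_iff]; rfl
    by_cases h1 : ρ = plus ∧ m = 0
    · by_cases h2 : σ = minus ∧ n = 0
      · simp only [h1, h2, and_self, if_true, Fin.val_zero, Matrix.one_apply, ite_mul, one_mul,
          zero_mul]
        simp
      · simp only [h2, if_false, mul_zero, Finset.sum_const_zero]
        rw [if_neg (by tauto), Matrix.zero_apply]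
    · have h1' : ¬ (ρ = plus ∧ (m : ℕ) = 0) := by rwa [← hm]
      simp only [h1', if_false, Matrix.zero_apply, zero_mul, Finset.sum_const_zero]
      rw [if_neg (by tauto), Matrix.zero_apply]
  have hrc : row * blockCol (N := N) v = U' ^ N * U ^ N := by
    ext x y
    rw [Matrix.mul_apply, Fintype.sum_prod_type, Fintype.sum_bool, Fintype.sum_prod_type,
      Fintype.sum_prod_type, Finset.sum_eq_zero, zero_add, Finset.sum_eq_single 0]
    · simp only [row, blockCol, Matrix.of_apply, and_self, if_true, Matrix.one_apply, ite_mul,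
        one_mul, zero_mul, hv]
      simp
    · intro n _ hn; simp [row, hn]
    · simp
    · intro n _; simp [row]
  rw [hfac, Matrix.det_mul, det_keldysh_zero, one_mul, Matrix.det_one_add_mul_comm,
    Matrix.mul_assoc, hrc, Matrix.mul_assoc]

/-- The corner of the covariance that connects the sources. -/
theorem keldysh_inv_corner (U U' P : Matrix X X ℂ) (hdet : IsUnit (keldysh N U U' P).det)
    (hY : IsUnit (1 + U ^ N * P * U' ^ N).det) (y y' : X) :
    (keldysh N U U' P)⁻¹ (plus, Fin.last N, y) (minus, Fin.last N, y')
      = -(((1 + U ^ N * P * U' ^ N)⁻¹ * (U ^ N * P * U' ^ N)) y y') := by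
  set Y := U ^ N * P * U' ^ N with hYdef
  set I := (1 + Y)⁻¹ with hI
  have hI1 : (1 + Y) * I = 1 := Matrix.mul_nonsing_inv _ hY
  have hcomm : I * Y = Y * I := by
    have h1 : I * (1 + Y) = 1 := Matrix.nonsing_inv_mul _ hY
    have h2 : I + I * Y = I + Y * I := by
      calc I + I * Y = I * (1 + Y) := by rw [mul_add, mul_one]
        _ = (1 + Y) * I := by rw [h1, hI1]
        _ = I + Y * I := by rw [add_mul, one_mul]
    exact add_left_cancel h2
  set v : Bool → ℕ → Matrix X X ℂ := fun ρ m =>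
    if ρ = plus then -(U ^ m * (P * U' ^ N * I)) else U' ^ (N - m) * I with hv
  have hcol : keldysh N U U' P * blockCol (N := N) v
      = blockCol (N := N) (fun ρ m => if ρ = minus ∧ m = N then 1 else 0) := by
    rw [keldysh_mul_blockCol]
    ext ⟨ρ, m, x⟩ y
    simp only [blockCol, Matrix.of_apply]
    refine apply_congr_of_eq ?_ x y
    have hm := m.2
    cases ρ
    · simp only [hv, reduceCtorEq, if_false, true_and, if_true]
      split_ifs with h
      · rw [sub_neg_eq_add, Nat.sub_self, pow_zero, one_mul, ← hI1, add_mul, one_mul, hYdef]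
        simp only [mul_assoc]
      · rw [show N - (m : ℕ) = (N - (m + 1)) + 1 by omega, pow_succ', mul_assoc, sub_self]
    · simp only [hv, if_true, reduceCtorEq, if_false, false_and]
      split_ifs with h
      · rw [pow_zero, one_mul, Nat.sub_zero, mul_assoc, neg_add_cancel]
      · obtain ⟨k, hk⟩ := Nat.exists_eq_succ_of_ne_zero h
        rw [hk, Nat.succ_sub_one, Nat.succ_eq_add_one, pow_succ', mul_neg, mul_assoc, sub_self]
  have hsol : blockCol (N := N) v = (keldysh N U U' P)⁻¹
      * (blockCol (fun ρ m => if ρ = minus ∧ m = N then 1 else 0) : Matrix (Contour X N) X ℂ) := by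
    rw [← hcol, ← Matrix.mul_assoc, Matrix.nonsing_inv_mul _ hdet, Matrix.one_mul]
  have h := congrFun (congrFun hsol (plus, Fin.last N, y)) y'
  rw [Matrix.mul_apply, Finset.sum_eq_single (minus, Fin.last N, y')] at h
  · simp only [blockCol, Matrix.of_apply, hv, if_true, Fin.val_last, and_self, Matrix.one_apply_eq,
      mul_one] at h
    rw [← h, hcomm, hYdef, Matrix.neg_apply]
    simp only [mul_assoc]
  · rintro ⟨σ, n, z⟩ _ hne
    simp only [blockCol, Matrix.of_apply]
    split_ifs with h'
    · rw [Matrix.one_apply, if_neg, mul_zero]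
      rintro rfl
      exact hne (by rw [h'.1]; congr 2; exact Fin.ext h'.2)
    · simp
  · simp

end Covariance

/-! ### One-particle operators -/

section OneParticle

open scoped ComplexOrder

variable {X : Type*} [Fintype X] [LinearOrder X]

theorem pairing_add {R : Type*} [Ring R] [Algebra ℂ R] (ε : ℝ) (M M' : Matrix X X ℂ)
    (φ χ : X → R) : pairing ε (M + M') φ χ = pairing ε M φ χ + pairing ε M' φ χ := by
  simp only [pairing, Matrix.add_apply, add_smul, Finset.sum_add_distrib, smul_add]

theorem pairing_smul {R : Type*} [Ring R] [Algebra ℂ R] (ε : ℝ) (c : ℂ) (M : Matrix X X ℂ)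
    (φ χ : X → R) : pairing ε (c • M) φ χ = c • pairing ε M φ χ := by
  simp only [pairing, Matrix.smul_apply, Finset.smul_sum, smul_smul, smul_eq_mul, mul_left_comm]

theorem pairing_sub {R : Type*} [Ring R] [Algebra ℂ R] (ε : ℝ) (M M' : Matrix X X ℂ)
    (φ χ : X → R) : pairing ε (M - M') φ χ = pairing ε M φ χ - pairing ε M' φ χ := by
  simp only [pairing, Matrix.sub_apply, sub_smul, Finset.sum_sub_distrib, smul_sub]

theorem pairing_ite {R : Type*} [Ring R] [Algebra ℂ R] (ε : ℝ) (c : Prop) [Decidable c]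
    (M : Matrix X X ℂ) (φ χ : X → R) :
    pairing ε (if c then M else 0) φ χ = if c then pairing ε M φ χ else 0 := by
  split_ifs
  · rfl
  · simp [pairing]

namespace Data

variable (D : Data X)

theorem aminus_conjTranspose (hA : D.A.IsHermitian) (hB : D.B.IsHermitian) :
    D.Aminusᴴ = D.Aplus := by
  rw [Aminus, Aplus, Matrix.conjTranspose_sub, Matrix.conjTranspose_smul, hA.eq, hB.eq]
  simp

theorem exp_conjTranspose (hA : D.A.IsHermitian) (hB : D.B.IsHermitian) (t : ℝ) :
    (NormedSpace.exp ((-Complex.I * t) • D.Aminus))ᴴ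
      = NormedSpace.exp ((Complex.I * t) • D.Aplus) := by
  rw [← Matrix.exp_conjTranspose, Matrix.conjTranspose_smul, D.aminus_conjTranspose hA hB]
  simp

theorem U_pow {N : ℕ} (hN : N ≠ 0) :
    D.U N ^ N = NormedSpace.exp ((-Complex.I * D.T) • D.Aminus) := by
  have hN' : (N : ℂ) ≠ 0 := Nat.cast_ne_zero.2 hN
  rw [U, ← Matrix.exp_nsmul, ← Nat.cast_smul_eq_nsmul ℂ, smul_smul]
  congr 2
  field_simp

theorem U_conjTranspose_pow (hA : D.A.IsHermitian) (hB : D.B.IsHermitian) {N : ℕ} (hN : N ≠ 0) :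
    (D.U N)ᴴ ^ N = NormedSpace.exp ((Complex.I * D.T) • D.Aplus) := by
  rw [← Matrix.conjTranspose_pow, D.U_pow hN, D.exp_conjTranspose hA hB]

/-- The matrix `e^{-βQ} e^{iA₊T} e^{-iA₋T}` is not positive, but cyclic permutation of the factors
gives `1 + W` the determinant of `1 + (E R)ᴴ (E R)`, where `E = e^{-iA₋T}` and `R = e^{-βQ/2}`. -/
theorem isUnit_one_add_W (hA : D.A.IsHermitian) (hB : D.B.IsHermitian) (hQ : D.Q.IsHermitian) :
    IsUnit (1 + D.W).det := by
  set E := NormedSpace.exp ((-Complex.I * D.T) • D.Aminus) with hE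
  set R := NormedSpace.exp ((-(D.β : ℂ) / 2) • D.Q) with hR
  have hRH : Rᴴ = R := by
    rw [hR, ← Matrix.exp_conjTranspose, Matrix.conjTranspose_smul, hQ.eq]
    simp
  have hRR : NormedSpace.exp (-(D.β : ℂ) • D.Q) = R * R := by
    rw [hR, ← Matrix.exp_add_of_commute _ _ (Commute.refl _), ← add_smul, add_halves]
  have hW : (1 + D.W).det = (1 + (E * R)ᴴ * (E * R)).det := by
    rw [W, hRR, ← D.exp_conjTranspose hA hB, ← hE, Matrix.conjTranspose_mul, hRH,
      show R * R * Eᴴ * E = R * (R * Eᴴ * E) by simp only [mul_assoc],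
      Matrix.det_one_add_mul_comm]
    simp only [mul_assoc]
  have hpos := Matrix.PosDef.one.add_posSemidef (Matrix.posSemidef_conjTranspose_mul_self (E * R))
  rw [hW, isUnit_iff_ne_zero]
  exact hpos.det_pos.ne'

theorem invCov_eq_keldysh (N : ℕ) :
    D.invCov N = keldysh N (D.U N) (D.U N)ᴴ (NormedSpace.exp (-(D.β : ℂ) • D.Q)) := rfl

theorem det_invCov (hA : D.A.IsHermitian) (hB : D.B.IsHermitian) {N : ℕ} (hN : N ≠ 0) :
    (D.invCov N).det = (1 + D.W).det := by
  rw [invCov_eq_keldysh, det_keldysh, D.U_pow hN, D.U_conjTranspose_pow hA hB hN, W]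

/-- The covariance between the points where the sources act. -/
theorem G_corner (hA : D.A.IsHermitian) (hB : D.B.IsHermitian) (hQ : D.Q.IsHermitian) {N : ℕ}
    (hN : N ≠ 0) (y y' : X) :
    D.G N (plus, Fin.last N, y) (minus, Fin.last N, y') = -D.sourceKernel y y' := by
  have hW := D.isUnit_one_add_W hA hB hQ
  have hdet : IsUnit (D.invCov N).det := by rwa [D.det_invCov hA hB hN]
  set E := NormedSpace.exp ((-Complex.I * D.T) • D.Aminus) with hE
  set P := NormedSpace.exp (-(D.β : ℂ) • D.Q) with hP
  set F := NormedSpace.exp ((Complex.I * D.T) • D.Aminus) with hF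
  have hEF : E * F = 1 := by
    rw [hE, hF, ← Matrix.exp_add_of_commute _ _
      (((Commute.refl D.Aminus).smul_left _).smul_right _), ← add_smul]
    simp
  have hWE : D.W = P * Eᴴ * E := by rw [W, hE, D.exp_conjTranspose hA hB]
  have hY : IsUnit (1 + E * P * Eᴴ).det := by
    rw [mul_assoc, Matrix.det_one_add_mul_comm, ← hWE]
    exact hW
  have hpow : D.U N ^ N = E := D.U_pow hN
  have hpow' : (D.U N)ᴴ ^ N = Eᴴ := by rw [← Matrix.conjTranspose_pow, hpow]
  rw [G, invCov_eq_keldysh, keldysh_inv_corner]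
  rotate_left
  · exact hdet
  · rw [hpow, hpow']; exact hY
  rw [hpow, hpow']
  suffices (1 + E * P * Eᴴ)⁻¹ * (E * P * Eᴴ) = D.sourceKernel by rw [this]
  have hinter : (1 + E * P * Eᴴ) * E = E * (1 + D.W) := by
    rw [hWE, add_mul, mul_add, one_mul, mul_one]
    simp only [mul_assoc]
  have hinv : (1 + E * P * Eᴴ)⁻¹ * E = E * (1 + D.W)⁻¹ := by
    generalize hZ : 1 + E * P * Eᴴ = Z at hinter hY
    calc Z⁻¹ * E = Z⁻¹ * (E * ((1 + D.W) * (1 + D.W)⁻¹)) := by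
          rw [Matrix.mul_nonsing_inv _ hW, mul_one]
      _ = Z⁻¹ * Z * E * (1 + D.W)⁻¹ := by
          rw [← mul_assoc E, ← hinter]; simp only [mul_assoc]
      _ = E * (1 + D.W)⁻¹ := by rw [Matrix.nonsing_inv_mul _ hY, one_mul]
  rw [sourceKernel, fBeta, ← hE, ← hF, ← mul_assoc E, ← hinv, hWE]
  simp only [mul_assoc]
  rw [hEF, mul_one]

end Data

end OneParticle

/-! ### The quadratic form of the discretized action -/

section QuadraticForm

variable {X : Type*} [Fintype X] [LinearOrder X] {N : ℕ}

theorem sum_fin_succ_eq {R : Type*} [AddCommMonoid R] (f : Fin (N + 1) → Fin (N + 1) → R) :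
    ∑ m : Fin (N + 1), ∑ n : Fin (N + 1), (if (m : ℕ) + 1 = n then f m n else 0)
      = ∑ i : Fin N, f i.castSucc i.succ := by
  rw [Fin.sum_univ_castSucc]
  have h0 : ∑ n : Fin (N + 1), (if ((Fin.last N : Fin (N + 1)) : ℕ) + 1 = n
      then f (Fin.last N) n else 0) = 0 :=
    Finset.sum_eq_zero fun n _ => if_neg (by have := n.2; simp; omega)
  rw [h0, add_zero]
  refine Finset.sum_congr rfl fun i _ => ?_
  rw [Finset.sum_eq_single i.succ]
  · simp
  · intro n _ hn
    exact if_neg fun h => hn (Fin.ext (by simpa using h.symm))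
  · simp

theorem pairing_keldysh {R : Type*} [Ring R] [Algebra ℂ R] (ε : ℝ) (U U' P : Matrix X X ℂ)
    (φ χ : Contour X N → R) :
    pairing ε (keldysh N U U' P) φ χ
      = (∑ m, pairing ε 1 (fun x => φ (minus, m, x)) (fun x => χ (minus, m, x))
          + ∑ m, pairing ε 1 (fun x => φ (plus, m, x)) (fun x => χ (plus, m, x)))
        - ∑ i : Fin N, pairing ε U' (fun x => φ (minus, i.castSucc, x))
            (fun x => χ (minus, i.succ, x))
        - ∑ i : Fin N, pairing ε U (fun x => φ (plus, i.succ, x))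
            (fun x => χ (plus, i.castSucc, x))
        - pairing ε 1 (fun x => φ (minus, Fin.last N, x)) (fun x => χ (plus, Fin.last N, x))
        + pairing ε P (fun x => φ (plus, 0, x)) (fun x => χ (minus, 0, x)) := by
  have hblocks : pairing ε (keldysh N U U' P) φ χ
      = ∑ ρ, ∑ m, ∑ σ, ∑ n, pairing ε (keldyshBlock N U U' P ρ m σ n)
          (fun x => φ (ρ, m, x)) (fun x => χ (σ, n, x)) := by
    simp only [pairing, Fintype.sum_prod_type, ← Finset.smul_sum, keldysh, Matrix.of_apply]
    congr 1
    refine Finset.sum_congr rfl fun ρ _ => Finset.sum_congr rfl fun m _ => ?_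
    rw [Finset.sum_comm]
    refine Finset.sum_congr rfl fun σ _ => ?_
    rw [Finset.sum_comm]
  rw [hblocks]
  simp only [keldyshBlock, pairing_add, pairing_sub, pairing_ite, Fintype.sum_bool,
    reduceCtorEq, true_and, false_and, if_false, add_zero, zero_add,
    Finset.sum_add_distrib, Finset.sum_sub_distrib,
    Finset.sum_const_zero]
  have hlast : ∀ f : Fin (N + 1) → Fin (N + 1) → R, ∀ a b,
      ∑ m, ∑ n, (if m = a ∧ n = b then f m n else 0) = f a b := by
    intro f a b
    rw [Finset.sum_eq_single a, Finset.sum_eq_single b]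
    · simp
    · intro n _ hn; simp [hn]
    · simp
    · intro m _ hm; simp [hm]
    · simp
  have hcomm : ∀ f : Fin (N + 1) → Fin (N + 1) → R,
      ∑ m : Fin (N + 1), ∑ n : Fin (N + 1), (if (n : ℕ) + 1 = (m : ℕ) then f m n else 0)
        = ∑ i : Fin N, f i.succ i.castSucc := by
    intro f
    rw [Finset.sum_comm]
    exact sum_fin_succ_eq fun n m => f m n
  rw [hlast, hlast, hcomm, sum_fin_succ_eq]
  simp only [Finset.sum_ite_eq, Finset.mem_univ, if_true]
  abel

end QuadraticForm

set_option synthInstance.maxSize 1000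

/-! ### The trace as a Grassmann integral along the contour -/

section Contour

variable {X : Type*} [Fintype X] [LinearOrder X]

/-- The `j`-th point of the contour that runs through the backward branch in the direction of
increasing time index, and then back through the forward branch. -/
def site (N j : ℕ) (x : X) : Contour X N :=
  if j ≤ N then (minus, Fin.ofNat (N + 1) j, x) else (plus, Fin.ofNat (N + 1) (2 * N + 1 - j), x)

theorem site_minus (N : ℕ) (m : Fin (N + 1)) : site (X := X) N m = fun x => (minus, m, x) := by
  funext x
  rw [site, if_pos (by omega)]
  congr 2
  exact Fin.ext (by simp)

theorem site_plus (N : ℕ) (m : Fin (N + 1)) :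
    site (X := X) N (2 * N + 1 - m) = fun x => (plus, m, x) := by
  funext x
  rw [site, if_neg (by omega)]
  congr 2
  have := m.2
  exact Fin.ext (by
    rw [show 2 * N + 1 - (2 * N + 1 - (m : ℕ)) = m by omega]
    simp)

theorem chainInj_site (N : ℕ) : ChainInj (site (X := X) N) (2 * N + 2) := by
  intro i hi j hj x y h
  simp only [site] at h
  split_ifs at h with h1 h2 h2 <;> simp only [Prod.mk.injEq, reduceCtorEq, false_and, true_and] at h
  · have := congrArg Fin.val h.1
    simp only [Fin.ofNat, Nat.mod_eq_of_lt (show i < N + 1 by omega),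
      Nat.mod_eq_of_lt (show j < N + 1 by omega)] at this
    exact ⟨this, h.2⟩
  · have := congrArg Fin.val h.1
    simp only [Fin.ofNat, Nat.mod_eq_of_lt (show 2 * N + 1 - i < N + 1 by omega),
      Nat.mod_eq_of_lt (show 2 * N + 1 - j < N + 1 by omega)] at this
    exact ⟨by omega, h.2⟩

theorem mem_chainLabels_site (N : ℕ) (k : Contour X N) :
    k ∈ chainLabels (site (X := X) N) (2 * N + 2) := by
  rw [mem_chainLabels]
  obtain ⟨σ, m, x⟩ := k
  have := m.2
  cases σ
  · exact ⟨m, by omega, x, congrFun (site_minus N m) x⟩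
  · exact ⟨2 * N + 1 - m, by omega, x, congrFun (site_plus N m) x⟩

theorem opProd_add {M : Type*} [Monoid M] (O : ℕ → M) (m n : ℕ) :
    opProd O (m + n) = opProd O m * opProd (fun j => O (m + j)) n := by
  induction n with
  | zero => simp [opProd]
  | succ n ih => rw [← add_assoc, opProd, ih, opProd, mul_assoc]

theorem opProd_eq_pow {M : Type*} [Monoid M] (O : ℕ → M) (a : M) (n : ℕ) (h : ∀ j < n, O j = a) :
    opProd O n = a ^ n := by
  induction n with
  | zero => rw [opProd, pow_zero]
  | succ n ih => rw [opProd, ih fun j hj => h j (by omega), h n (by omega), pow_succ]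

theorem lift_pow {J : Type*} (M : Matrix (Finset X) (Finset X) ℂ) (n : ℕ) :
    lift (J := J) (M ^ n) = lift M ^ n := by
  induction n with
  | zero => rw [pow_zero, pow_zero, lift_one]
  | succ n ih => rw [pow_succ, pow_succ, lift_mul, ih]

/-- The integration variable `ψbar_k`. -/
def psiBarInt {N : ℕ} (k : Contour X N) : Grass ((Contour X N ⊕ Contour X N) ⊕ Source X) :=
  form (Pi.single (Sum.inl (Sum.inl k)) 1)

/-- The integration variable `ψ_k`. -/
def psiInt {N : ℕ} (k : Contour X N) : Grass ((Contour X N ⊕ Contour X N) ⊕ Source X) :=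
  form (Pi.single (Sum.inl (Sum.inr k)) 1)

/-- A source as a spectator of the integration. -/
def sourceInt (N : ℕ) (s : Source X) : (Contour X N ⊕ Contour X N) ⊕ Source X → ℂ :=
  Pi.single (Sum.inr s) 1

theorem sum_weight_site (ε : ℝ) (N : ℕ) :
    ∑ j ∈ Finset.range (2 * N + 2), weight (J := Source X) ε (site (X := X) N j) Finset.univ
      = -(∑ m, pairing ε 1 (fun x => psiBarInt (N := N) (minus, m, x)) (fun x => psiInt (minus, m, x))
          + ∑ m, pairing ε 1 (fun x => psiBarInt (N := N) (plus, m, x))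
            (fun x => psiInt (plus, m, x))) := by
  have hw : ∀ (k : X → Contour X N), weight (J := Source X) ε k Finset.univ
      = -pairing ε 1 (fun x => psiBarInt (k x)) (fun x => psiInt (k x)) := by
    intro k
    rw [weight, pairing_one, Finset.smul_sum]
    rfl
  rw [show 2 * N + 2 = (N + 1) + (N + 1) by omega, Finset.sum_range_add, neg_add,
    ← Finset.sum_neg_distrib, ← Finset.sum_neg_distrib]
  congr 1
  · rw [Finset.sum_range]
    refine Finset.sum_congr rfl fun m _ => ?_
    rw [hw, site_minus]
  · rw [← Finset.sum_range_reflect, Finset.sum_range]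
    refine Finset.sum_congr rfl fun m _ => ?_
    have := m.2
    rw [hw, show N + 1 + (N + 1 - 1 - (m : ℕ)) = 2 * N + 1 - m by omega, site_plus]

namespace Data

variable (D : Data X)

/-- The operator of one time step on the forward branch. -/
def forwardStep (N : ℕ) : Matrix (Finset X) (Finset X) ℂ :=
  stepOp D.ε (-Complex.I • D.Aminus) D.v (-Complex.I) (D.T / N)

/-- The operator of one time step on the backward branch. -/
def backwardStep (N : ℕ) : Matrix (Finset X) (Finset X) ℂ :=
  stepOp D.ε (Complex.I • D.Aplus) (adjVertex D.v) Complex.I (D.T / N)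

/-- The source insertion `e^{(c⁺, a*)} e^{(c⁻, a)}`. -/
def sourceInsertion : SourceOp X :=
  sourceExp D.ε (fun x => Pi.single (Sum.inl x) 1) (fun x => Pi.single (Sum.inr x) 1)

/-- The time discretized generating functional. -/
def discreteZ (N : ℕ) : Grass (Source X) :=
  Matrix.trace (lift (D.backwardStep N ^ N) * D.sourceInsertion * lift (D.forwardStep N ^ N)
    * lift D.rho0)

theorem rho0_eq : D.rho0 = NormedSpace.exp (secondQuant D.ε (-(D.β : ℂ) • D.Q)) := by
  rw [rho0, secondQuant, pairing_smul]

/-- The operators between consecutive points of the contour. -/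
def contourOp (N j : ℕ) :
    Matrix (Finset X) (Finset X) (Grass ((Contour X N ⊕ Contour X N) ⊕ Source X)) :=
  if j < N then lift (D.backwardStep N)
  else if j = N then D.sourceInsertion.map ofSpectators
  else if j ≤ 2 * N then lift (D.forwardStep N)
  else lift D.rho0

/-- The exponents of the coherent state kernels of `contourOp`, for `j ≤ 2 * N`. -/
def contourExponent (N j : ℕ) : Grass ((Contour X N ⊕ Contour X N) ⊕ Source X) :=
  if j < N then
    pairing D.ε (D.U N)ᴴ (fun x => psiBarInt (site N j x)) (fun x => psiInt (site N (j + 1) x))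
      + ((D.T / N : ℂ) * Complex.I) • normalPoly D.ε (adjVertex D.v)
        (fun x => psiBarInt (site N j x)) (fun x => psiInt (site N (j + 1) x))
  else if j = N then
    pairing D.ε 1 (fun x => psiBarInt (site N j x)) (fun x => psiInt (site N (j + 1) x))
      + (pairing D.ε 1 (fun x => form (sourceInt N (Sum.inl x))) (fun x => psiBarInt (site N j x))
        + pairing D.ε 1 (fun x => form (sourceInt N (Sum.inr x)))
          (fun x => psiInt (site N (j + 1) x)))
  else
    pairing D.ε (D.U N) (fun x => psiBarInt (site N j x)) (fun x => psiInt (site N (j + 1) x))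
      + ((D.T / N : ℂ) * -Complex.I) • normalPoly D.ε D.v
        (fun x => psiBarInt (site N j x)) (fun x => psiInt (site N (j + 1) x))

theorem adjVertex_even (heven : ∀ m m' : ℕ, Odd (m + m') → ∀ x y, D.v m m' x y = 0)
    (m m' : ℕ) (h : Odd (m + m')) (x : Fin m → X) (y : Fin m' → X) :
    adjVertex D.v m m' x y = 0 := by
  rw [adjVertex, heven m' m (by rwa [add_comm]), map_zero]

theorem adjVertex_const (hconst : ∀ x y, D.v 0 0 x y = 0) (x y : Fin 0 → X) :
    adjVertex D.v 0 0 x y = 0 := by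
  rw [adjVertex, hconst, map_zero]

theorem sourceInsertion_map (N : ℕ) :
    D.sourceInsertion.map (ofSpectators (K := Contour X N))
      = sourceExp D.ε (fun x => sourceInt N (Sum.inl x)) (fun x => sourceInt N (Sum.inr x)) := by
  have hmap : ∀ (m : X → Source X → ℂ) (m' : X → (Contour X N ⊕ Contour X N) ⊕ Source X → ℂ)
      (hm : ∀ x, ofSpectators (form (m x)) = form (m' x))
      (a : X → Matrix (Finset X) (Finset X) ℂ)
      (_ : ∀ x y, a x * a y = -(a y * a x)) (_ : ∀ x, parity * a x = -(a x * parity)),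
      (ofSpectators (K := Contour X N)).mapMatrix
        (gexp (pairing D.ε 1 (fun x => formOp (m x)) (fun x => lift (a x))))
      = gexp (pairing D.ε 1 (fun x => formOp (m' x)) (fun x => lift (a x))) := by
    intro m m' hm a ha hp
    rw [map_gexp (isNilpotent_source a ha hp m), map_pairing]
    congr 2
    · funext x
      simp only [formOp, AlgHom.mapMatrix_apply]
      rw [Matrix.diagonal_map (map_zero _)]
      congr 1
      funext S
      simp [hm]
    · funext x
      ext S S'
      simp [lift]
  rw [sourceInsertion, sourceExp, sourceExp, ← AlgHom.mapMatrix_apply, map_mul,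
    hmap _ _ _ _ creat_anticomm parity_mul_creat, hmap _ _ _ _ annih_anticomm parity_mul_annih]
  · intro x
    exact subst_gen _ _
  · intro x
    exact subst_gen _ _

theorem kernel_contourOp (hε : 0 < D.ε) (hA : D.A.IsHermitian) (hB : D.B.IsHermitian)
    (heven : ∀ m m' : ℕ, Odd (m + m') → ∀ x y, D.v m m' x y = 0)
    (hconst : ∀ x y, D.v 0 0 x y = 0) (N j : ℕ) (hj : j < 2 * N + 1) :
    kernel D.ε (barField (site N j)) (D.contourOp N j) (field (site N (j + 1)))
      = gexp (D.contourExponent N j) := by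
  have hU : NormedSpace.exp ((D.T / N : ℂ) • -Complex.I • D.Aminus) = D.U N := by
    rw [U, smul_smul, mul_comm]
  have hU' : NormedSpace.exp ((D.T / N : ℂ) • Complex.I • D.Aplus) = (D.U N)ᴴ := by
    have := D.exp_conjTranspose hA hB (D.T / N)
    push_cast at this
    rw [U, this, smul_smul, mul_comm]
  rw [contourOp, contourExponent]
  split_ifs with h1 h2 h3
  · rw [backwardStep, kernel_stepOp _ _ _ hε (D.adjVertex_even heven) (D.adjVertex_const hconst),
      hU']
    rfl
  · rw [sourceInsertion_map, kernel_sourceExp hε]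
    rfl
  · rw [forwardStep, kernel_stepOp _ _ _ hε heven hconst, hU]
    rfl
  · omega

theorem bos_contourExponent (heven : ∀ m m' : ℕ, Odd (m + m') → ∀ x y, D.v m m' x y = 0)
    (hconst : ∀ x y, D.v 0 0 x y = 0) (N j : ℕ) : Bos (D.contourExponent N j) := by
  rw [contourExponent]
  split_ifs
  · exact (bos_pairing _ _ _ _).add ((bos_normalPoly _ _ _ _ (D.adjVertex_even heven)
      (D.adjVertex_const hconst)).smul _)
  · exact (bos_pairing _ _ _ _).add ((bos_pairing _ _ _ _).add (bos_pairing _ _ _ _))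
  · exact (bos_pairing _ _ _ _).add ((bos_normalPoly _ _ _ _ heven hconst).smul _)

theorem opProd_contourOp (N : ℕ) :
    opProd (D.contourOp N) (2 * N + 2)
      = (lift (D.backwardStep N ^ N) * D.sourceInsertion * lift (D.forwardStep N ^ N)
        * lift D.rho0).map (ofSpectators (K := Contour X N)) := by
  have hlift : ∀ M : Matrix (Finset X) (Finset X) ℂ,
      (lift M).map (ofSpectators (K := Contour X N) (J := Source X)) = lift M := by
    intro M
    ext S S'
    simp [lift]
  rw [← AlgHom.mapMatrix_apply, map_mul, map_mul, map_mul]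
  simp only [AlgHom.mapMatrix_apply, hlift]
  rw [opProd, show 2 * N + 1 = N + 1 + N by omega, opProd_add, opProd,
    opProd_eq_pow _ (lift (D.backwardStep N)), opProd_eq_pow _ (lift (D.forwardStep N)),
    lift_pow, lift_pow]
  · congr 2
    · congr 1
      simp [contourOp]
    · rw [contourOp, if_neg (by omega), if_neg (by omega), if_neg (by omega)]
  · intro j hj
    rw [contourOp, if_neg (by omega), if_neg (by omega), if_pos (by omega)]
  · intro j hj
    rw [contourOp, if_pos hj]

theorem freeOf_contourOp (N j : ℕ) (S S' : Finset X) (l : List (Contour X N)) :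
    FreeOf (listLabels l) (D.contourOp N j S S') := by
  rw [contourOp]
  split_ifs
  · exact freeOf_algebraMap _ _
  · exact freeOf_ofSpectators _ _
  · exact freeOf_algebraMap _ _
  · exact freeOf_algebraMap _ _

/-- The interaction part of the exponent of the discretized path integral. -/
def interactionInt (N : ℕ) : Grass ((Contour X N ⊕ Contour X N) ⊕ Source X) :=
  ((D.T / N : ℂ) * Complex.I) • ∑ i : Fin N, normalPoly D.ε (adjVertex D.v)
      (fun x => psiBarInt (minus, i.castSucc, x)) (fun x => psiInt (minus, i.succ, x))
    + ((D.T / N : ℂ) * -Complex.I) • ∑ i : Fin N, normalPoly D.ε D.v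
      (fun x => psiBarInt (plus, i.succ, x)) (fun x => psiInt (plus, i.castSucc, x))

/-- The source part of the exponent of the discretized path integral. -/
def sourceTermInt (N : ℕ) : Grass ((Contour X N ⊕ Contour X N) ⊕ Source X) :=
  pairing D.ε 1 (fun x => form (sourceInt N (Sum.inl x)))
      (fun x => psiBarInt (minus, Fin.last N, x))
    + pairing D.ε 1 (fun x => form (sourceInt N (Sum.inr x)))
      (fun x => psiInt (plus, Fin.last N, x))

theorem sum_contourExponent (N : ℕ) :
    ∑ j ∈ Finset.range (2 * N + 1), D.contourExponent N j
      = ∑ i : Fin N, pairing D.ε (D.U N)ᴴ (fun x => psiBarInt (minus, i.castSucc, x))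
            (fun x => psiInt (minus, i.succ, x))
        + ∑ i : Fin N, pairing D.ε (D.U N) (fun x => psiBarInt (plus, i.succ, x))
            (fun x => psiInt (plus, i.castSucc, x))
        + pairing D.ε 1 (fun x => psiBarInt (minus, Fin.last N, x))
            (fun x => psiInt (plus, Fin.last N, x))
        + (D.sourceTermInt N + D.interactionInt N) := by
  have h1 : ∑ j ∈ Finset.range N, D.contourExponent N j
      = ∑ i : Fin N, pairing D.ε (D.U N)ᴴ (fun x => psiBarInt (minus, i.castSucc, x))
            (fun x => psiInt (minus, i.succ, x))
        + ((D.T / N : ℂ) * Complex.I) • ∑ i : Fin N, normalPoly D.ε (adjVertex D.v)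
      (fun x => psiBarInt (minus, i.castSucc, x)) (fun x => psiInt (minus, i.succ, x)) := by
    rw [Finset.sum_range, Finset.smul_sum, ← Finset.sum_add_distrib]
    refine Finset.sum_congr rfl fun i _ => ?_
    have e1 := site_minus (X := X) N i.castSucc
    have e2 := site_minus (X := X) N i.succ
    rw [Fin.val_castSucc] at e1
    rw [Fin.val_succ] at e2
    rw [contourExponent, if_pos i.2, e1, e2]
  have h2 : D.contourExponent N N
      = pairing D.ε 1 (fun x => psiBarInt (minus, Fin.last N, x))
            (fun x => psiInt (plus, Fin.last N, x)) + D.sourceTermInt N := by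
    have e1 := site_minus (X := X) N (Fin.last N)
    have e2 := site_plus (X := X) N (Fin.last N)
    rw [Fin.val_last] at e1 e2
    rw [show 2 * N + 1 - N = N + 1 by omega] at e2
    rw [contourExponent, if_neg (lt_irrefl _), if_pos rfl, e1, e2, sourceTermInt]
  have h3 : ∑ j ∈ Finset.range N, D.contourExponent N (N + 1 + j)
      = ∑ i : Fin N, pairing D.ε (D.U N) (fun x => psiBarInt (plus, i.succ, x))
            (fun x => psiInt (plus, i.castSucc, x))
        + ((D.T / N : ℂ) * -Complex.I) • ∑ i : Fin N, normalPoly D.ε D.v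
      (fun x => psiBarInt (plus, i.succ, x)) (fun x => psiInt (plus, i.castSucc, x)) := by
    rw [← Finset.sum_range_reflect, Finset.sum_range, Finset.smul_sum, ← Finset.sum_add_distrib]
    refine Finset.sum_congr rfl fun i _ => ?_
    have e1 := site_plus (X := X) N i.castSucc
    have e2 := site_plus (X := X) N i.succ
    have hi := i.2
    rw [Fin.val_castSucc, show 2 * N + 1 - (i : ℕ) = N + 1 + (N - 1 - i) + 1 by omega] at e1
    rw [Fin.val_succ, show 2 * N + 1 - ((i : ℕ) + 1) = N + 1 + (N - 1 - i) by omega] at e2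
    rw [contourExponent, if_neg (by omega), if_neg (by omega), e1, e2]
  rw [show 2 * N + 1 = N + 1 + N by omega, Finset.sum_range_add, Finset.sum_range_succ, h1, h2, h3,
    interactionInt]
  abel

/-- The discretized generating functional is a Grassmann integral over the contour. The trace closes
the chain of coherent states with a sign, which is the sign of `e^{-βQ}` in the inverse
covariance. -/
theorem berezin_contour (hε : 0 < D.ε) (hA : D.A.IsHermitian) (hB : D.B.IsHermitian)
    (heven : ∀ m m' : ℕ, Odd (m + m') → ∀ x y, D.v m m' x y = 0)
    (hconst : ∀ x y, D.v 0 0 x y = 0) (N : ℕ) :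
    berezin (gexp (-pairing D.ε (D.invCov N) psiBarInt psiInt
        + (D.sourceTermInt N + D.interactionInt N)))
      = ((D.ε : ℂ) ^ Fintype.card (Contour X N)) • D.discreteZ N := by
  have hchain : ∑ S, chain D.ε (site N) (D.contourOp N) (2 * N + 2) S S
      = gexp (-pairing D.ε (D.invCov N) psiBarInt psiInt
        + (D.sourceTermInt N + D.interactionInt N)) := by
    have happly := chain_apply D.ε (site N) (D.contourOp N) (2 * N + 1) (D.contourExponent N)
      (D.bos_contourExponent heven hconst N) (D.kernel_contourOp hε hA hB heven hconst N)
    simp only [show 2 * N + 1 + 1 = 2 * N + 2 from rfl] at happly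
    simp only [happly]
    have hlast : D.contourOp N (2 * N + 1)
        = lift (NormedSpace.exp (secondQuant D.ε (-(D.β : ℂ) • D.Q))) := by
      rw [contourOp, if_neg (by omega), if_neg (by omega), if_neg (by omega), rho0_eq]
    have e1 := site_minus (X := X) N 0
    have e2 := site_plus (X := X) N 0
    rw [Fin.val_zero] at e1 e2
    rw [Nat.sub_zero] at e2
    rw [← Finset.mul_sum, hlast, sum_cohR_mul_cohL _ _ _ _ (parity_mul_exp_secondQuant _),
      kernel_exp_secondQuant hε, ← gexp_add, sum_weight_site, sum_contourExponent,
      invCov_eq_keldysh, pairing_keldysh]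
    rotate_left
    · exact (Bos.sum _ _ fun j _ => bos_weight _ _).add
        (Bos.sum _ _ fun j _ => D.bos_contourExponent heven hconst N j)
    · exact bos_pairing _ _ _ _
    have hneg : pairing D.ε (NormedSpace.exp (-(D.β : ℂ) • D.Q))
        (fun x => form (barField (J := Source X) (site N (2 * N + 1)) x))
        (fun x => form ((-field (J := Source X) (site N 0)) x))
        = -pairing D.ε (NormedSpace.exp (-(D.β : ℂ) • D.Q)) (fun x => psiBarInt (N := N) (plus, 0, x))
            (fun x => psiInt (minus, 0, x)) := by
      have hform : ∀ x, form ((-field (J := Source X) (site N 0)) x)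
          = -psiInt (N := N) (minus, 0, x) := by
        intro x
        rw [Pi.neg_apply, form, map_neg, field, e1]
        rfl
      simp only [hform, barField, e2, pairing, mul_neg, smul_neg, Finset.sum_neg_distrib]
      rfl
    rw [hneg]
    congr 1
    abel
  rw [← hchain, berezin_eq (chainLabels (site (X := X) N) (2 * N + 2))
    (nodup_chainLabels _ _ (chainInj_site N)) (mem_chainLabels_site N), map_sum, map_sum]
  simp only [listIntegral_chain (site N) (D.contourOp N) hε _ (chainInj_site N)
    (fun j _ S S' l => D.freeOf_contourOp N j S S' l), opProd_contourOp, map_smul,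
    Matrix.map_apply, toSpectators_ofSpectators]
  rw [← Finset.smul_sum, discreteZ, Matrix.trace]
  congr 2
  simp
  ring

end Data

end Contour

/-! ### The source-dependent shift of the integration variables -/

section Shift

theorem pairing_sub_sub {K R : Type*} [Fintype K] [Ring R] [Algebra ℂ R] (ε : ℝ) (M : Matrix K K ℂ)
    (φ φ' χ χ' : K → R) :
    pairing ε M (fun k => φ k - φ' k) (fun k => χ k - χ' k)
      = pairing ε M φ χ - pairing ε M φ χ' - pairing ε M φ' χ + pairing ε M φ' χ' := by
  simp only [pairing, sub_mul, mul_sub, smul_sub, Finset.sum_sub_distrib]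
  abel

theorem pairing_eq_sum_mul {K R : Type*} [Fintype K] [Ring R] [Algebra ℂ R] (ε : ℝ)
    (M : Matrix K K ℂ) (φ χ : K → R) :
    pairing ε M φ χ = (ε : ℂ) • ∑ k, φ k * ∑ l, M k l • χ l := by
  simp only [pairing, Finset.mul_sum, mul_smul_comm]

theorem pairing_eq_sum_mul' {K R : Type*} [Fintype K] [Ring R] [Algebra ℂ R] (ε : ℝ)
    (M : Matrix K K ℂ) (φ χ : K → R) :
    pairing ε M φ χ = (ε : ℂ) • ∑ l, (∑ k, M k l • φ k) * χ l := by
  simp only [pairing, Finset.sum_mul, smul_mul_assoc]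
  rw [Finset.sum_comm]

variable {X : Type*} [Fintype X] [LinearOrder X]

namespace Data

variable (D : Data X)

/-- The field `ζ̄` in the doubled algebra. -/
def zetaBarInt (N : ℕ) (k : Contour X N) : Grass ((Contour X N ⊕ Contour X N) ⊕ Source X) :=
  ∑ y, D.G N (plus, Fin.last N, y) k • form (sourceInt N (Sum.inr y))

/-- The field `ζ` in the doubled algebra. -/
def zetaInt (N : ℕ) (k : Contour X N) : Grass ((Contour X N ⊕ Contour X N) ⊕ Source X) :=
  -∑ y, D.G N k (minus, Fin.last N, y) • form (sourceInt N (Sum.inl y))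

theorem invCov_zetaInt {N : ℕ} (hdet : IsUnit (D.invCov N).det) (k : Contour X N) :
    ∑ l, D.invCov N k l • D.zetaInt N l
      = -∑ y, if k = (minus, Fin.last N, y) then form (sourceInt N (Sum.inl y)) else 0 := by
  have hinv : D.invCov N * D.G N = 1 := Matrix.mul_nonsing_inv _ hdet
  simp only [zetaInt, smul_neg, Finset.sum_neg_distrib, Finset.smul_sum, smul_smul]
  rw [Finset.sum_comm]
  congr 1
  refine Finset.sum_congr rfl fun y _ => ?_
  rw [← Finset.sum_smul, ← Matrix.mul_apply, hinv, Matrix.one_apply, ite_smul, one_smul, zero_smul]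

theorem zetaBarInt_invCov {N : ℕ} (hdet : IsUnit (D.invCov N).det) (l : Contour X N) :
    ∑ k, D.invCov N k l • D.zetaBarInt N k
      = ∑ y, if (plus, Fin.last N, y) = l then form (sourceInt N (Sum.inr y)) else 0 := by
  have hinv : D.G N * D.invCov N = 1 := Matrix.nonsing_inv_mul _ hdet
  simp only [zetaBarInt, Finset.smul_sum, smul_smul]
  rw [Finset.sum_comm]
  refine Finset.sum_congr rfl fun y _ => ?_
  rw [← Finset.sum_smul]
  have : ∑ k, D.invCov N k l * D.G N (plus, Fin.last N, y) k
      = (D.G N * D.invCov N) (plus, Fin.last N, y) l := by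
    rw [Matrix.mul_apply]
    exact Finset.sum_congr rfl fun k _ => mul_comm _ _
  rw [this, hinv, Matrix.one_apply, ite_smul, one_smul, zero_smul]

/-- Completing the square: the shift by the fields `ζ̄`, `ζ` produces the source terms, and the
covariance between the sources. -/
theorem pairing_invCov_shift (hA : D.A.IsHermitian) (hB : D.B.IsHermitian) (hQ : D.Q.IsHermitian)
    {N : ℕ} (hN : N ≠ 0) :
    -pairing D.ε (D.invCov N) (fun k => psiBarInt k - D.zetaBarInt N k)
        (fun k => psiInt k - D.zetaInt N k)
      = -pairing D.ε D.sourceKernel (fun x => form (sourceInt N (Sum.inr x)))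
          (fun x => form (sourceInt N (Sum.inl x)))
        + (-pairing D.ε (D.invCov N) psiBarInt psiInt + D.sourceTermInt N) := by
  have hdet : IsUnit (D.invCov N).det := by
    rw [D.det_invCov hA hB hN]; exact D.isUnit_one_add_W hA hB hQ
  have h1 : pairing D.ε (D.invCov N) psiBarInt (D.zetaInt N)
      = pairing D.ε 1 (fun x => form (sourceInt N (Sum.inl x)))
      (fun x => psiBarInt (minus, Fin.last N, x)) := by
    rw [pairing_eq_sum_mul, pairing_one]
    simp only [D.invCov_zetaInt hdet, mul_neg, Finset.mul_sum, mul_ite, mul_zero]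
    rw [Finset.sum_neg_distrib, Finset.sum_comm, ← Finset.sum_neg_distrib]
    congr 1
    refine Finset.sum_congr rfl fun y _ => ?_
    rw [Finset.sum_ite_eq', if_pos (Finset.mem_univ _)]
    exact (ι_anticomm _ _).symm
  have h2 : pairing D.ε (D.invCov N) (D.zetaBarInt N) psiInt
      = pairing D.ε 1 (fun x => form (sourceInt N (Sum.inr x)))
      (fun x => psiInt (plus, Fin.last N, x)) := by
    rw [pairing_eq_sum_mul', pairing_one]
    simp only [D.zetaBarInt_invCov hdet, Finset.sum_mul, ite_mul, zero_mul]
    rw [Finset.sum_comm]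
    congr 1
    refine Finset.sum_congr rfl fun y _ => ?_
    rw [Finset.sum_ite_eq, if_pos (Finset.mem_univ _)]
  have h3 : pairing D.ε (D.invCov N) (D.zetaBarInt N) (D.zetaInt N)
      = pairing D.ε D.sourceKernel (fun x => form (sourceInt N (Sum.inr x)))
          (fun x => form (sourceInt N (Sum.inl x))) := by
    rw [pairing_eq_sum_mul', pairing]
    simp only [D.zetaBarInt_invCov hdet, Finset.sum_mul, ite_mul, zero_mul]
    rw [Finset.sum_comm]
    congr 1
    refine Finset.sum_congr rfl fun y _ => ?_
    rw [Finset.sum_ite_eq, if_pos (Finset.mem_univ _), zetaInt, mul_neg, Finset.mul_sum,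
      ← Finset.sum_neg_distrib]
    refine Finset.sum_congr rfl fun y' _ => ?_
    rw [D.G_corner hA hB hQ hN, mul_smul_comm, neg_smul, neg_neg]
  rw [pairing_sub_sub, h1, h2, h3, sourceTermInt]
  abel

/-- The fields that combine the shift of the integration variables with the substitution of `ζ̄`, `ζ`
for the external variables. -/
def shiftInt (N : ℕ) : (Contour X N ⊕ Contour X N) ⊕ (Contour X N ⊕ Contour X N) →
    (Contour X N ⊕ Contour X N) ⊕ Source X → ℂ :=
  Sum.elim
    (fun i => Pi.single (Sum.inl i) 1 + Sum.elim (fun _ => 0) (-D.zeta N i))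
    (fun j => Sum.elim (fun _ => 0) (D.zeta N j))

theorem form_zeta_inl (N : ℕ) (k : Contour X N) :
    form (Sum.elim (fun _ => 0) (D.zeta N (Sum.inl k))
      : (Contour X N ⊕ Contour X N) ⊕ Source X → ℂ) = D.zetaBarInt N k := by
  simp only [zetaBarInt, form, ← map_smul, ← map_sum]
  congr 1
  funext j
  rcases j with j | j | j <;>
    simp [zeta, sourceInt, Finset.sum_apply, Pi.single_apply]

theorem form_zeta_inr (N : ℕ) (k : Contour X N) :
    form (Sum.elim (fun _ => 0) (D.zeta N (Sum.inr k))
      : (Contour X N ⊕ Contour X N) ⊕ Source X → ℂ) = D.zetaInt N k := by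
  simp only [zetaInt, form, ← map_smul, ← map_sum, ← map_neg]
  congr 1
  funext j
  rcases j with j | j | j <;>
    simp [zeta, sourceInt, Finset.sum_apply, Pi.single_apply]

theorem form_single_add_neg (N : ℕ) (i : Contour X N ⊕ Contour X N) :
    form (Pi.single (Sum.inl i) 1 + Sum.elim (fun _ => 0) (-D.zeta N i)
      : (Contour X N ⊕ Contour X N) ⊕ Source X → ℂ)
      = form (Pi.single (Sum.inl i) 1) - form (Sum.elim (fun _ => 0) (D.zeta N i)) := by
  rw [form, form, form, ← map_sub]
  congr 1
  funext j
  rcases j with j | j <;> simp [sub_eq_add_neg]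

theorem bos_action (heven : ∀ m m' : ℕ, Odd (m + m') → ∀ x y, D.v m m' x y = 0)
    (hconst : ∀ x y, D.v 0 0 x y = 0) (N : ℕ) : Bos (D.action N) :=
  ((Bos.sum _ _ fun _ _ => bos_normalPoly _ _ _ _ heven hconst).sub
    (Bos.sum _ _ fun _ _ => bos_normalPoly _ _ _ _ (D.adjVertex_even heven)
      (D.adjVertex_const hconst))).smul _

theorem subst_action (N : ℕ) :
    subst (fun i => Pi.single (Sum.inl i) 1) (-Complex.I • D.action N) = D.interactionInt N := by
  have h1 : ∀ k : Contour X N, subst (fun i => Pi.single (Sum.inl i : _ ⊕ Source X) (1 : ℂ))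
      (gen (Sum.inl k : Contour X N ⊕ Contour X N)) = psiBarInt k := fun k => subst_gen _ _
  have h2 : ∀ k : Contour X N, subst (fun i => Pi.single (Sum.inl i : _ ⊕ Source X) (1 : ℂ))
      (gen (Sum.inr k : Contour X N ⊕ Contour X N)) = psiInt k := fun k => subst_gen _ _
  rw [action, interactionInt]
  simp only [map_smul, map_sub, map_sum, map_normalPoly, psiBar, psi, h1, h2]
  rw [smul_smul, smul_sub, sub_eq_neg_add, ← neg_smul]
  congr 2 <;> ring

theorem bos_interactionInt (heven : ∀ m m' : ℕ, Odd (m + m') → ∀ x y, D.v m m' x y = 0)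
    (hconst : ∀ x y, D.v 0 0 x y = 0) (N : ℕ) : Bos (D.interactionInt N) :=
  ((Bos.sum _ _ fun _ _ => bos_normalPoly _ _ _ _ (D.adjVertex_even heven)
      (D.adjVertex_const hconst)).smul _).add
    ((Bos.sum _ _ fun _ _ => bos_normalPoly _ _ _ _ heven hconst).smul _)

/-- Integrals over spectators factor out. -/
theorem berezin_ofSpectators_mul {K J : Type*} [Fintype K] [Fintype J] [DecidableEq K]
    [DecidableEq J] (y : Grass J) (x : Grass ((K ⊕ K) ⊕ J)) :
    berezin (ofSpectators y * x) = y * berezin x := by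
  rw [berezin_eq Finset.univ.toList (Finset.nodup_toList _) (fun k => by simp),
    berezin_eq Finset.univ.toList (Finset.nodup_toList _) (fun k => by simp),
    listIntegral_mul_left _ (freeOf_ofSpectators _ _), map_mul, toSpectators_ofSpectators]

/-- At finite `N`, the approximation is the discretized generating functional, up to the factors
that come from the determinant and from completing the square. -/
theorem approx_eq (hε : 0 < D.ε) (hA : D.A.IsHermitian) (hB : D.B.IsHermitian)
    (hQ : D.Q.IsHermitian) (heven : ∀ m m' : ℕ, Odd (m + m') → ∀ x y, D.v m m' x y = 0)
    (hconst : ∀ x y, D.v 0 0 x y = 0) {N : ℕ} (hN : N ≠ 0) :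
    D.approx N = ((1 + D.W).det)⁻¹
      • (gexp (-pairing D.ε D.sourceKernel cMinus cPlus) * D.discreteZ N) := by
  have hdet : IsUnit (D.invCov N).det := by
    rw [D.det_invCov hA hB hN]; exact D.isUnit_one_add_W hA hB hQ
  have hGinv : (D.G N)⁻¹ = D.invCov N := Matrix.nonsing_inv_nonsing_inv _ hdet
  have hGdet : (D.G N).det = ((1 + D.W).det)⁻¹ := by
    rw [G, Matrix.det_nonsing_inv, D.det_invCov hA hB hN, Ring.inverse_eq_inv']
  have hsp : ofSpectators (K := Contour X N) (gexp (-pairing D.ε D.sourceKernel cMinus cPlus))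
      = gexp (-pairing D.ε D.sourceKernel (fun x => form (sourceInt N (Sum.inr x)))
          (fun x => form (sourceInt N (Sum.inl x)))) := by
    have hb : Bos (pairing D.ε D.sourceKernel (cMinus (X := X)) cPlus) := bos_pairing _ _ _ _
    rw [map_gexp hb.neg.2, map_neg, map_pairing]
    congr 3
    · funext x; exact subst_gen _ _
    · funext x; exact subst_gen _ _
  have hint : subst (D.shiftInt N)
      (gexp (-pairing D.ε (D.G N)⁻¹ (fun k => gen (Sum.inl (Sum.inl k)))
          (fun k => gen (Sum.inl (Sum.inr k))))
        * subst (fun i => Pi.single (Sum.inl i) 1 + Pi.single (Sum.inr i) 1)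
          (gexp (-Complex.I • D.action N)))
      = ofSpectators (gexp (-pairing D.ε D.sourceKernel cMinus cPlus))
        * gexp (-pairing D.ε (D.invCov N) psiBarInt psiInt
          + (D.sourceTermInt N + D.interactionInt N)) := by
    have hb : Bos (pairing D.ε (D.invCov N)
        (fun k => (gen (Sum.inl (Sum.inl k)) : Grass ((Contour X N ⊕ Contour X N)
          ⊕ (Contour X N ⊕ Contour X N))))
        (fun k => gen (Sum.inl (Sum.inr k)))) := bos_pairing _ _ _ _
    have hshift : subst (D.shiftInt N) (subst (fun i => Pi.single (Sum.inl i) 1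
        + Pi.single (Sum.inr i) 1) (-Complex.I • D.action N)) = D.interactionInt N := by
      rw [subst_subst, ← D.subst_action N]
      refine subst_congr (fun i => ?_) _
      simp only [Pi.add_apply, add_smul, Finset.sum_add_distrib, Pi.single_apply, ite_smul,
        one_smul, zero_smul, Finset.sum_ite_eq', Finset.mem_univ, if_true]
      funext j
      rcases j with j | j <;> simp [shiftInt]
    have hbar : ∀ k : Contour X N, subst (D.shiftInt N) (gen (Sum.inl (Sum.inl k)))
        = psiBarInt k - D.zetaBarInt N k := by
      intro k
      rw [subst_gen, ← D.form_zeta_inl]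
      exact D.form_single_add_neg N (Sum.inl k)
    have hunb : ∀ k : Contour X N, subst (D.shiftInt N) (gen (Sum.inl (Sum.inr k)))
        = psiInt k - D.zetaInt N k := by
      intro k
      rw [subst_gen, ← D.form_zeta_inr]
      exact D.form_single_add_neg N (Sum.inr k)
    have hact := (D.bos_action heven hconst N).smul (-Complex.I)
    rw [hGinv, map_mul, map_gexp hb.neg.2, map_neg, map_pairing, map_gexp hact.2,
      map_gexp (hact.2.map _), hshift, hsp]
    simp only [hbar, hunb]
    rw [D.pairing_invCov_shift hA hB hQ hN]
    have hbq : Bos (-pairing D.ε (D.invCov N) psiBarInt psiInt) := (bos_pairing _ _ _ _).neg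
    have hbs : Bos (D.sourceTermInt N) := (bos_pairing _ _ _ _).add (bos_pairing _ _ _ _)
    have hbv := D.bos_interactionInt heven hconst N
    have hbk : Bos (-pairing D.ε D.sourceKernel (fun x => form (sourceInt N (Sum.inr x)))
          (fun x => form (sourceInt N (Sum.inl x)))) := (bos_pairing _ _ _ _).neg
    rw [← gexp_add (hbk.add (hbq.add hbs)) hbv, ← gexp_add hbk (hbq.add (hbs.add hbv)), add_assoc,
      add_assoc]
  have hεc : (D.ε : ℂ) ≠ 0 := by exact_mod_cast hε.ne'
  rw [approx, gaussConv, map_smul, subst_berezin (D.zeta N) (-D.zeta N)]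
  change _ • berezin (subst (D.shiftInt N) _) = _
  rw [hint]
  rw [berezin_ofSpectators_mul, D.berezin_contour hε hA hB heven hconst, mul_smul_comm, smul_smul,
    hGdet, mul_assoc, inv_mul_cancel₀ (pow_ne_zero _ hεc), mul_one]

end Data

end Shift

/-! ### Adjoints, and the limit of the time discretization -/

section Limit

open Filter Topology

variable {X : Type*} [Fintype X] [LinearOrder X]

theorem secondQuant_conjTranspose (ε : ℝ) (M : Matrix X X ℂ) :
    (secondQuant ε M)ᴴ = secondQuant ε Mᴴ := by
  simp only [secondQuant, pairing, Matrix.conjTranspose_smul, Matrix.conjTranspose_sum,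
    Matrix.conjTranspose_mul, creat, Matrix.conjTranspose_conjTranspose,
    Matrix.conjTranspose_apply]
  rw [Finset.sum_comm, Complex.star_def, Complex.conj_ofReal]

theorem normalPoly_conjTranspose (ε : ℝ) (v : (m m' : ℕ) → (Fin m → X) → (Fin m' → X) → ℂ) :
    (normalPoly ε v (creat ε) (annih ε))ᴴ = normalPoly ε (adjVertex v) (creat ε) (annih ε) := by
  have hprod : ∀ (n : ℕ) (a : X → Matrix (Finset X) (Finset X) ℂ) (x : Fin n → X),
      ((List.ofFn fun i => a (x i)).prod)ᴴ = (List.ofFn fun i => (a ((x ∘ Fin.rev) i))ᴴ).prod := by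
    intro n a x
    rw [Matrix.conjTranspose_list_prod]
    congr 1
    refine List.ext_getElem (by simp) fun i h _ => ?_
    simp only [List.length_reverse, List.length_map, List.length_ofFn] at h
    simp only [List.getElem_reverse, List.getElem_map, List.getElem_ofFn, List.length_map,
      List.length_ofFn, Function.comp_apply]
    congr 3
    exact Fin.ext (by simp only [Fin.val_rev]; omega)
  have hannih : ∀ x, (annih ε x : Matrix (Finset X) (Finset X) ℂ)ᴴ = creat ε x := fun _ => rfl
  have hcreat : ∀ x, (creat ε x : Matrix (Finset X) (Finset X) ℂ)ᴴ = annih ε x :=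
    fun _ => Matrix.conjTranspose_conjTranspose _
  simp only [normalPoly, Matrix.conjTranspose_smul, Matrix.conjTranspose_sum,
    Matrix.conjTranspose_mul, hprod, hannih, hcreat]
  rw [Finset.sum_comm]
  refine Finset.sum_congr rfl fun m _ => Finset.sum_congr rfl fun m' _ => ?_
  rw [Finset.sum_comm]
  refine Fintype.sum_equiv (Equiv.arrowCongr Fin.revPerm (Equiv.refl X)) _ _ fun x => ?_
  refine Fintype.sum_equiv (Equiv.arrowCongr Fin.revPerm (Equiv.refl X)) _ _ fun y => ?_
  have hrev : ∀ (n : ℕ) (z : Fin n → X),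
      (Equiv.arrowCongr Fin.revPerm (Equiv.refl X)) z = z ∘ Fin.rev := fun n z => rfl
  have hrr : ∀ (n : ℕ) (z : Fin n → X), (z ∘ Fin.rev) ∘ Fin.rev = z := fun n z => by
    funext i; simp
  simp only [hrev, adjVertex, hrr, Function.comp_apply, star_mul', star_pow]
  rw [Complex.star_def, Complex.conj_ofReal, add_comm m' m]

/-- Convergence of the coefficients implies convergence in every seminorm. -/
theorem tendsto_seminorm_sum {E ι : Type*} [AddCommGroup E] [Module ℂ E] [Fintype ι]
    (p : Seminorm ℂ E) (Θ : ι → E) (c : ℕ → ι → ℂ) (c' : ι → ℂ)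
    (h : ∀ i, Tendsto (fun N => c N i) atTop (𝓝 (c' i))) :
    Tendsto (fun N => p (∑ i, c N i • Θ i - ∑ i, c' i • Θ i)) atTop (𝓝 0) := by
  have hlim : Tendsto (fun N => ∑ i, ‖c N i - c' i‖ * p (Θ i)) atTop (𝓝 0) := by
    have : Tendsto (fun N => ∑ i, ‖c N i - c' i‖ * p (Θ i)) atTop
        (𝓝 (∑ i, ‖c' i - c' i‖ * p (Θ i))) :=
      tendsto_finsetSum _ fun i _ => ((h i).sub_const _).norm.mul_const _
    simpa using this
  refine squeeze_zero (fun N => apply_nonneg p _) (fun N => ?_) hlim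
  rw [← Finset.sum_sub_distrib]
  refine (Finset.le_sum_of_subadditive p (map_zero p).le (map_add_le_add p) _ _).trans
    (Finset.sum_le_sum fun i _ => ?_)
  rw [← sub_smul, map_smul_eq_mul]

/-- Only the numerical factors `A`, `B` depend on the discretization: the trace is a finite linear
combination of fixed Grassmann elements, with coefficients bilinear in `A` and `B`. -/
theorem trace_lift_eq_sum {J : Type*} (A B R : Matrix (Finset X) (Finset X) ℂ)
    (S : Matrix (Finset X) (Finset X) (Grass J)) :
    Matrix.trace (lift A * S * lift B * lift R)
      = ∑ i : (Finset X × Finset X) × (Finset X × Finset X),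
          (A i.1.1 i.1.2 * B i.2.1 i.2.2) • (R i.2.2 i.1.1 • S i.1.2 i.2.1) := by
  simp only [Matrix.trace, Matrix.diag_apply, Matrix.mul_apply, lift, Matrix.map_apply,
    ← Algebra.smul_def, ← Algebra.commutes, Finset.smul_sum, smul_smul, Fintype.sum_prod_type]
  refine Finset.sum_congr rfl fun a _ => ?_
  rw [Finset.sum_comm]
  conv_rhs => rw [Finset.sum_comm]
  refine Finset.sum_congr rfl fun c _ => ?_
  rw [Finset.sum_comm]
  refine Finset.sum_congr rfl fun b _ => Finset.sum_congr rfl fun d _ => ?_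
  congr 1
  ring

namespace Data

variable (D : Data X)

theorem H_conjTranspose (hA : D.A.IsHermitian) (hB : D.B.IsHermitian) :
    D.Hᴴ = secondQuant D.ε D.Aplus + normalPoly D.ε (adjVertex D.v) (creat D.ε) (annih D.ε) := by
  rw [H, Matrix.conjTranspose_add, V, normalPoly_conjTranspose, ← D.aminus_conjTranspose hA hB,
    ← secondQuant_conjTranspose]

attribute [local instance] Matrix.linftyOpNormedRing Matrix.linftyOpNormedAlgebra

theorem tendsto_forwardStep (heven : ∀ m m' : ℕ, Odd (m + m') → ∀ x y, D.v m m' x y = 0)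
    (hconst : ∀ x y, D.v 0 0 x y = 0) (S S' : Finset X) :
    Tendsto (fun N => (D.forwardStep N ^ N) S S') atTop
      (𝓝 (NormedSpace.exp ((-Complex.I * D.T) • D.H) S S')) := by
  have h := tendsto_stepOp_pow (ε := D.ε) (-Complex.I • D.Aminus) D.v (-Complex.I) heven hconst D.T
  rw [secondQuant, pairing_smul, ← smul_add, smul_smul, mul_comm] at h
  exact ((continuous_apply_apply S S').tendsto _).comp h

theorem tendsto_backwardStep (hA : D.A.IsHermitian) (hB : D.B.IsHermitian)
    (heven : ∀ m m' : ℕ, Odd (m + m') → ∀ x y, D.v m m' x y = 0)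
    (hconst : ∀ x y, D.v 0 0 x y = 0) (S S' : Finset X) :
    Tendsto (fun N => (D.backwardStep N ^ N) S S') atTop
      (𝓝 (NormedSpace.exp ((Complex.I * D.T) • D.Hᴴ) S S')) := by
  have h := tendsto_stepOp_pow (ε := D.ε) (Complex.I • D.Aplus) (adjVertex D.v) Complex.I
    (D.adjVertex_even heven) (D.adjVertex_const hconst) D.T
  rw [secondQuant, pairing_smul, ← smul_add, smul_smul, mul_comm, ← secondQuant,
    ← D.H_conjTranspose hA hB] at h
  exact ((continuous_apply_apply S S').tendsto _).comp h

theorem Z_eq : D.Z = Matrix.trace (lift (NormedSpace.exp ((Complex.I * D.T) • D.Hᴴ))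
    * D.sourceInsertion * lift (NormedSpace.exp ((-Complex.I * D.T) • D.H)) * lift D.rho0) := by
  rw [Z, sourceInsertion, sourceExp, ← mul_assoc]
  rfl

theorem tendsto_discreteZ (hA : D.A.IsHermitian) (hB : D.B.IsHermitian)
    (heven : ∀ m m' : ℕ, Odd (m + m') → ∀ x y, D.v m m' x y = 0)
    (hconst : ∀ x y, D.v 0 0 x y = 0) (p : Seminorm ℂ (Grass (Source X))) :
    Tendsto (fun N => p (D.discreteZ N - D.Z)) atTop (𝓝 0) := by
  simp only [Z_eq, discreteZ, trace_lift_eq_sum]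
  exact tendsto_seminorm_sum p _ _ _ fun i =>
    (D.tendsto_backwardStep hA hB heven hconst _ _).mul (D.tendsto_forwardStep heven hconst _ _)

end Data

end Limit

end

end Keldysh

open Keldysh Filter Topology
open scoped ComplexOrder

theorem theorem2 {X : Type*} [Fintype X] [LinearOrder X] (D : Data X)
    (hε : 0 < D.ε) (hβ : 0 < D.β) (hT : 0 < D.T)
    (hA : D.A.IsHermitian) (hB : D.B.PosSemidef) (hQ : D.Q.IsHermitian)
    -- the vertices are antisymmetric in the annihilation and in the creation variables
    (hanti : ∀ (m m' : ℕ) (σ : Equiv.Perm (Fin m)) (τ : Equiv.Perm (Fin m'))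
      (x : Fin m → X) (y : Fin m' → X),
      D.v m m' (x ∘ σ) (y ∘ τ)
        = ((Equiv.Perm.sign σ : ℤ) : ℂ) * ((Equiv.Perm.sign τ : ℤ) : ℂ) * D.v m m' x y)
    -- the interaction is even, and has no constant term
    (heven : ∀ m m' : ℕ, Odd (m + m') → ∀ x y, D.v m m' x y = 0)
    (hconst : ∀ x y, D.v 0 0 x y = 0)
    (hnormal : IsStarNormal D.V) :
    -- the matrices of which inverses are taken are invertible
    (∀ N : ℕ, 1 ≤ N → IsUnit (D.invCov N).det) ∧ IsUnit (1 + D.W).det ∧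
    -- the limit exists in every norm on the source algebra, and gives the generating functional
    ∃ L : Grass (Source X),
      (∀ p : Seminorm ℂ (Grass (Source X)),
        Tendsto (fun N : ℕ => p (D.approx N - L)) atTop (𝓝 0)) ∧
      D.Z = (1 + D.W).det • (gexp (pairing D.ε D.sourceKernel cMinus cPlus) * L) := by
  have hBh := hB.isHermitian
  have hW := D.isUnit_one_add_W hA hBh hQ
  refine ⟨fun N hN => ?_, hW, ((1 + D.W).det)⁻¹
      • (gexp (-pairing D.ε D.sourceKernel cMinus cPlus) * D.Z), fun p => ?_, ?_⟩
  · rw [D.det_invCov hA hBh (by omega)]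
    exact hW
  · -- the approximants depend linearly on the discretized generating functional
    let Φ : Grass (Source X) →ₗ[ℂ] Grass (Source X) := ((1 + D.W).det)⁻¹
      • LinearMap.mulLeft ℂ (gexp (-pairing D.ε D.sourceKernel cMinus cPlus))
    refine (D.tendsto_discreteZ hA hBh heven hconst (p.comp Φ)).congr' ?_
    filter_upwards [eventually_ne_atTop 0] with N hN
    rw [D.approx_eq hε hA hBh hQ heven hconst hN, Seminorm.comp_apply, map_sub]
    rfl
  · have hb : Bos (pairing D.ε D.sourceKernel (cMinus (X := X)) cPlus) := bos_pairing _ _ _ _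
    have hone := gexp_neg_mul_gexp hb.neg
    rw [neg_neg] at hone
    rw [mul_smul_comm, smul_smul, mul_inv_cancel₀ hW.ne_zero, one_smul, ← mul_assoc, hone, one_mul]
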